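/- Let $L\ge 1$ be an integer. Let $H$ be a semi-infinite Jacobi matrix with $L\times L$ matrix entries, acting on sequences $\phi=(\phi_n)_{n\ge 1}$, $\phi_n\in\mathbb C^L$, by $$(H\phi)_n=T_{n+1}\phi_{n+1}+V_n\phi_n+T_n^*\phi_{n-1}\quad(n\ge 2),\qquad (H\phi)_1=T_2\phi_2+V_1\phi_1 ,$$ where the $V_n\in\mathbb C^{L\times L}$ ($n\ge 1$) are self-adjoint and the $T_n\in\mathbb C^{L\times L}$ ($n\ge 2$) are invertible. Assume that $H$ is in the limit point case, i.e. that it is essentially self-adjoint on the finitely supported sequences in $\ell^2(\mathbb N)\otimes\mathbb C^L$; its self-adjoint closure is again denoted by $H$. Let $\pi_n:\mathbb C^L\to\ell^2(\mathbb N)\otimes\mathbb C^L$ be the partial isometry onto the $n$th site. Let $N\in\mathbb N$, let $W_1,\dots,W_N\in\mathbb C^{L\times L}$ be positive semidefinite, and for $\mu\in\mathbb R$ set $$H(\mu)=H+\mu\sum_{n=1}^N\pi_nW_n\pi_n^* .$$ Let $H^N(\mu)$ be the $NL\times NL$ matrix obtained by projecting $H(\mu)$ to the first $N$ sites, that is,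 the block tridiagonal Hermitian matrix with diagonal blocks $V_n+\mu W_n$ ($1\le n\le N$), blocks $T_2,\dots,T_N$ above the diagonal and $T_2^*,\dots,T_N^*$ below it. Denote by $\lambda_1(\mu)\ge\dots\ge\lambda_{NL}(\mu)$ its eigenvalues, counted with multiplicity; they are non-decreasing in $\mu$. Suppose that $W_n>0$ and $W_{n+1}>0$ for some $n\in\{1,\dots,N-1\}$. Let $E\in\mathbb R$, and let $I=[\mu_0,\mu_1]$ be so large that at least $2L$ eigenvalues of $H^N(\mu)$ pass by $E$ as $\mu$ varies in $I$, meaning that $\lambda_j(\mu_0)<E<\lambda_j(\mu_1)$ for at least $2L$ indices $j$. Then, for every $\mu\in\mathbb R$, the operator $H(\mu)$ is self-adjoint and has a matrix-valued spectral measure $\rho(\mu)$ at the first site, i.e. a finite positive $L\times L$ matrix-valued Borel measure on $\mathbb R$ with $$\pi_1^*(H(\mu)-z)^{-1}\pi_1=\int_{\mathbb R}\frac{\rho(\mu)(dx)}{x-z}\qquad(\operatorname{Im} z>0);$$ the map $\mu\mapsto\operatorname{Tr}\rho(\mu)$ is measurable, and the averaged spectral measure $$\overline\rho=\int_{\mu_0}^{\mu_1}d\mu\;\operatorname{Tr}\rho(\mu)$$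 is equivalent to the Lebesgue measure in a neighborhood of $E$: there is an open set $U\ni E$ on which $\overline\rho$ and the Lebesgue measure are mutually absolutely continuous, and in fact there are constants $c,C>0$ such that $c\,|B|\le\overline\rho(B)\le C\,|B|$ for all Borel sets $B\subseteq U$. -/

import Mathlib

open Matrix MeasureTheory
open scoped ENNReal ComplexOrder

noncomputable section

/-- The data of a semi-infinite Jacobi matrix with complex `L × L` matrix entries. The sites are
`0, 1, 2, …`; the diagonal blocks `V n` are self-adjoint and the invertible block `T n` couples the
sites `n` and `n + 1`. The left boundary condition is the Dirichlet one (a self-adjoint left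
boundary condition can be absorbed in `V 0`). -/
structure MatrixJacobi (L : ℕ) where
  T : ℕ → Matrix (Fin L) (Fin L) ℂ
  V : ℕ → Matrix (Fin L) (Fin L) ℂ
  isUnit_T : ∀ n, IsUnit (T n)
  isHermitian_V : ∀ n, (V n).IsHermitian

/-- The fibre `ℂ^L` with its Euclidean norm. -/
abbrev Fibre (L : ℕ) : Type := EuclideanSpace ℂ (Fin L)

/-- The Hilbert space `ℓ²(ℕ) ⊗ ℂ^L`. -/
abbrev JacobiSpace (L : ℕ) : Type := lp (fun _ : ℕ => Fibre L) 2

/-- The partial isometry `π_n` from `ℂ^L` onto the `n`-th site. Its adjoint is `φ ↦ φ n`. -/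
abbrev sitePi {L : ℕ} (n : ℕ) : Fibre L →ₗ[ℂ] JacobiSpace L :=
  lp.lsingle (𝕜 := ℂ) (E := fun _ : ℕ => Fibre L) 2 n

/-- The linear subspace of finitely supported states. -/
def finiteStates (L : ℕ) : Submodule ℂ (JacobiSpace L) where
  carrier := {φ | {n : ℕ | φ n ≠ 0}.Finite}
  zero_mem' := by simp
  add_mem' := by
    intro φ ψ hφ hψ
    refine (hφ.union hψ).subset ?_
    intro n hn
    by_contra h
    have h1 : φ n = 0 := by_contra fun h1 => h (Or.inl h1)
    have h2 : ψ n = 0 := by_contra fun h2 => h (Or.inr h2)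
    exact hn (by simp [h1, h2])
  smul_mem' := by
    intro c φ hφ
    refine Set.Finite.subset hφ ?_
    intro n hn h
    exact hn (by simp [h])

namespace MatrixJacobi

variable {L : ℕ} (J : MatrixJacobi L)

/-- The Jacobi difference expression
`(H φ)_n = T_n φ_{n+1} + V_n φ_n + T_{n-1}^* φ_{n-1}`, without the last term at the first site. -/
def expr (φ : ℕ → Fibre L) : ℕ → Fibre L
  | 0 => toEuclideanLin (J.T 0) (φ 1) + toEuclideanLin (J.V 0) (φ 0)
  | n + 1 => toEuclideanLin (J.T (n + 1)) (φ (n + 2)) + toEuclideanLin (J.V (n + 1)) (φ (n + 1))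
      + toEuclideanLin (J.T n)ᴴ (φ n)

lemma expr_memℓp (φ : ℕ → Fibre L) (hφ : {n : ℕ | φ n ≠ 0}.Finite) :
    Memℓp (J.expr φ) 2 := by
  suffices h : Memℓp (J.expr φ) 0 from h.of_exponent_ge zero_le
  refine memℓp_zero ?_
  obtain ⟨m, hm⟩ := hφ.bddAbove
  have hz : ∀ k, m < k → φ k = 0 := by
    intro k hk
    by_contra h
    exact absurd (hm h) (not_le.mpr hk)
  refine (Set.finite_Iic (m + 1)).subset ?_
  intro n hn
  by_contra h
  have hlt : m + 1 < n := not_le.mp h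
  obtain ⟨k, rfl⟩ : ∃ k, n = k + 1 := ⟨n - 1, by omega⟩
  exact hn (by simp [expr, hz k (by omega), hz (k + 1) (by omega), hz (k + 2) (by omega)])

/-- The minimal operator: the Jacobi difference expression on finitely supported states. -/
def minimal : JacobiSpace L →ₗ.[ℂ] JacobiSpace L where
  domain := finiteStates L
  toFun :=
    { toFun := fun φ => ⟨J.expr (φ : JacobiSpace L), J.expr_memℓp _ φ.2⟩
      map_add' := by
        intro φ ψ
        refine lp.ext (funext fun n => ?_)
        rw [lp.coeFn_add, Pi.add_apply]
        cases n
        · simp only [expr, Submodule.coe_add, lp.coeFn_add, Pi.add_apply, map_add]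
          abel
        · simp only [expr, Submodule.coe_add, lp.coeFn_add, Pi.add_apply, map_add]
          abel
      map_smul' := by
        intro c φ
        refine lp.ext (funext fun n => ?_)
        rw [lp.coeFn_smul, Pi.smul_apply]
        cases n <;> simp [expr, smul_add] }

/-- The limit point case: the Jacobi matrix is essentially self-adjoint on the finitely supported
states, i.e. its closure is a self-adjoint operator. -/
def LimitPoint : Prop := IsSelfAdjoint J.minimal.closure

/-- The local perturbation `∑_{n < N} π_n W_n π_n^*`. -/
def localPerturbation (N : ℕ) (W : ℕ → Matrix (Fin L) (Fin L) ℂ) :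
    JacobiSpace L →ₗ[ℂ] JacobiSpace L where
  toFun φ := ∑ n ∈ Finset.range N, sitePi n (toEuclideanLin (W n) (φ n))
  map_add' φ ψ := by simp [Finset.sum_add_distrib]
  map_smul' c φ := by simp [Finset.smul_sum]

/-- The operator `H(μ) = H + μ ∑_{n < N} π_n W_n π_n^*`, where `H` is the closure of the minimal
operator; its domain is that of `H`. -/
def hamiltonian (N : ℕ) (W : ℕ → Matrix (Fin L) (Fin L) ℂ) (μ : ℝ) :
    JacobiSpace L →ₗ.[ℂ] JacobiSpace L :=
  ((μ : ℂ) • localPerturbation N W) +ᵥ J.minimal.closure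

/-- The finite Jacobi matrix `H^N(μ)`: the projection of `H(μ)` to the first `N` sites, i.e. the
block tridiagonal matrix with diagonal blocks `V_n + μ W_n`, blocks `T_n` above the diagonal and
`T_n^*` below it. -/
def finiteHamiltonian (N : ℕ) (W : ℕ → Matrix (Fin L) (Fin L) ℂ) (μ : ℝ) :
    Matrix (Fin N × Fin L) (Fin N × Fin L) ℂ :=
  Matrix.of fun p q =>
    if (p.1 : ℕ) = q.1 then (J.V p.1 + (μ : ℂ) • W p.1) p.2 q.2
    else if (q.1 : ℕ) = p.1 + 1 then (J.T p.1) p.2 q.2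
    else if (p.1 : ℕ) = q.1 + 1 then (J.T q.1)ᴴ p.2 q.2
    else 0

lemma finiteHamiltonian_isHermitian (N : ℕ) (W : ℕ → Matrix (Fin L) (Fin L) ℂ)
    (hW : ∀ n < N, (W n).PosSemidef) (μ : ℝ) : (J.finiteHamiltonian N W μ).IsHermitian := by
  refine Matrix.IsHermitian.ext fun p q => ?_
  have hV := fun n i j => (J.isHermitian_V n).apply i j
  have hWs := fun i j => (hW p.1 p.1.2).isHermitian.apply i j
  simp only [finiteHamiltonian, Matrix.of_apply]
  by_cases h1 : (p.1 : ℕ) = q.1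
  · rw [if_pos h1.symm, if_pos h1, ← h1]
    have a := hV p.1 p.2 q.2
    have b := hWs p.2 q.2
    simp only [Matrix.add_apply, Matrix.smul_apply, smul_eq_mul, star_add, star_mul']
    rw [a, b]
    simp
  · by_cases h2 : (q.1 : ℕ) = p.1 + 1
    · have h3 : ¬ (p.1 : ℕ) = q.1 + 1 := by omega
      rw [if_neg (Ne.symm h1), if_neg h3, if_pos h2, if_neg h1, if_pos h2]
      simp [Matrix.conjTranspose_apply]
    · by_cases h3 : (p.1 : ℕ) = q.1 + 1
      · rw [if_neg (Ne.symm h1), if_pos h3, if_neg h1, if_neg h2, if_pos h3]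
        simp [Matrix.conjTranspose_apply]
      · rw [if_neg (Ne.symm h1), if_neg h3, if_neg h2, if_neg h1, if_neg h2, if_neg h3]
        simp

/-- The number of eigenvalues of `H^N(μ)` (with multiplicity) that pass by `E` as the coupling
varies from `μ₀` to `μ₁`: those whose branch, in the ordering of the eigenvalues by size, starts
strictly below `E` and ends strictly above `E`. -/
def passingEigenvalues (N : ℕ) (W : ℕ → Matrix (Fin L) (Fin L) ℂ)
    (hW : ∀ n < N, (W n).PosSemidef) (μ₀ μ₁ E : ℝ) : ℕ :=
  {j : Fin (Fintype.card (Fin N × Fin L)) |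
    (J.finiteHamiltonian_isHermitian N W hW μ₀).eigenvalues₀ j < E ∧
    E < (J.finiteHamiltonian_isHermitian N W hW μ₁).eigenvalues₀ j}.ncard

end MatrixJacobi

/-- A finite positive matrix-valued Borel measure on `ℝ`. -/
structure MatrixMeasure (L : ℕ) where
  toVectorMeasure : VectorMeasure ℝ (Matrix (Fin L) (Fin L) ℂ)
  posSemidef : ∀ B, (toVectorMeasure B).PosSemidef

namespace MatrixMeasure

variable {L : ℕ} (ρ : MatrixMeasure L)

/-- The finite positive measure `B ↦ f (ρ B)` for a continuous additive functional `f` that is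
non-negative on positive semidefinite matrices. -/
def functional (f : Matrix (Fin L) (Fin L) ℂ →+ ℝ) (hf : Continuous f)
    (h0 : ∀ M : Matrix (Fin L) (Fin L) ℂ, M.PosSemidef → 0 ≤ f M) : Measure ℝ :=
  SignedMeasure.toMeasureOfZeroLE (ρ.toVectorMeasure.mapRange f hf) Set.univ MeasurableSet.univ
    (VectorMeasure.le_restrict_univ_iff_le _ _ |>.mpr
      (VectorMeasure.le_iff.mpr fun B _ => by
        simpa using h0 _ (ρ.posSemidef B)))

/-- The positive measure `v^* ρ v`. -/
def quad (v : Fin L → ℂ) : Measure ℝ :=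
  ρ.functional
    { toFun := fun M => (star v ⬝ᵥ (M *ᵥ v)).re
      map_zero' := by simp
      map_add' := fun M M' => by simp [Matrix.add_mulVec, dotProduct_add] }
    (Complex.continuous_re.comp
      (Continuous.dotProduct continuous_const (continuous_id.matrix_mulVec continuous_const)))
    (fun M hM => by simpa using (Complex.le_def.mp (hM.dotProduct_mulVec_nonneg v)).1)

/-- The positive measure `Tr ρ`. -/
def trace : Measure ℝ :=
  ρ.functional
    { toFun := fun M => (Matrix.trace M).re
      map_zero' := by simp
      map_add' := fun M M' => by simp }
    (Complex.continuous_re.comp (continuous_id.matrix_trace))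
    (fun M hM => by simpa using (Complex.le_def.mp hM.trace_nonneg).1)

end MatrixMeasure

/-- `R` is the bounded resolvent `(A - z)⁻¹` of the partially defined operator `A`. -/
def IsResolvent {L : ℕ} (A : JacobiSpace L →ₗ.[ℂ] JacobiSpace L) (z : ℂ)
    (R : JacobiSpace L →L[ℂ] JacobiSpace L) : Prop :=
  (∀ f : JacobiSpace L, ∃ u : A.domain, (u : JacobiSpace L) = R f ∧ A u - z • (u : JacobiSpace L) = f)
  ∧ ∀ u : A.domain, R (A u - z • (u : JacobiSpace L)) = u

/-- `ρ` is the matrix-valued spectral measure of `A` at the first site: the measure in the Herglotz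
representation `π^* (A - z)⁻¹ π = ∫ ρ(dx) / (x - z)`, `Im z > 0`, of the Green matrix at the first
site (tested against all vectors `v` of the fibre). It is unique. -/
def IsSpectralMeasure {L : ℕ} (A : JacobiSpace L →ₗ.[ℂ] JacobiSpace L) (ρ : MatrixMeasure L) :
    Prop :=
  ∀ z : ℂ, 0 < z.im → ∃ R : JacobiSpace L →L[ℂ] JacobiSpace L, IsResolvent A z R ∧
    ∀ v : Fibre L, inner ℂ (sitePi 0 v) (R (sitePi 0 v)) = ∫ x : ℝ, ((x : ℂ) - z)⁻¹ ∂(ρ.quad v)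

open Classical in
/-- The matrix-valued spectral measure of `A` (zero if there is none). -/
def spectralMeasure {L : ℕ} (A : JacobiSpace L →ₗ.[ℂ] JacobiSpace L) : MatrixMeasure L :=
  if h : ∃ ρ, IsSpectralMeasure A ρ then h.choose else ⟨0, fun _ => Matrix.PosSemidef.zero⟩

/-- The averaged spectral measure `∫_{[μ₀, μ₁]} dμ Tr ρ(μ)`, where `ρ(μ)` is the spectral measure
of `H(μ)`. -/
def averagedSpectralMeasure {L : ℕ} (J : MatrixJacobi L) (N : ℕ)
    (W : ℕ → Matrix (Fin L) (Fin L) ℂ) (μ₀ μ₁ : ℝ) : Measure ℝ :=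
  (volume.restrict (Set.Icc μ₀ μ₁)).bind fun μ => (spectralMeasure (J.hamiltonian N W μ)).trace

end

/-! By Stieltjes inversion, the averaged measure has a density between two positive constants near
`E` as soon as the `μ`-integral of `Im Tr G(x + iε)`, with `G` the Green matrix of `H(μ)` at the
first site, is bounded above and below for `x` near `E` and small `ε > 0`. Such bounds are proved
for the truncations to `M > N` sites, uniformly in `M` (`exists_bounds_integral_truncGreen`), and
then `M` tends to infinity.

For a truncation and `z = x + iε`, let `φ` run over the columns of the resolvent `(H^M(μ) - z)⁻¹`.
The identity `im_trace_inv_mul` expresses two quantities through these columns. `Im Tr G` is `ε ∑ ‖φ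
0‖²`. The imaginary part of the `μ`-derivative of `log det (z - H^M(μ))` is `ε` times the sum of the
quadratic forms `∑_{n < N} ⟨φ n, W n φ n⟩`. Each column solves the Jacobi equation with a source at
a single site. Transfer estimates bound `φ n` for `n < N` by `φ 0`; backwards they bound `φ 0` by
two neighbouring values, which are controlled by the form where two consecutive `W` are positive
definite (`exists_perturbForm_comparison`). So the two quantities are comparable, up to an error of
order `ε N L` from the sources in the first `N` sites.

It remains to bound the total winding of `det (z - H^M(μ))` over `[μ₀, μ₁]`
(`eventually_winding_bounds`). A Schur complement removes the sites beyond `N`: up to a constant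
factor, the determinant is that of `z - H^N(μ) + P S Pᴴ`, where the `L × L` matrix `S` has positive
imaginary part and does not depend on `μ`. On `d × d` matrices with positive imaginary part there is
a continuous `log det` with imaginary part in `[0, dπ]` (`exists_isLogDet`). Hence the winding is at
most `NLπ`. Dropping `P S Pᴴ` changes it by at most `Lπ`, because the quotient of the determinants
is a constant times the determinant of an `L × L` matrix of the same kind. Without that term, an
eigenvalue passing by `E` turns `arg (z - λ)` from near `0` to near `π`, so `2L` of them give almost
`2Lπ`. The winding is therefore bounded away from zero.

The limit `M → ∞` rests on strong resolvent convergence, the finitely supported states being a core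
(`tendsto_truncGreen`). The same limit, with tightness and polarization, produces the matrix-valued
spectral measure. -/

noncomputable section

/-! ### Logarithms of determinants of matrices with positive imaginary part -/

section LogDet

open Complex Filter Topology

/-- The imaginary part of the quadratic form of `K` is positive definite. -/
def ImPos {n : Type*} [Fintype n] (K : Matrix n n ℂ) : Prop :=
  ∀ v : n → ℂ, v ≠ 0 → 0 < (star v ⬝ᵥ (K *ᵥ v)).im

/-- The values lie in `2πiℤ`, which is discrete, so a continuous function cannot leave its value on
a preconnected set. This is how two branches of a logarithm are compared below. -/
lemma eq_of_exp_sub_eq_one {α : Type*} [TopologicalSpace α] {s : Set α} (hs : IsPreconnected s)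
    {f : α → ℂ} (hf : ContinuousOn f s) (h : ∀ x ∈ s, exp (f x) = 1) {x y : α} (hx : x ∈ s)
    (hy : y ∈ s) : f x = f y := by
  have h2 : (2 * Real.pi * I : ℂ) ≠ 0 := by simp [Real.pi_ne_zero]
  have hg : ContinuousOn (fun x => (f x / (2 * Real.pi * I)).re) s :=
    continuous_re.comp_continuousOn (hf.div_const _)
  have key : ∀ x ∈ s, ∃ n : ℤ, f x = n * (2 * Real.pi * I) := fun x hx => exp_eq_one_iff.mp (h x hx)
  have hmap : Set.MapsTo (fun x => (f x / (2 * Real.pi * I)).re) s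
      (Set.range ((↑) : ℤ → ℝ)) := by
    intro x hx
    obtain ⟨n, hn⟩ := key x hx
    exact ⟨n, by simp only [hn, mul_div_cancel_right₀ _ h2]; simp⟩
  have hdisc : DiscreteTopology (Set.range ((↑) : ℤ → ℝ)) :=
    Int.isClosedEmbedding_coe_real.toIsEmbedding.toHomeomorph.symm.isEmbedding.discreteTopology
  have := hs.constant_of_mapsTo ⟨hdisc⟩ hg hmap hx hy
  obtain ⟨n, hn⟩ := key x hx
  obtain ⟨m, hm⟩ := key y hy
  simp only [hn, hm, mul_div_cancel_right₀ _ h2] at this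
  rw [hn, hm]
  have h3 : (n : ℤ) = m := by
    have : ((n : ℂ)).re = ((m : ℂ)).re := this
    simpa using this
  rw [h3]

lemma ImPos.isUnit_det {n : Type*} [Fintype n] [DecidableEq n] {K : Matrix n n ℂ} (h : ImPos K) :
    IsUnit K.det := by
  rw [isUnit_iff_ne_zero]
  intro h0
  obtain ⟨v, hv, hKv⟩ := Matrix.exists_mulVec_eq_zero_iff.mpr h0
  have := h v hv
  simp [hKv] at this

lemma ImPos.submatrix {n m : Type*} [Fintype n] [Fintype m] {K : Matrix n n ℂ} (h : ImPos K)
    (e : m ≃ n) : ImPos (K.submatrix e e) := by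
  intro v hv
  have h1 : v ∘ e.symm ≠ 0 := by
    intro h0
    apply hv
    funext i
    simpa using congrFun h0 (e i)
  convert h (v ∘ e.symm) h1 using 2
  rw [Matrix.submatrix_mulVec_equiv]
  simp only [dotProduct, Function.comp]
  exact Fintype.sum_equiv e _ _ (by simp)

lemma ImPos.add {n : Type*} [Fintype n] {K S : Matrix n n ℂ} (h : ImPos K)
    (hS : ∀ v : n → ℂ, 0 ≤ (star v ⬝ᵥ (S *ᵥ v)).im) : ImPos (K + S) := by
  intro v hv
  rw [add_mulVec, dotProduct_add, add_im]
  linarith [h v hv, hS v]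

lemma ImPos.nonneg {n : Type*} [Fintype n] {K : Matrix n n ℂ} (h : ImPos K) (v : n → ℂ) :
    0 ≤ (star v ⬝ᵥ (K *ᵥ v)).im := by
  by_cases hv : v = 0
  · simp [hv]
  · exact (h v hv).le

lemma ImPos.toBlocks₂₂ {n m : Type*} [Fintype n] [Fintype m] {A : Matrix n n ℂ} {B : Matrix n m ℂ}
    {C : Matrix m n ℂ} {D : Matrix m m ℂ} (h : ImPos (fromBlocks A B C D)) : ImPos D := by
  intro v hv
  have h1 : Sum.elim (0 : n → ℂ) v ≠ 0 := by
    intro h0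
    apply hv
    funext i
    simpa using congrFun h0 (Sum.inr i)
  have := h _ h1
  rw [fromBlocks_mulVec] at this
  simpa [dotProduct, Matrix.mulVec] using this

/-- Test the block matrix on `(v, -D⁻¹ C v)`: the second component of the image vanishes, and what
is left is the form of the Schur complement at `v`. -/
lemma ImPos.schur {n m : Type*} [Fintype n] [Fintype m] [DecidableEq m] {A : Matrix n n ℂ}
    {B : Matrix n m ℂ} {C : Matrix m n ℂ} {D : Matrix m m ℂ} (h : ImPos (fromBlocks A B C D)) :
    ImPos (A - B * D⁻¹ * C) := by
  intro v hv
  have hD := h.toBlocks₂₂.isUnit_det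
  have h1 : Sum.elim v (-(D⁻¹ *ᵥ (C *ᵥ v))) ≠ 0 := by
    intro h0
    apply hv
    funext i
    simpa using congrFun h0 (Sum.inl i)
  have := h _ h1
  rw [fromBlocks_mulVec] at this
  have e1 : ((Sum.elim v (-(D⁻¹ *ᵥ (C *ᵥ v)))) ∘ Sum.inl : n → ℂ) = v := rfl
  have e2 : ((Sum.elim v (-(D⁻¹ *ᵥ (C *ᵥ v)))) ∘ Sum.inr : m → ℂ) = -(D⁻¹ *ᵥ (C *ᵥ v)) := rfl
  rw [e1, e2] at this
  have e3 : C *ᵥ v + D *ᵥ (-(D⁻¹ *ᵥ (C *ᵥ v))) = 0 := by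
    rw [mulVec_neg, mulVec_mulVec, mul_nonsing_inv _ hD, one_mulVec, add_neg_cancel]
  have e4 : A *ᵥ v + B *ᵥ (-(D⁻¹ *ᵥ (C *ᵥ v))) = (A - B * D⁻¹ * C) *ᵥ v := by
    rw [mulVec_neg, mulVec_mulVec, mulVec_mulVec, sub_mulVec, sub_eq_add_neg, Matrix.mul_assoc]
  rw [e3, e4] at this
  simpa [dotProduct] using this

/-- A continuous logarithm of the determinant on the matrices with positive imaginary part. -/
def IsLogDet {n : Type*} [Fintype n] [DecidableEq n] (l : Matrix n n ℂ → ℂ) : Prop :=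
  ContinuousOn l {K | ImPos K} ∧ ∀ K, ImPos K → exp (l K) = K.det ∧ 0 ≤ (l K).im ∧
    (l K).im ≤ Fintype.card n * Real.pi

lemma IsLogDet.submatrix {n m : Type*} [Fintype n] [DecidableEq n] [Fintype m] [DecidableEq m]
    {l : Matrix n n ℂ → ℂ} (hl : IsLogDet l) (e : n ≃ m) :
    IsLogDet (fun K : Matrix m m ℂ => l (K.submatrix e e)) := by
  refine ⟨?_, fun K hK => ?_⟩
  · exact hl.1.comp (by fun_prop) fun K hK => ImPos.submatrix hK e
  · have := hl.2 _ (hK.submatrix e)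
    rw [det_submatrix_equiv_self, Fintype.card_congr e] at this
    exact this

/-- The determinant factors into the last diagonal entry and the determinant of its Schur
complement, and both factors inherit the positive imaginary part. The principal logarithm of the
entry contributes an angle in `[0, π]`, so the bound on the imaginary part grows by `π` with each
dimension. -/
lemma exists_isLogDet_sum {n : Type*} [Fintype n] [DecidableEq n]
    {l : Matrix n n ℂ → ℂ} (hl : IsLogDet l) :
    ∃ l' : Matrix (n ⊕ Unit) (n ⊕ Unit) ℂ → ℂ, IsLogDet l' := by
  have hpos : ∀ K : Matrix (n ⊕ Unit) (n ⊕ Unit) ℂ, ImPos K →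
      0 < (K.toBlocks₂₂ () ()).im ∧ ImPos (K.toBlocks₁₁ - K.toBlocks₁₂ * K.toBlocks₂₂⁻¹ * K.toBlocks₂₁)
      ∧ K.det = K.toBlocks₂₂ () () *
        (K.toBlocks₁₁ - K.toBlocks₁₂ * K.toBlocks₂₂⁻¹ * K.toBlocks₂₁).det := by
    intro K hK
    rw [← fromBlocks_toBlocks K] at hK
    have h2 := hK.toBlocks₂₂
    refine ⟨?_, hK.schur, ?_⟩
    · have := h2 1 one_ne_zero
      simpa [dotProduct, Matrix.mulVec] using this
    · have hu := h2.isUnit_det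
      let _ := Matrix.invertibleOfIsUnitDet _ hu
      conv_lhs => rw [← fromBlocks_toBlocks K, det_fromBlocks₂₂, det_unique]
      rw [invOf_eq_nonsing_inv]
  refine ⟨fun K => Complex.log (K.toBlocks₂₂ () ()) +
    l (K.toBlocks₁₁ - K.toBlocks₁₂ * K.toBlocks₂₂⁻¹ * K.toBlocks₂₁), ?_, fun K hK => ?_⟩
  · refine ContinuousOn.add ?_ ?_
    · refine ContinuousOn.clog (by unfold toBlocks₂₂; fun_prop) ?_
      intro K hK
      exact Or.inr (hpos K hK).1.ne'
    · refine hl.1.comp ?_ fun K hK => (hpos K hK).2.1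
      have h0 : ContinuousOn (fun K : Matrix (n ⊕ Unit) (n ⊕ Unit) ℂ => K.toBlocks₂₂⁻¹)
          {K | ImPos K} := by
        have : (fun K : Matrix (n ⊕ Unit) (n ⊕ Unit) ℂ => K.toBlocks₂₂⁻¹) =
            fun K => Matrix.of fun _ _ => (K.toBlocks₂₂ () ())⁻¹ := by
          funext K
          ext i j
          rw [Matrix.inv_subsingleton]
          simp [diagonal]
        rw [this]
        refine continuousOn_pi.mpr fun i => continuousOn_pi.mpr fun j => ?_
        refine ContinuousOn.inv₀ (by unfold toBlocks₂₂; fun_prop) ?_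
        intro K hK h0
        have := (hpos K hK).1
        rw [h0] at this
        simp at this
      have h1 : Continuous (fun K : Matrix (n ⊕ Unit) (n ⊕ Unit) ℂ => K.toBlocks₁₁) := by
        unfold toBlocks₁₁; fun_prop
      have h2 : Continuous (fun K : Matrix (n ⊕ Unit) (n ⊕ Unit) ℂ => K.toBlocks₁₂) := by
        unfold toBlocks₁₂; fun_prop
      have h3 : Continuous (fun K : Matrix (n ⊕ Unit) (n ⊕ Unit) ℂ => K.toBlocks₂₁) := by
        unfold toBlocks₂₁; fun_prop
      rw [continuousOn_iff_continuous_domRestrict] at h0 ⊢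
      exact (h1.comp continuous_subtype_val).sub
        ((((h2.comp continuous_subtype_val).matrix_mul h0)).matrix_mul
          (h3.comp continuous_subtype_val))
  · obtain ⟨ha, hb, hc⟩ := hpos K hK
    obtain ⟨h1, h2, h3⟩ := hl.2 _ hb
    have h4 : K.toBlocks₂₂ () () ≠ 0 := fun h0 => by rw [h0] at ha; simp at ha
    refine ⟨?_, ?_, ?_⟩
    · rw [exp_add, exp_log h4, h1, hc]
    · rw [add_im, log_im]
      exact add_nonneg (arg_nonneg_iff.mpr ha.le) h2
    · rw [add_im, log_im, Fintype.card_sum]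
      have := arg_le_pi (K.toBlocks₂₂ () ())
      push_cast
      simp only [Fintype.card_unit, Nat.cast_one]
      linarith

theorem exists_isLogDet (n : Type*) [Fintype n] [DecidableEq n] :
    ∃ l : Matrix n n ℂ → ℂ, IsLogDet l := by
  have hfin : ∀ k : ℕ, ∃ l : Matrix (Fin k) (Fin k) ℂ → ℂ, IsLogDet l := by
    intro k
    induction k with
    | zero => exact ⟨fun _ => 0, continuousOn_const, fun K _ => by simp⟩
    | succ k ih =>
      obtain ⟨l, hl⟩ := ih
      obtain ⟨l', hl'⟩ := exists_isLogDet_sum hl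
      exact ⟨_, hl'.submatrix (Fintype.equivFinOfCardEq (by simp))⟩
  obtain ⟨l, hl⟩ := hfin (Fintype.card n)
  exact ⟨_, hl.submatrix (Fintype.equivFin n).symm⟩

/-- The fundamental theorem of calculus for the logarithmic derivative. -/
lemma integral_logDeriv_eq {d : ℝ → ℂ} (hd : ContDiff ℝ 1 d) {l : ℝ → ℂ} (hl : Continuous l)
    (h : ∀ t, exp (l t) = d t) (a b : ℝ) : ∫ t in a..b, logDeriv d t = l b - l a := by
  have hne : ∀ t, d t ≠ 0 := fun t => by rw [← h]; exact exp_ne_zero _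
  have hcont : Continuous (logDeriv d) := by
    unfold logDeriv
    exact (hd.continuous_deriv le_rfl).div hd.continuous hne
  set g : ℝ → ℂ := fun t => ∫ s in a..t, logDeriv d s with hg
  have hg' : ∀ t, HasDerivAt g (logDeriv d t) t := fun t =>
    intervalIntegral.integral_hasDerivAt_right (hcont.intervalIntegrable _ _)
      (hcont.stronglyMeasurableAtFilter _ _) hcont.continuousAt
  -- The primitive `g` of the logarithmic derivative is itself a branch of `log d` up to a constant;
  -- discreteness then identifies it with `l - l a`.
  have hder : ∀ t, HasDerivAt (fun t => exp (-g t) * d t) 0 t := by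
    intro t
    have h1 := ((hg' t).neg.cexp).mul (hd.differentiable (by simp) t).hasDerivAt
    convert! h1 using 1
    simp only [logDeriv, Pi.div_apply]
    field_simp [hne t]
    ring
  have hconst : ∀ t, exp (-g t) * d t = d a := by
    intro t
    have := is_const_of_deriv_eq_zero (fun t => (hder t).differentiableAt)
      (fun t => (hder t).deriv) t a
    rw [this]
    simp [hg]
  have hgc : Continuous g := continuous_iff_continuousAt.mpr fun t => (hg' t).continuousAt
  have := eq_of_exp_sub_eq_one (s := Set.univ) isPreconnected_univ
    (f := fun t => l t - l a - g t) (by fun_prop) (fun t _ => by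
      rw [exp_sub, exp_sub, h, h, ← hconst t]
      rw [Complex.exp_neg]
      have := exp_ne_zero (g t)
      have := hne t
      field_simp) (Set.mem_univ b) (Set.mem_univ a)
  simp only [sub_self, zero_sub] at this
  have hga : g a = 0 := by simp [hg]
  rw [hga] at this
  change g b = _
  linear_combination -this

variable {n : Type*} [Fintype n] [DecidableEq n]

lemma contDiff_det {K : ℝ → Matrix n n ℂ} (hK : ∀ i j, ContDiff ℝ 1 fun t => K t i j) :
    ContDiff ℝ 1 fun t => (K t).det := by
  simp only [det_apply]
  refine ContDiff.sum fun σ _ => ContDiff.const_smul _ ?_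
  exact contDiff_prod fun i _ => hK _ _

omit [Fintype n] [DecidableEq n] in
lemma continuous_of_entries {α : Type*} [TopologicalSpace α] {K : α → Matrix n n ℂ}
    (hK : ∀ i j, Continuous fun t => K t i j) : Continuous K :=
  continuous_pi fun i => continuous_pi fun j => hK i j

lemma IsLogDet.integral_logDeriv {l : Matrix n n ℂ → ℂ} (hl : IsLogDet l) {K : ℝ → Matrix n n ℂ}
    (hK : ∀ i j, ContDiff ℝ 1 fun t => K t i j) (hpos : ∀ t, ImPos (K t)) (a b : ℝ) :
    ∫ t in a..b, logDeriv (fun t => (K t).det) t = l (K b) - l (K a) :=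
  integral_logDeriv_eq (contDiff_det hK) (l := fun t => l (K t))
    (hl.1.comp_continuous (continuous_of_entries fun i j => (hK i j).continuous) hpos)
    (fun t => (hl.2 _ (hpos t)).1) a b

/-- The integral is a difference of two values of a `log det` whose imaginary parts both lie in `[0,
|n| π]`, whatever the curve does in between. -/
lemma abs_im_integral_logDeriv_det_le {K : ℝ → Matrix n n ℂ}
    (hK : ∀ i j, ContDiff ℝ 1 fun t => K t i j) (hpos : ∀ t, ImPos (K t)) (a b : ℝ) :
    |(∫ t in a..b, logDeriv (fun t => (K t).det) t).im| ≤ Fintype.card n * Real.pi := by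
  obtain ⟨l, hl⟩ := exists_isLogDet n
  rw [hl.integral_logDeriv hK hpos, sub_im, abs_le]
  have h1 := (hl.2 _ (hpos a)).2
  have h2 := (hl.2 _ (hpos b)).2
  constructor <;> linarith

lemma imPos_smul_one_sub {X : Matrix n n ℂ} (hX : X.IsHermitian) {z : ℂ} (hz : 0 < z.im) :
    ImPos (z • (1 : Matrix n n ℂ) - X) := by
  intro v hv
  have h1 : (star v ⬝ᵥ (X *ᵥ v)).im = 0 := hX.im_star_dotProduct_mulVec_self v
  have h2 : 0 < star v ⬝ᵥ v := dotProduct_star_self_pos_iff.mpr hv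
  rw [Complex.lt_def] at h2
  simp only [zero_re, zero_im] at h2
  rw [sub_mulVec, smul_mulVec, one_mulVec, dotProduct_sub, dotProduct_smul, sub_im, h1, smul_eq_mul,
    mul_im, ← h2.2]
  have := mul_pos hz h2.1
  simp; linarith

lemma det_smul_one_sub_smul {X : Matrix n n ℂ} (hX : X.IsHermitian) (w s : ℂ) :
    (w • (1 : Matrix n n ℂ) - s • X).det = ∏ k, (w - s * hX.eigenvalues k) := by
  by_cases hs : s = 0
  · simp [hs, Finset.prod_const]
  · have h1 : w • (1 : Matrix n n ℂ) - s • X = s • ((w / s) • (1 : Matrix n n ℂ) - X) := by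
      rw [smul_sub, smul_smul, mul_div_cancel₀ _ hs]
    have h2 : ((w / s) • (1 : Matrix n n ℂ) - X).det = X.charpoly.eval (w / s) := by
      rw [Matrix.eval_charpoly, scalar_apply, smul_one_eq_diagonal]
    rw [h1, det_smul, h2, hX.charpoly_eq, Polynomial.eval_prod, ← Finset.card_univ,
      ← Finset.prod_const, ← Finset.prod_mul_distrib]
    refine Finset.prod_congr rfl fun k _ => ?_
    simp
    field_simp

/-- Both sides are logarithms of the same determinant along the path from `i · 1` to `z - X` given
by `w s • 1 - s • X`, on which the imaginary part stays positive. The starting point does not depend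
on `X`, so the additive constant drops out of differences. -/
lemma IsLogDet.eq_sum_log {l : Matrix n n ℂ → ℂ} (hl : IsLogDet l) {X : Matrix n n ℂ}
    (hX : X.IsHermitian) {z : ℂ} (hz : 0 < z.im) :
    l (z • (1 : Matrix n n ℂ) - X) = ∑ k, Complex.log (z - hX.eigenvalues k) +
      (l (I • (1 : Matrix n n ℂ)) - Fintype.card n * Complex.log I) := by
  set w : ℝ → ℂ := fun s => I + s * (z - I) with hw
  have hwc : Continuous w := by fun_prop
  have hwpos : ∀ s ∈ Set.Icc (0 : ℝ) 1, 0 < (w s).im := by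
    intro s hs
    simp [hw]
    rcases hs.1.eq_or_lt with h | h
    · simp [← h]
    · nlinarith [mul_pos h hz, hs.2]
  have hKpos : ∀ s ∈ Set.Icc (0 : ℝ) 1, ImPos (w s • (1 : Matrix n n ℂ) - (s : ℂ) • X) := by
    intro s hs
    refine imPos_smul_one_sub ?_ (hwpos s hs)
    rw [IsHermitian, conjTranspose_smul, hX.eq]
    simp
  have hpos2 : ∀ s ∈ Set.Icc (0 : ℝ) 1, ∀ k, 0 < (w s - (s : ℂ) * hX.eigenvalues k).im := by
    intro s hs k
    simpa using hwpos s hs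
  have hcont : ContinuousOn (fun s : ℝ => l (w s • (1 : Matrix n n ℂ) - (s : ℂ) • X) -
      ∑ k, Complex.log (w s - (s : ℂ) * hX.eigenvalues k)) (Set.Icc 0 1) := by
    refine ContinuousOn.sub ?_ ?_
    · exact hl.1.comp (Continuous.continuousOn (by fun_prop)) hKpos
    · refine continuousOn_finsetSum _ fun k _ => ContinuousOn.clog (by fun_prop) ?_
      intro s hs
      exact Or.inr (hpos2 s hs k).ne'
  have := eq_of_exp_sub_eq_one isPreconnected_Icc hcont (fun s hs => by
    have hk : ∀ k, w s - (s : ℂ) * hX.eigenvalues k ≠ 0 := fun k h0 => by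
      have := hpos2 s hs k; rw [h0] at this; simp at this
    rw [exp_sub, (hl.2 _ (hKpos s hs)).1, exp_sum, det_smul_one_sub_smul hX,
      Finset.prod_congr rfl fun k _ => exp_log (hk k), div_self]
    exact Finset.prod_ne_zero_iff.mpr fun k _ => hk k)
    (Set.right_mem_Icc.mpr zero_le_one) (Set.left_mem_Icc.mpr zero_le_one)
  simp [hw] at this
  linear_combination this

end LogDet

/-! ### Inverses, logarithmic derivatives of determinants and the trace identity for resolvents -/

section DeterminantCurves

open Complex Filter Topology

variable {n m : Type*} [Fintype n] [DecidableEq n] [Fintype m] [DecidableEq m]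

/-- With `w = K⁻¹ v`, the number `star v ⬝ᵥ K⁻¹ v` is the conjugate of the form of `K` at `w`. -/
lemma ImPos.neg_inv {K : Matrix n n ℂ} (h : ImPos K) : ImPos (-K⁻¹) := by
  intro v hv
  have hu := h.isUnit_det
  have hKv : K *ᵥ (K⁻¹ *ᵥ v) = v := by rw [mulVec_mulVec, mul_nonsing_inv _ hu, one_mulVec]
  have h1 : K⁻¹ *ᵥ v ≠ 0 := by
    intro h0
    rw [h0, mulVec_zero] at hKv
    exact hv hKv.symm
  have h2 := h _ h1
  rw [hKv] at h2
  rw [neg_mulVec, dotProduct_neg, neg_im]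
  have h3 : star v ⬝ᵥ (K⁻¹ *ᵥ v) = star (star (K⁻¹ *ᵥ v) ⬝ᵥ v) := by
    rw [star_dotProduct]
  rw [h3]
  simpa using h2

omit [DecidableEq n] [DecidableEq m] in
lemma ImPos.conj {K : Matrix n n ℂ} (h : ImPos K) (R : Matrix m n ℂ)
    (hR : ∀ v, v ≠ 0 → Rᴴ *ᵥ v ≠ 0) : ImPos (R * K * Rᴴ) := by
  intro v hv
  have := h _ (hR v hv)
  rwa [star_mulVec, conjTranspose_conjTranspose, ← dotProduct_mulVec, mulVec_mulVec, mulVec_mulVec] at this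

lemma contDiff_inv_apply {K : ℝ → Matrix n n ℂ} (hK : ∀ i j, ContDiff ℝ 1 fun t => K t i j)
    (hu : ∀ t, IsUnit (K t).det) (i j : n) : ContDiff ℝ 1 fun t => (K t)⁻¹ i j := by
  have : (fun t => (K t)⁻¹ i j) = fun t => (K t).det⁻¹ * ((K t).updateRow j (Pi.single i 1)).det := by
    funext t
    rw [Matrix.inv_def, Matrix.smul_apply, adjugate_apply, Ring.inverse_eq_inv', smul_eq_mul]
  rw [this]
  refine ((contDiff_det hK).inv fun t => (hu t).ne_zero).mul (contDiff_det fun k l => ?_)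
  by_cases hk : k = j
  · subst hk
    simpa using contDiff_const
  · simpa [updateRow_ne hk] using hK k l

lemma continuous_inv_of_isUnit_det {α : Type*} [TopologicalSpace α] {K : α → Matrix n n ℂ}
    (hK : Continuous K) (hu : ∀ t, IsUnit (K t).det) : Continuous fun t => (K t)⁻¹ := by
  have : (fun t => (K t)⁻¹) = fun t => (K t).det⁻¹ • (K t).adjugate := by
    funext t
    rw [Matrix.inv_def, Ring.inverse_eq_inv']
  rw [this]
  exact (hK.matrix_det.inv₀ fun t => (hu t).ne_zero).smul hK.matrix_adjugate

/-- Jacobi's formula: factor out the matrix at `t` and use `det (1 + h C) = 1 + h Tr C + O(h²)`. -/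
lemma logDeriv_det_sub_smul {A B : Matrix n n ℂ} {t : ℝ} (hu : IsUnit (A - (t : ℂ) • B).det) :
    logDeriv (fun t : ℝ => (A - (t : ℂ) • B).det) t = -((A - (t : ℂ) • B)⁻¹ * B).trace := by
  set D := A - (t : ℂ) • B with hD
  set C := -(D⁻¹ * B) with hC
  have h1 : ∀ s : ℝ, (A - (s : ℂ) • B).det = D.det * (1 + ((s - t : ℝ) : ℂ) • C).det := by
    intro s
    rw [← det_mul, Matrix.mul_add, Matrix.mul_smul, hC, Matrix.mul_neg, ← Matrix.mul_assoc,
      mul_nonsing_inv _ hu, Matrix.mul_one, Matrix.one_mul, hD]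
    congr 1
    push_cast
    module
  have h2 : HasDerivAt (fun s : ℝ => (A - (s : ℂ) • B).det) (D.det * C.trace) t := by
    rw [funext h1]
    simp only [det_one_add_smul (_ : ℂ) C]
    refine HasDerivAt.const_mul _ ?_
    -- The terms of degree at least two in the expansion, divided by the square of the variable;
    -- they do not contribute to the derivative at `s = t`.
    set p := (det (1 + (Polynomial.X : Polynomial ℂ) • C.map Polynomial.C)).divX.divX
    have hs : HasDerivAt (fun s : ℝ => ((s - t : ℝ) : ℂ)) 1 t := by
      have := ((hasDerivAt_id t).sub_const t).ofReal_comp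
      simpa using this
    have hp : HasDerivAt (fun s : ℝ => p.eval ((s - t : ℝ) : ℂ)) (p.derivative.eval ((t - t : ℝ) : ℂ)) t := by
      have := (p.hasDerivAt (((t - t : ℝ) : ℂ))).comp t hs
      simpa using! this
    have := ((hs.const_mul C.trace).const_add 1).add (hp.mul (hs.pow 2))
    convert! this using 1
    simp
  rw [logDeriv, Pi.div_apply, h2.deriv, ← hD, mul_div_cancel_left₀ _ hu.ne_zero, hC, trace_neg]

/-- The resolvent identity `G - Gᴴ = 2i Im z · G Gᴴ`, multiplied by `W` and traced. It is used with
two choices of `W`: the projection on the first site and the perturbation. That is what makes the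
spectral density and the winding rate comparable column by column. -/
lemma im_trace_inv_mul {H W : Matrix n n ℂ} (hH : H.IsHermitian) (hW : W.IsHermitian) {z : ℂ}
    (hz : 0 < z.im) :
    ((H - z • 1)⁻¹ * W).trace.im = z.im *
      ∑ c, (star ((H - z • 1)⁻¹.col c) ⬝ᵥ (W *ᵥ ((H - z • 1)⁻¹.col c))).re := by
  set K := H - z • (1 : Matrix n n ℂ) with hK
  have hu : IsUnit K.det := by
    have := (imPos_smul_one_sub hH hz).isUnit_det
    have h2 : K = -(z • (1 : Matrix n n ℂ) - H) := by rw [hK, neg_sub]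
    rw [h2, det_neg]
    exact IsUnit.mul (by simp) this
  set G := K⁻¹ with hG
  have h1 : G - Gᴴ = (2 * I * z.im) • (G * Gᴴ) := by
    have hKG : K * G = 1 := mul_nonsing_inv _ hu
    have hGK : G * K = 1 := nonsing_inv_mul _ hu
    have hGK' : Kᴴ * Gᴴ = 1 := by rw [← conjTranspose_mul, hGK, conjTranspose_one]
    have : Kᴴ - K = (2 * I * z.im) • (1 : Matrix n n ℂ) := by
      rw [hK, conjTranspose_sub, hH.eq, conjTranspose_smul, conjTranspose_one, sub_sub_sub_cancel_left,
        ← sub_smul]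
      congr 1
      apply Complex.ext <;> simp; ring
    calc G - Gᴴ = G * (Kᴴ * Gᴴ) - (G * K) * Gᴴ := by rw [hGK', hGK, Matrix.mul_one, Matrix.one_mul]
      _ = G * (Kᴴ - K) * Gᴴ := by
        rw [Matrix.mul_sub G Kᴴ K, Matrix.sub_mul (G * Kᴴ) (G * K), Matrix.mul_assoc G Kᴴ Gᴴ]
      _ = _ := by rw [this]; simp
  have h2 : (G * W).trace - star ((G * W).trace) = (2 * I * z.im) * (Gᴴ * W * G).trace := by
    rw [← trace_conjTranspose, conjTranspose_mul, hW.eq, trace_mul_comm W, ← trace_sub,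
      ← Matrix.sub_mul, h1, Matrix.smul_mul, trace_smul, smul_eq_mul, Matrix.mul_assoc,
      trace_mul_comm G]
  have h3 : (Gᴴ * W * G).trace = ∑ c, star (G.col c) ⬝ᵥ (W *ᵥ (G.col c)) := by
    simp only [trace, diag_apply]
    refine Finset.sum_congr rfl fun c _ => ?_
    rw [Matrix.mul_assoc, Matrix.mul_apply]
    simp only [dotProduct, conjTranspose_apply, Pi.star_apply, col_apply]
    rfl
  have h4 := congrArg Complex.im h2
  rw [h3] at h4
  simp at h4
  have h5 : (∑ c, (star (G.col c) ⬝ᵥ (W *ᵥ G.col c)).re) = (∑ c, (star (G.col c) ⬝ᵥ (W *ᵥ G.col c))).re := by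
    simp
  rw [h5, re_sum]
  linarith

end DeterminantCurves

/-! ### Truncations to finitely many sites -/

namespace MatrixJacobi

open Complex Filter Topology

variable {L : ℕ} (J : MatrixJacobi L)

/-- The truncation of a Jacobi matrix to the first `M` sites. -/
def trunc (M : ℕ) : Matrix (Fin M × Fin L) (Fin M × Fin L) ℂ := J.finiteHamiltonian M (fun _ => 0) 0

lemma trunc_isHermitian (M : ℕ) : (J.trunc M).IsHermitian :=
  J.finiteHamiltonian_isHermitian M _ (fun _ _ => PosSemidef.zero) 0

lemma trunc_apply (M : ℕ) (p q : Fin M × Fin L) : J.trunc M p q =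
    if (p.1 : ℕ) = q.1 then (J.V p.1) p.2 q.2
    else if (q.1 : ℕ) = p.1 + 1 then (J.T p.1) p.2 q.2
    else if (p.1 : ℕ) = q.1 + 1 then (J.T q.1)ᴴ p.2 q.2
    else 0 := by
  simp [trunc, finiteHamiltonian]

/-- The Jacobi matrix without its first `N` sites. -/
def shift (N : ℕ) : MatrixJacobi L where
  T n := J.T (N + n)
  V n := J.V (N + n)
  isUnit_T _ := J.isUnit_T _
  isHermitian_V _ := J.isHermitian_V _

/-- The restriction to `m < N` of a sequence of matrices. -/
def cutoff (N : ℕ) (W : ℕ → Matrix (Fin L) (Fin L) ℂ) (n : ℕ) : Matrix (Fin L) (Fin L) ℂ :=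
  if n < N then W n else 0

lemma cutoff_isHermitian {N : ℕ} {W : ℕ → Matrix (Fin L) (Fin L) ℂ}
    (hW : ∀ n < N, (W n).PosSemidef) (n : ℕ) : (cutoff N W n).IsHermitian := by
  unfold cutoff
  split_ifs with h
  · exact (hW n h).isHermitian
  · exact isHermitian_zero

/-- The Jacobi matrix of `H(μ)`. -/
def perturb (N : ℕ) (W : ℕ → Matrix (Fin L) (Fin L) ℂ) (hW : ∀ n < N, (W n).PosSemidef) (μ : ℝ) :
    MatrixJacobi L where
  T := J.T
  V n := J.V n + (μ : ℂ) • cutoff N W n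
  isUnit_T := J.isUnit_T
  isHermitian_V n := by
    refine (J.isHermitian_V n).add ?_
    rw [IsHermitian, conjTranspose_smul, (cutoff_isHermitian hW n).eq]
    simp

lemma trunc_perturb_self (N : ℕ) (W : ℕ → Matrix (Fin L) (Fin L) ℂ)
    (hW : ∀ n < N, (W n).PosSemidef) (μ : ℝ) :
    (J.perturb N W hW μ).trunc N = J.finiteHamiltonian N W μ := by
  ext p q
  simp [trunc_apply, finiteHamiltonian, perturb, cutoff]

/-- The block diagonal matrix `∑_{n < N} π_n W_n π_n^*` on `M` sites. -/
def blockPotential (N : ℕ) (W : ℕ → Matrix (Fin L) (Fin L) ℂ) (M : ℕ) :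
    Matrix (Fin M × Fin L) (Fin M × Fin L) ℂ :=
  Matrix.of fun p q => if p.1 = q.1 then cutoff N W p.1 p.2 q.2 else 0

lemma blockPotential_isHermitian {N : ℕ} {W : ℕ → Matrix (Fin L) (Fin L) ℂ}
    (hW : ∀ n < N, (W n).PosSemidef) (M : ℕ) : (blockPotential N W M).IsHermitian := by
  refine IsHermitian.ext fun p q => ?_
  simp only [blockPotential, of_apply]
  by_cases h : p.1 = q.1
  · rw [if_pos h.symm, if_pos h, ← h]
    exact (cutoff_isHermitian hW p.1).apply _ _
  · rw [if_neg (Ne.symm h), if_neg h, star_zero]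

lemma trunc_perturb (N : ℕ) (W : ℕ → Matrix (Fin L) (Fin L) ℂ) (hW : ∀ n < N, (W n).PosSemidef)
    (μ : ℝ) (M : ℕ) : (J.perturb N W hW μ).trunc M = J.trunc M + (μ : ℂ) • blockPotential N W M := by
  ext p q
  simp only [trunc_apply, perturb, blockPotential, Matrix.add_apply, Matrix.smul_apply, of_apply, Fin.ext_iff]
  by_cases h : (p.1 : ℕ) = q.1
  · simp [h]
  · simp [h]

/-- A function on `M` sites, extended by zero. -/
def extendZero {M : ℕ} (g : Fin M × Fin L → ℂ) (n : ℕ) : Fibre L :=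
  if h : n < M then WithLp.toLp 2 fun a => g (⟨n, h⟩, a) else 0

lemma extendZero_apply {M : ℕ} (g : Fin M × Fin L → ℂ) (p : Fin M × Fin L) :
    extendZero g p.1 p.2 = g p := by
  simp [extendZero]

lemma extendZero_of_le {M : ℕ} (g : Fin M × Fin L → ℂ) {n : ℕ} (h : M ≤ n) :
    extendZero g n = 0 := by
  simp [extendZero, not_lt.mpr h]

lemma sum_fin_ite_eq {M : ℕ} (F : ℕ → ℂ) (k : ℕ) (hF : M ≤ k → F k = 0) :
    ∑ i : Fin M, (if (i : ℕ) = k then F i else 0) = F k := by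
  rw [Fin.sum_univ_eq_sum_range (fun i => if i = k then F i else 0) M, Finset.sum_ite_eq']
  split_ifs with h
  · rfl
  · exact (hF (by simpa using h)).symm

/-- The only value outside the truncation that the difference expression reaches from the sites
below `M` is `φ M`, so its vanishing is all that is required of `φ`. -/
lemma trunc_mulVec {M : ℕ} (φ : ℕ → Fibre L) (hφ : φ M = 0) (p : Fin M × Fin L) :
    (J.trunc M *ᵥ fun q => φ q.1 q.2) p = J.expr φ p.1 p.2 := by
  obtain ⟨⟨i, hi⟩, a⟩ := p
  have key : ∀ q : Fin M × Fin L, J.trunc M (⟨i, hi⟩, a) q * φ q.1 q.2 =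
      (if (q.1 : ℕ) = i then J.V i a q.2 * φ q.1 q.2 else 0) +
      (if (q.1 : ℕ) = i + 1 then J.T i a q.2 * φ q.1 q.2 else 0) +
      (if i = (q.1 : ℕ) + 1 then (J.T q.1)ᴴ a q.2 * φ q.1 q.2 else 0) := by
    intro q
    rw [trunc_apply]
    simp only
    by_cases h1 : i = (q.1 : ℕ)
    · simp [h1]
    · by_cases h2 : (q.1 : ℕ) = i + 1
      · have : ¬ i = i + 1 + 1 := by omega
        simp [h2, this]
      · simp [h1, Ne.symm h1, h2]
  have hsum : ∀ (F : ℕ → Fin L → ℂ) (k : ℕ) (_ : M ≤ k → ∀ b, F k b = 0),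
      ∑ q : Fin M × Fin L, (if (q.1 : ℕ) = k then F q.1 q.2 else 0) = ∑ b, F k b := by
    intro F k hF
    rw [Fintype.sum_prod_type, Finset.sum_comm]
    exact Finset.sum_congr rfl fun b _ => sum_fin_ite_eq (fun n => F n b) k fun h => hF h b
  simp only [mulVec, dotProduct]
  rw [Finset.sum_congr rfl fun q _ => key q, Finset.sum_add_distrib, Finset.sum_add_distrib,
    hsum (fun n b => J.V i a b * φ n b) i (fun h => by omega),
    hsum (fun n b => J.T i a b * φ n b) (i + 1) (fun h b => by
      rw [show i + 1 = M by omega, hφ]; simp)]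
  cases i with
  | zero =>
    simp [expr, mulVec, dotProduct, toLpLin_apply]
    ring
  | succ i =>
    have : ∀ q : Fin M × Fin L, (if i + 1 = (q.1 : ℕ) + 1 then (J.T q.1)ᴴ a q.2 * φ q.1 q.2 else 0)
        = if (q.1 : ℕ) = i then (J.T q.1)ᴴ a q.2 * φ q.1 q.2 else 0 := by
      intro q
      congr 1
      simp [eq_comm]
    rw [Finset.sum_congr rfl fun q _ => this q,
      hsum (fun n b => (J.T n)ᴴ a b * φ n b) i (fun h => by omega)]
    simp [expr, mulVec, dotProduct, toLpLin_apply]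
    ring

lemma eq_extendZero {M : ℕ} (g : Fin M × Fin L → ℂ) : g = fun q => extendZero g q.1 q.2 :=
  funext fun q => (extendZero_apply g q).symm

lemma expr_extendZero {M : ℕ} (g : Fin M × Fin L → ℂ) (p : Fin M × Fin L) :
    J.expr (extendZero g) p.1 p.2 = (J.trunc M *ᵥ g) p := by
  conv_rhs => rw [eq_extendZero g]
  exact (J.trunc_mulVec _ (extendZero_of_le g le_rfl) p).symm

end MatrixJacobi

/-! ### Transfer estimates for approximate solutions -/

section Transfer

open Complex Filter Topology

/-- Induction over pairs of neighbours: since `3R ≥ 1`, each of the three terms on the right is at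
most `(3R)^(n+1) (x 0 + δ)`. -/
lemma le_pow_mul_of_three_term {x : ℕ → ℝ} (hx : ∀ n, 0 ≤ x n) {R δ : ℝ} (hR : 1 ≤ R) (hδ : 0 ≤ δ)
    {N : ℕ} (h0 : 0 < N → x 1 ≤ R * (x 0 + δ))
    (h : ∀ n, n + 1 < N → x (n + 2) ≤ R * (x (n + 1) + x n + δ)) :
    ∀ n ≤ N, x n ≤ (3 * R) ^ n * (x 0 + δ) := by
  have hA : 0 ≤ x 0 + δ := add_nonneg (hx 0) hδ
  suffices H : ∀ n, (n ≤ N → x n ≤ (3 * R) ^ n * (x 0 + δ)) ∧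
      (n + 1 ≤ N → x (n + 1) ≤ (3 * R) ^ (n + 1) * (x 0 + δ)) from fun n => (H n).1
  intro n
  induction n with
  | zero =>
    refine ⟨fun _ => by simpa using hδ, fun hN => (h0 (by omega)).trans ?_⟩
    rw [zero_add, pow_one]
    nlinarith
  | succ n ih =>
    refine ⟨ih.2, fun hN => ?_⟩
    have h1 := ih.1 (by omega)
    have h2 := ih.2 (by omega)
    have hp : 1 ≤ (3 * R) ^ n := one_le_pow₀ (by linarith)
    have hp' : (3 * R) ^ (n + 1) = (3 * R) ^ n * (3 * R) := pow_succ _ _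
    have hAp : 0 ≤ (3 * R) ^ n * (x 0 + δ) := by positivity
    have h3 : (3 * R) ^ n * (x 0 + δ) ≤ (3 * R) ^ (n + 1) * (x 0 + δ) := by
      rw [hp']; nlinarith
    have h4 : δ ≤ (3 * R) ^ (n + 1) * (x 0 + δ) := by
      have : δ ≤ (3 * R) ^ n * (x 0 + δ) := by nlinarith [hx 0]
      linarith
    calc x (n + 1 + 1) ≤ R * (x (n + 1) + x n + δ) := h n (by omega)
      _ ≤ R * ((3 * R) ^ (n + 1) * (x 0 + δ) + (3 * R) ^ (n + 1) * (x 0 + δ) +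
          (3 * R) ^ (n + 1) * (x 0 + δ)) := by gcongr; linarith
      _ = (3 * R) ^ (n + 1 + 1) * (x 0 + δ) := by ring

/-- The induction on `k` moves the controlling pair one place to the right, replacing `x k` by the
recursion bound. -/
lemma le_pow_mul_of_three_term_backward {x : ℕ → ℝ} (hx : ∀ n, 0 ≤ x n) {R δ : ℝ} (hR : 1 ≤ R)
    (hδ : 0 ≤ δ) {k : ℕ} (h : ∀ n < k, x n ≤ R * (x (n + 1) + x (n + 2) + δ)) :
    x 0 ≤ (3 * R) ^ k * (x k + x (k + 1) + δ) := by
  induction k with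
  | zero => simp; linarith [hx 1]
  | succ k ih =>
    refine (ih fun n hn => h n (by omega)).trans ?_
    rw [pow_succ, mul_assoc]
    gcongr
    have := h k (by omega)
    nlinarith [hx (k + 1), hx (k + 2)]

variable {L : ℕ}

/-- The operator norm of a matrix acting on the fibre. -/
def blockNorm (A : Matrix (Fin L) (Fin L) ℂ) : ℝ :=
  ‖LinearMap.toContinuousLinearMap (toEuclideanLin A)‖

lemma blockNorm_nonneg (A : Matrix (Fin L) (Fin L) ℂ) : 0 ≤ blockNorm A := norm_nonneg _

lemma norm_toEuclideanLin_le (A : Matrix (Fin L) (Fin L) ℂ) (v : Fibre L) :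
    ‖toEuclideanLin A v‖ ≤ blockNorm A * ‖v‖ :=
  (LinearMap.toContinuousLinearMap (toEuclideanLin A)).le_opNorm v

lemma norm_le_of_isUnit {A : Matrix (Fin L) (Fin L) ℂ} (hA : IsUnit A) (v : Fibre L) :
    ‖v‖ ≤ blockNorm A⁻¹ * ‖toEuclideanLin A v‖ := by
  have : toEuclideanLin A⁻¹ (toEuclideanLin A v) = v := by
    rw [isUnit_iff_isUnit_det] at hA
    simp [toLpLin_apply, mulVec_mulVec, nonsing_inv_mul _ hA]
  conv_lhs => rw [← this]
  exact norm_toEuclideanLin_le _ _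

/-- The quadratic form of the perturbation. -/
def perturbForm (N : ℕ) (W : ℕ → Matrix (Fin L) (Fin L) ℂ) (φ : ℕ → Fibre L) : ℝ :=
  ∑ n ∈ Finset.range N, (inner ℂ (φ n) (toEuclideanLin (W n) (φ n))).re

lemma re_inner_nonneg {A : Matrix (Fin L) (Fin L) ℂ} (hA : A.PosSemidef) (v : Fibre L) :
    0 ≤ (inner ℂ v (toEuclideanLin A v)).re := by
  have := (Complex.le_def.mp (hA.dotProduct_mulVec_nonneg v.ofLp)).1
  rw [PiLp.inner_apply]
  simpa [dotProduct, toLpLin_apply, mul_comm] using this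

/-- The form attains a positive minimum on the compact unit sphere; scaling does the rest. The
sphere is empty only when the fibre is trivial. -/
lemma Matrix.PosDef.exists_le_inner {A : Matrix (Fin L) (Fin L) ℂ} (hA : A.PosDef) :
    ∃ c > 0, ∀ v : Fibre L, c * ‖v‖ ^ 2 ≤ (inner ℂ v (toEuclideanLin A v)).re := by
  by_cases hne : (Metric.sphere (0 : Fibre L) 1).Nonempty
  · have hc : Continuous fun v : Fibre L => (inner ℂ v (toEuclideanLin A v)).re := by
      have : Continuous (toEuclideanLin A) := (toEuclideanLin A).continuous_of_finiteDimensional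
      fun_prop
    obtain ⟨v₀, hv₀, hmin⟩ := (isCompact_sphere (0 : Fibre L) 1).exists_isMinOn hne hc.continuousOn
    have hpos : 0 < (inner ℂ v₀ (toEuclideanLin A v₀)).re := by
      have hv : v₀.ofLp ≠ 0 := by
        intro h0
        have : v₀ = 0 := by ext i; simpa using congrFun h0 i
        simp [this] at hv₀
      have := (Complex.lt_def.mp (hA.dotProduct_mulVec_pos hv)).1
      rw [PiLp.inner_apply]
      simpa [dotProduct, toLpLin_apply, mul_comm] using this
    refine ⟨_, hpos, fun v => ?_⟩
    by_cases hv : v = 0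
    · simp [hv]
    have hn : ‖v‖ ≠ 0 := norm_ne_zero_iff.mpr hv
    have h1 : ((‖v‖⁻¹ : ℝ) : ℂ) • v ∈ Metric.sphere (0 : Fibre L) 1 := by
      simp [norm_smul, hn]
    have h2 : (inner ℂ v₀ (toEuclideanLin A v₀)).re ≤
      (inner ℂ (((‖v‖⁻¹ : ℝ) : ℂ) • v) (toEuclideanLin A (((‖v‖⁻¹ : ℝ) : ℂ) • v))).re := hmin h1
    rw [map_smul, inner_smul_left, inner_smul_right, ← mul_assoc, conj_ofReal, ← ofReal_mul,
      re_ofReal_mul] at h2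
    have : ‖v‖ ^ 2 > 0 := by positivity
    calc _ ≤ ‖v‖⁻¹ * ‖v‖⁻¹ * (inner ℂ v (toEuclideanLin A v)).re * ‖v‖ ^ 2 := by gcongr
      _ = _ := by field_simp
  · refine ⟨1, one_pos, fun v => ?_⟩
    have : v = 0 := by
      by_contra hv
      refine hne ⟨((‖v‖⁻¹ : ℝ) : ℂ) • v, ?_⟩
      have hn : ‖v‖ ≠ 0 := norm_ne_zero_iff.mpr hv
      simp [norm_smul, hn]
    simp [this]

namespace MatrixJacobi

/-- Uniform bounds on the blocks of the first `N` sites. -/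
structure BlockBound (J : MatrixJacobi L) (N : ℕ) (z : ℂ) (B : ℝ) : Prop where
  one_le : 1 ≤ B
  le_T : ∀ n < N, ∀ v : Fibre L, ‖v‖ ≤ B * ‖toEuclideanLin (J.T n) v‖
  T_le : ∀ n < N, ∀ v : Fibre L, ‖toEuclideanLin (J.T n) v‖ ≤ B * ‖v‖
  le_Tstar : ∀ n < N, ∀ v : Fibre L, ‖v‖ ≤ B * ‖toEuclideanLin (J.T n)ᴴ v‖
  Tstar_le : ∀ n < N, ∀ v : Fibre L, ‖toEuclideanLin (J.T n)ᴴ v‖ ≤ B * ‖v‖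
  V_le : ∀ n < N, ∀ v : Fibre L, ‖toEuclideanLin (J.V n) v - z • v‖ ≤ B * ‖v‖

variable {J : MatrixJacobi L} {N : ℕ} {z : ℂ} {B : ℝ}

/-- The equation is solved for `T n (φ (n + 1))`. The first site has no left neighbour, so `φ 0`
alone determines the solution up to the error `δ`. -/
lemma BlockBound.forward (hB : J.BlockBound N z B) {φ : ℕ → Fibre L} {δ : ℝ} (hδ : 0 ≤ δ)
    (h : ∀ n < N, ‖J.expr φ n - z • φ n‖ ≤ δ) :
    ∀ n ≤ N, ‖φ n‖ ≤ (3 * B ^ 2) ^ n * (‖φ 0‖ + δ) := by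
  have h1 := hB.one_le
  refine le_pow_mul_of_three_term (x := fun n => ‖φ n‖) (fun n => norm_nonneg _) (by nlinarith) hδ
    (fun hN => ?_) fun n hn => ?_
  · have e : toEuclideanLin (J.T 0) (φ 1) =
      (J.expr φ 0 - z • φ 0) - (toEuclideanLin (J.V 0) (φ 0) - z • φ 0) := by simp only [expr]; abel
    have h2 := hB.le_T 0 hN (φ 1)
    have h3 : ‖toEuclideanLin (J.T 0) (φ 1)‖ ≤ δ + B * ‖φ 0‖ := by
      rw [e]
      exact (norm_sub_le _ _).trans (add_le_add (h 0 hN) (hB.V_le 0 hN _))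
    have h4 : B * δ ≤ B ^ 2 * δ := by gcongr; nlinarith
    calc ‖φ 1‖ ≤ B * (δ + B * ‖φ 0‖) := h2.trans (by gcongr)
      _ ≤ _ := by nlinarith
  · have e : toEuclideanLin (J.T (n + 1)) (φ (n + 2)) =
      (J.expr φ (n + 1) - z • φ (n + 1)) - (toEuclideanLin (J.V (n + 1)) (φ (n + 1)) - z • φ (n + 1))
        - toEuclideanLin (J.T n)ᴴ (φ n) := by simp only [expr]; abel
    have h2 := hB.le_T (n + 1) hn (φ (n + 2))
    have h3 : ‖toEuclideanLin (J.T (n + 1)) (φ (n + 2))‖ ≤ δ + B * ‖φ (n + 1)‖ + B * ‖φ n‖ := by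
      rw [e]
      exact (norm_sub_le _ _).trans (add_le_add ((norm_sub_le _ _).trans
        (add_le_add (h _ hn) (hB.V_le _ hn _))) (hB.Tstar_le n (by omega) _))
    have h4 : B * δ ≤ B ^ 2 * δ := by gcongr; nlinarith
    calc ‖φ (n + 2)‖ ≤ B * (δ + B * ‖φ (n + 1)‖ + B * ‖φ n‖) := h2.trans (by gcongr)
      _ ≤ _ := by nlinarith

/-- Here the equation at `n + 1` is solved for `(T n)ᴴ (φ n)`. Two neighbouring values are needed to
start, whence the requirement of two consecutive positive definite blocks. -/
lemma BlockBound.backward (hB : J.BlockBound N z B) {φ : ℕ → Fibre L} {δ : ℝ} (hδ : 0 ≤ δ)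
    (h : ∀ n < N, ‖J.expr φ n - z • φ n‖ ≤ δ) {k : ℕ} (hk : k < N) :
    ‖φ 0‖ ≤ (3 * B ^ 2) ^ k * (‖φ k‖ + ‖φ (k + 1)‖ + δ) := by
  have h1 := hB.one_le
  refine le_pow_mul_of_three_term_backward (x := fun n => ‖φ n‖) (fun n => norm_nonneg _)
    (by nlinarith) hδ fun n hn => ?_
  have hn' : n + 1 < N := by omega
  have e : toEuclideanLin (J.T n)ᴴ (φ n) =
    (J.expr φ (n + 1) - z • φ (n + 1)) - (toEuclideanLin (J.V (n + 1)) (φ (n + 1)) - z • φ (n + 1))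
      - toEuclideanLin (J.T (n + 1)) (φ (n + 2)) := by simp only [expr]; abel
  have h2 := hB.le_Tstar n (by omega) (φ n)
  have h3 : ‖toEuclideanLin (J.T n)ᴴ (φ n)‖ ≤ δ + B * ‖φ (n + 1)‖ + B * ‖φ (n + 2)‖ := by
    rw [e]
    exact (norm_sub_le _ _).trans (add_le_add ((norm_sub_le _ _).trans
      (add_le_add (h _ hn') (hB.V_le _ hn' _))) (hB.T_le (n + 1) hn' _))
  have h4 : B * δ ≤ B ^ 2 * δ := by gcongr; nlinarith
  calc ‖φ n‖ ≤ B * (δ + B * ‖φ (n + 1)‖ + B * ‖φ (n + 2)‖) := h2.trans (by gcongr)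
    _ ≤ _ := by nlinarith

lemma exists_blockBound (J : MatrixJacobi L) (N : ℕ) (W : ℕ → Matrix (Fin L) (Fin L) ℂ)
    (hW : ∀ n < N, (W n).PosSemidef) (μ₀ μ₁ R : ℝ) (hR : 0 ≤ R) :
    ∃ B : ℝ, ∀ μ ∈ Set.Icc μ₀ μ₁, ∀ z : ℂ, ‖z‖ ≤ R → (J.perturb N W hW μ).BlockBound N z B := by
  set m := max |μ₀| |μ₁|
  have hm : 0 ≤ m := le_max_of_le_left (abs_nonneg _)
  set b : ℕ → ℝ := fun n => blockNorm (J.T n)⁻¹ + blockNorm (J.T n) + blockNorm ((J.T n)ᴴ)⁻¹ +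
    blockNorm (J.T n)ᴴ + (blockNorm (J.V n) + m * blockNorm (W n)) with hb
  have hbn : ∀ n, 0 ≤ b n := fun n => by
    have := blockNorm_nonneg (J.T n)
    have := blockNorm_nonneg (J.T n)⁻¹
    have := blockNorm_nonneg (J.T n)ᴴ
    have := blockNorm_nonneg ((J.T n)ᴴ)⁻¹
    have := blockNorm_nonneg (J.V n)
    have := mul_nonneg hm (blockNorm_nonneg (W n))
    simp only [hb]; linarith
  have hle : ∀ n < N, b n ≤ ∑ n ∈ Finset.range N, b n := fun n hn =>
    Finset.single_le_sum (fun n _ => hbn n) (Finset.mem_range.mpr hn)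
  have hS : 0 ≤ ∑ n ∈ Finset.range N, b n := Finset.sum_nonneg fun n _ => hbn n
  refine ⟨1 + R + ∑ n ∈ Finset.range N, b n, fun μ hμ z hz => ?_⟩
  have key : ∀ n < N, ∀ x y : ℝ, 0 ≤ y → x ≤ b n → x * y ≤ (1 + R + ∑ n ∈ Finset.range N, b n) * y := by
    intro n hn x y hy hx
    have := hle n hn
    gcongr
    linarith
  have hall : ∀ n, 0 ≤ blockNorm (J.T n)⁻¹ ∧ 0 ≤ blockNorm (J.T n) ∧ 0 ≤ blockNorm ((J.T n)ᴴ)⁻¹ ∧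
    0 ≤ blockNorm (J.T n)ᴴ ∧ 0 ≤ blockNorm (J.V n) ∧ 0 ≤ m * blockNorm (W n) := fun n =>
    ⟨blockNorm_nonneg _, blockNorm_nonneg _, blockNorm_nonneg _, blockNorm_nonneg _,
      blockNorm_nonneg _, mul_nonneg hm (blockNorm_nonneg _)⟩
  refine ⟨by linarith, fun n hn v => ?_, fun n hn v => ?_, fun n hn v => ?_, fun n hn v => ?_,
    fun n hn v => ?_⟩
  · refine (norm_le_of_isUnit (J.isUnit_T n) v).trans (key n hn _ _ (norm_nonneg _) ?_)
    have := hall n; simp only [hb]; linarith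
  · refine (norm_toEuclideanLin_le _ v).trans (key n hn _ _ (norm_nonneg _) ?_)
    have := hall n; simp only [hb, perturb]; linarith
  · refine (norm_le_of_isUnit (isUnit_conjTranspose _ |>.mpr (J.isUnit_T n)) v).trans
      (key n hn _ _ (norm_nonneg _) ?_)
    have := hall n; simp only [hb]; linarith
  · refine (norm_toEuclideanLin_le _ v).trans (key n hn _ _ (norm_nonneg _) ?_)
    have := hall n; simp only [hb, perturb]; linarith
  · have e : toEuclideanLin ((J.perturb N W hW μ).V n) v = toEuclideanLin (J.V n) v +
        (μ : ℂ) • toEuclideanLin (W n) v := by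
      simp only [perturb, cutoff, if_pos hn, map_add, map_smul, LinearMap.add_apply,
        LinearMap.smul_apply]
    have hμm : |μ| ≤ m := abs_le_max_abs_abs hμ.1 hμ.2
    rw [e]
    calc _ ≤ ‖toEuclideanLin (J.V n) v‖ + ‖(μ : ℂ) • toEuclideanLin (W n) v‖ + ‖z • v‖ :=
          (norm_sub_le _ _).trans (add_le_add (norm_add_le _ _) le_rfl)
      _ ≤ blockNorm (J.V n) * ‖v‖ + m * (blockNorm (W n) * ‖v‖) + R * ‖v‖ := by
          rw [norm_smul, norm_smul, norm_real, Real.norm_eq_abs]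
          gcongr
          · exact norm_toEuclideanLin_le _ _
          · exact norm_toEuclideanLin_le _ _
      _ = (blockNorm (J.V n) + m * blockNorm (W n) + R) * ‖v‖ := by ring
      _ ≤ _ := by
          refine mul_le_mul_of_nonneg_right ?_ (norm_nonneg _)
          have := hall n
          have := hle n hn
          simp only [hb] at this ⊢
          linarith

/-- On approximate solutions of `H(μ) φ = z φ`, the quadratic form of the perturbation is comparable
with the squared norm at the first site. -/
lemma exists_perturbForm_comparison (J : MatrixJacobi L) (N : ℕ)
    (W : ℕ → Matrix (Fin L) (Fin L) ℂ) (hW : ∀ n < N, (W n).PosSemidef)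
    (hWpos : ∃ n, n + 1 < N ∧ (W n).PosDef ∧ (W (n + 1)).PosDef) (μ₀ μ₁ R : ℝ) (hR : 0 ≤ R) :
    ∃ C > 0, ∀ μ ∈ Set.Icc μ₀ μ₁, ∀ z : ℂ, ‖z‖ ≤ R → ∀ (φ : ℕ → Fibre L) (δ : ℝ), 0 ≤ δ →
      (∀ n < N, ‖(J.perturb N W hW μ).expr φ n - z • φ n‖ ≤ δ) →
      perturbForm N W φ ≤ C * (‖φ 0‖ ^ 2 + δ ^ 2) ∧ ‖φ 0‖ ^ 2 ≤ C * (perturbForm N W φ + δ ^ 2) := by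
  obtain ⟨k, hk, hk0, hk1⟩ := hWpos
  obtain ⟨c0, hc0, h0⟩ := hk0.exists_le_inner
  obtain ⟨c1, hc1, h1⟩ := hk1.exists_le_inner
  obtain ⟨B, hB⟩ := exists_blockBound J N W hW μ₀ μ₁ R hR
  -- `C1` comes from propagating `φ 0` forward to all sites below `N`, `C2` from propagating the
  -- sites `k` and `k + 1` back to the first one. The factors 2 and 3 come from squaring sums of two
  -- and three terms.
  set C1 : ℝ := ∑ n ∈ Finset.range N, blockNorm (W n) * (((3 * B ^ 2) ^ n) ^ 2 * 2) with hC1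
  set C2 : ℝ := ((3 * B ^ 2) ^ k) ^ 2 * 3 * (c0⁻¹ + c1⁻¹ + 1) with hC2
  have hC1n : 0 ≤ C1 := Finset.sum_nonneg fun n _ => by
    have := blockNorm_nonneg (W n)
    positivity
  have hC2n : 0 ≤ C2 := by positivity
  refine ⟨C1 + C2 + 1, by positivity, fun μ hμ z hz φ δ hδ h => ?_⟩
  have hBz := hB μ hμ z hz
  have hpf : 0 ≤ perturbForm N W φ := Finset.sum_nonneg fun n hn =>
    re_inner_nonneg (hW n (Finset.mem_range.mp hn)) _
  constructor
  · have : perturbForm N W φ ≤ C1 * (‖φ 0‖ ^ 2 + δ ^ 2) := by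
      rw [hC1, Finset.sum_mul]
      refine Finset.sum_le_sum fun n hn => ?_
      have hn' := Finset.mem_range.mp hn
      have hf := hBz.forward hδ h n hn'.le
      calc (inner ℂ (φ n) (toEuclideanLin (W n) (φ n))).re
          ≤ ‖φ n‖ * ‖toEuclideanLin (W n) (φ n)‖ :=
            (Complex.re_le_norm _).trans (norm_inner_le_norm _ _)
        _ ≤ ‖φ n‖ * (blockNorm (W n) * ‖φ n‖) := by
            gcongr; exact norm_toEuclideanLin_le _ _
        _ = blockNorm (W n) * ‖φ n‖ ^ 2 := by ring
        _ ≤ blockNorm (W n) * ((3 * B ^ 2) ^ n * (‖φ 0‖ + δ)) ^ 2 := by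
            have := blockNorm_nonneg (W n)
            gcongr
        _ ≤ blockNorm (W n) * ((((3 * B ^ 2) ^ n) ^ 2 * 2) * (‖φ 0‖ ^ 2 + δ ^ 2)) := by
            have := blockNorm_nonneg (W n)
            rw [mul_pow, mul_assoc (((3 * B ^ 2) ^ n) ^ 2)]
            gcongr
            nlinarith [sq_nonneg (‖φ 0‖ - δ)]
        _ = _ := by ring
    refine this.trans ?_
    gcongr
    linarith
  · have hb := hBz.backward hδ h (k := k) (by omega)
    have hk0' : c0 * ‖φ k‖ ^ 2 ≤ perturbForm N W φ := (h0 _).trans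
      (Finset.single_le_sum (f := fun n => (inner ℂ (φ n) (toEuclideanLin (W n) (φ n))).re)
        (fun n hn => re_inner_nonneg (hW n (Finset.mem_range.mp hn)) _)
        (Finset.mem_range.mpr (by omega)))
    have hk1' : c1 * ‖φ (k + 1)‖ ^ 2 ≤ perturbForm N W φ := (h1 _).trans
      (Finset.single_le_sum (f := fun n => (inner ℂ (φ n) (toEuclideanLin (W n) (φ n))).re)
        (fun n hn => re_inner_nonneg (hW n (Finset.mem_range.mp hn)) _)
        (Finset.mem_range.mpr hk))
    have hk0'' : ‖φ k‖ ^ 2 ≤ c0⁻¹ * perturbForm N W φ := by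
      rw [inv_mul_eq_div, le_div_iff₀ hc0]; linarith
    have hk1'' : ‖φ (k + 1)‖ ^ 2 ≤ c1⁻¹ * perturbForm N W φ := by
      rw [inv_mul_eq_div, le_div_iff₀ hc1]; linarith
    have : ‖φ 0‖ ^ 2 ≤ C2 * (perturbForm N W φ + δ ^ 2) := by
      calc ‖φ 0‖ ^ 2 ≤ ((3 * B ^ 2) ^ k * (‖φ k‖ + ‖φ (k + 1)‖ + δ)) ^ 2 := by gcongr
        _ ≤ ((3 * B ^ 2) ^ k) ^ 2 * (3 * (‖φ k‖ ^ 2 + ‖φ (k + 1)‖ ^ 2 + δ ^ 2)) := by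
          rw [mul_pow]
          gcongr
          nlinarith [sq_nonneg (‖φ k‖ - ‖φ (k + 1)‖), sq_nonneg (‖φ k‖ - δ),
            sq_nonneg (‖φ (k + 1)‖ - δ)]
        _ ≤ ((3 * B ^ 2) ^ k) ^ 2 * (3 * ((c0⁻¹ + c1⁻¹ + 1) * (perturbForm N W φ + δ ^ 2))) := by
          gcongr
          have := inv_pos.mpr hc0
          have := inv_pos.mpr hc1
          nlinarith [sq_nonneg δ, mul_nonneg (inv_pos.mpr hc0).le (sq_nonneg δ),
            mul_nonneg (inv_pos.mpr hc1).le (sq_nonneg δ)]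
        _ = _ := by ring
    refine this.trans ?_
    gcongr
    linarith

end MatrixJacobi

end Transfer

/-! ### Elimination of the sites beyond the perturbation -/

namespace MatrixJacobi

open Complex Filter Topology

variable {L : ℕ} (J : MatrixJacobi L)

/-- The matrix of the partial isometry onto the site `n`. -/
def siteMat (L M n : ℕ) : Matrix (Fin M × Fin L) (Fin L) ℂ :=
  Matrix.of fun p b => if (p.1 : ℕ) = n ∧ p.2 = b then 1 else 0

lemma siteMat_mul_apply {M n : ℕ} {ι : Type*} (S : Matrix (Fin L) ι ℂ) (p : Fin M × Fin L) (q : ι) :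
    (siteMat L M n * S) p q = if (p.1 : ℕ) = n then S p.2 q else 0 := by
  rw [mul_apply]
  by_cases h : (p.1 : ℕ) = n
  · simp [siteMat, h]
  · simp [siteMat, h]

lemma mul_siteMat_conjTranspose_apply {M n : ℕ} {ι : Type*} (S : Matrix ι (Fin L) ℂ) (p : ι)
    (q : Fin M × Fin L) : (S * (siteMat L M n)ᴴ) p q = if (q.1 : ℕ) = n then S p q.2 else 0 := by
  rw [mul_apply]
  by_cases h : (q.1 : ℕ) = n
  · simp [siteMat, h, apply_ite]
  · simp [siteMat, h]

lemma siteMat_conjTranspose_mul_self {M n : ℕ} (h : n < M) :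
    (siteMat L M n)ᴴ * siteMat L M n = 1 := by
  ext a b
  rw [mul_apply, Fintype.sum_prod_type]
  rw [Finset.sum_eq_single (⟨n, h⟩ : Fin M) (fun i _ hi => by
      have : ¬ (i : ℕ) = n := fun h0 => hi (Fin.ext h0)
      simp [siteMat, this]) (by simp)]
  simp [siteMat, Matrix.one_apply, apply_ite, eq_comm]

lemma siteMat_mulVec_ne_zero {M n : ℕ} (h : n < M) (v : Fin L → ℂ) (hv : v ≠ 0) :
    siteMat L M n *ᵥ v ≠ 0 := by
  intro h0
  have := congrArg (fun w => (siteMat L M n)ᴴ *ᵥ w) h0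
  simp only [mulVec_mulVec, siteMat_conjTranspose_mul_self h, one_mulVec, mulVec_zero] at this
  exact hv this

/-- The sites of a chain of length `N + K`, split after the first `N`. -/
def splitSites (L N K : ℕ) : (Fin N × Fin L) ⊕ (Fin K × Fin L) ≃ Fin (N + K) × Fin L :=
  (Equiv.sumProdDistrib _ _ _).symm.trans (finSumFinEquiv.prodCongr (Equiv.refl _))

/-- The two halves of the chain are coupled only by `T (N - 1)`, between site `N - 1` and the first
site of the shifted chain. -/
lemma trunc_submatrix_splitSites {N K : ℕ} (hN : 0 < N) :
    (J.trunc (N + K)).submatrix (splitSites L N K) (splitSites L N K) =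
      fromBlocks (J.trunc N) (siteMat L N (N - 1) * J.T (N - 1) * (siteMat L K 0)ᴴ)
        (siteMat L N (N - 1) * J.T (N - 1) * (siteMat L K 0)ᴴ)ᴴ ((J.shift N).trunc K) := by
  ext (⟨i, a⟩ | ⟨i, a⟩) (⟨j, b⟩ | ⟨j, b⟩)
  · simp [splitSites, trunc_apply]
  · rw [fromBlocks_apply₁₂, mul_siteMat_conjTranspose_apply, siteMat_mul_apply]
    have h1 : ¬ ((i : ℕ) = N + j) := by omega
    have h2 : ¬ ((i : ℕ) = N + j + 1) := by omega
    simp only [splitSites, submatrix_apply, Equiv.trans_apply, Equiv.sumProdDistrib_symm_apply_left,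
      Equiv.sumProdDistrib_symm_apply_right, Equiv.prodCongr_apply, Prod.map_apply,
      finSumFinEquiv_apply_left, finSumFinEquiv_apply_right, trunc_apply, Fin.val_castAdd,
      Fin.val_natAdd, Equiv.refl_apply, h1, h2, if_false]
    by_cases h3 : (j : ℕ) = 0
    · by_cases h4 : (i : ℕ) = N - 1
      · rw [if_pos (by omega), if_pos h3, if_pos h4, h4]
      · rw [if_neg (by omega), if_pos h3, if_neg h4]
    · rw [if_neg (by omega), if_neg h3]
  · rw [fromBlocks_apply₂₁, conjTranspose_apply, mul_siteMat_conjTranspose_apply, siteMat_mul_apply]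
    have h1 : ¬ (N + i = (j : ℕ)) := by omega
    have h2 : ¬ ((j : ℕ) = N + i + 1) := by omega
    simp only [splitSites, submatrix_apply, Equiv.trans_apply, Equiv.sumProdDistrib_symm_apply_left,
      Equiv.sumProdDistrib_symm_apply_right, Equiv.prodCongr_apply, Prod.map_apply,
      finSumFinEquiv_apply_left, finSumFinEquiv_apply_right, trunc_apply, Fin.val_castAdd,
      Fin.val_natAdd, Equiv.refl_apply, h1, h2, if_false]
    by_cases h3 : (i : ℕ) = 0
    · by_cases h4 : (j : ℕ) = N - 1
      · rw [if_pos (by omega), if_pos h3, if_pos h4, h4, conjTranspose_apply]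
      · rw [if_neg (by omega), if_pos h3, if_neg h4, star_zero]
    · rw [if_neg (by omega), if_neg h3, star_zero]
  · simp [splitSites, trunc_apply, shift, add_assoc]

lemma imPos_smul_one_sub_trunc {z : ℂ} (hz : 0 < z.im) (M : ℕ) :
    ImPos (z • (1 : Matrix (Fin M × Fin L) (Fin M × Fin L) ℂ) - J.trunc M) :=
  imPos_smul_one_sub (J.trunc_isHermitian M) hz

variable (N : ℕ) (W : ℕ → Matrix (Fin L) (Fin L) ℂ) (hW : ∀ n < N, (W n).PosSemidef)

/-- The perturbation is cut off at `N`. For this reason the matrix `S` and the constant obtained by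
the elimination do not depend on `μ`. -/
lemma trunc_shift_perturb (μ : ℝ) (K : ℕ) :
    ((J.perturb N W hW μ).shift N).trunc K = (J.shift N).trunc K := by
  ext p q
  simp [trunc_apply, shift, perturb, cutoff]

/-- Elimination of the sites beyond `N` from the determinant. -/
lemma exists_det_trunc_eq (hN : 0 < N) {K : ℕ} (hK : 0 < K) {z : ℂ} (hz : 0 < z.im) :
    ∃ S : Matrix (Fin L) (Fin L) ℂ, ImPos S ∧ ∃ c : ℂ, c ≠ 0 ∧ ∀ μ : ℝ,
      (z • (1 : Matrix (Fin (N + K) × Fin L) (Fin (N + K) × Fin L) ℂ) -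
        (J.perturb N W hW μ).trunc (N + K)).det =
      c * (z • (1 : Matrix (Fin N × Fin L) (Fin N × Fin L) ℂ) - J.finiteHamiltonian N W μ +
        siteMat L N (N - 1) * S * (siteMat L N (N - 1))ᴴ).det := by
  set D := z • (1 : Matrix (Fin K × Fin L) (Fin K × Fin L) ℂ) - (J.shift N).trunc K with hD
  have hDpos : ImPos D := imPos_smul_one_sub_trunc _ hz K
  set R := J.T (N - 1) * (siteMat L K 0)ᴴ with hR
  set P := siteMat L N (N - 1) with hP
  -- `S` is minus the inverse of the far block, compressed to the boundary by `R`. Its positivity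
  -- needs `Rᴴ` injective, that is, `T (N - 1)` invertible and `K > 0`.
  refine ⟨R * (-D⁻¹) * Rᴴ, hDpos.neg_inv.conj R fun v hv => ?_, D.det, hDpos.isUnit_det.ne_zero,
    fun μ => ?_⟩
  · rw [hR, conjTranspose_mul, conjTranspose_conjTranspose, ← mulVec_mulVec]
    refine siteMat_mulVec_ne_zero hK _ fun h0 => hv ?_
    have hu : IsUnit (J.T (N - 1))ᴴ := isUnit_conjTranspose _ |>.mpr (J.isUnit_T _)
    exact (mulVec_injective_iff_isUnit.mpr hu) (by rw [h0, mulVec_zero])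
  · have h1 := (J.perturb N W hW μ).trunc_submatrix_splitSites (K := K) hN
    rw [trunc_shift_perturb, trunc_perturb_self] at h1
    have hT : (J.perturb N W hW μ).T (N - 1) = J.T (N - 1) := rfl
    rw [hT, Matrix.mul_assoc, ← hR, ← hP] at h1
    have h2 : (z • (1 : Matrix (Fin (N + K) × Fin L) (Fin (N + K) × Fin L) ℂ) -
        (J.perturb N W hW μ).trunc (N + K)).submatrix (splitSites L N K) (splitSites L N K) =
        fromBlocks (z • (1 : Matrix (Fin N × Fin L) (Fin N × Fin L) ℂ) - J.finiteHamiltonian N W μ)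
          (-(P * R)) (-(P * R)ᴴ) D := by
      rw [submatrix_sub, Pi.sub_apply, Pi.sub_apply, h1, submatrix_smul, Pi.smul_apply, Pi.smul_apply,
        submatrix_one_equiv, ← fromBlocks_one, fromBlocks_smul, sub_eq_add_neg, fromBlocks_neg,
        fromBlocks_add]
      simp [hD, sub_eq_add_neg]
    rw [← det_submatrix_equiv_self (splitSites L N K), h2]
    let _ := Matrix.invertibleOfIsUnitDet _ hDpos.isUnit_det
    rw [det_fromBlocks₂₂, invOf_eq_nonsing_inv]
    congr 2
    rw [conjTranspose_mul]
    simp [Matrix.mul_assoc, sub_eq_add_neg]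

end MatrixJacobi

/-! ### Winding of the determinant as the coupling varies -/

section Winding

open Complex Filter Topology

/-- The limit point lies on the negative half-axis, where `arg` jumps; the approach is from the
upper half-plane only, so the limit is `π` and not `-π`. -/
lemma tendsto_arg_sub_of_gt {E l : ℝ} (h : E < l) :
    Tendsto (fun p : ℝ × ℝ => arg ((p.1 : ℂ) + p.2 * I - l)) (𝓝 E ×ˢ 𝓝[>] 0) (𝓝 Real.pi) := by
  have h1 : Tendsto (fun p : ℝ × ℝ => (p.1 : ℂ) + p.2 * I - l) (𝓝 E ×ˢ 𝓝[>] 0)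
      (𝓝[{z : ℂ | 0 ≤ z.im}] ((E - l : ℝ) : ℂ)) := by
    refine tendsto_nhdsWithin_iff.mpr ⟨?_, ?_⟩
    · have : Tendsto (fun p : ℝ × ℝ => (p.1 : ℂ) + p.2 * I - l) (𝓝 (E, 0))
          (𝓝 ((E : ℂ) + (0 : ℝ) * I - l)) :=
        Continuous.tendsto (f := fun p : ℝ × ℝ => (p.1 : ℂ) + p.2 * I - l) (by fun_prop) (E, 0)
      rw [nhds_prod_eq] at this
      refine (this.mono_left (prod_mono le_rfl nhdsWithin_le_nhds)).trans_eq ?_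
      simp
    · have : ∀ᶠ p : ℝ × ℝ in 𝓝 E ×ˢ 𝓝[>] 0, 0 < p.2 :=
        tendsto_snd.eventually self_mem_nhdsWithin
      filter_upwards [this] with p hp
      simpa using hp.le
  exact (tendsto_arg_nhdsWithin_im_nonneg_of_re_neg_of_im_zero (by simpa using h) (by simp)).comp h1

lemma tendsto_arg_sub_of_lt {E l : ℝ} (h : l < E) :
    Tendsto (fun p : ℝ × ℝ => arg ((p.1 : ℂ) + p.2 * I - l)) (𝓝 E ×ˢ 𝓝[>] 0) (𝓝 0) := by
  have h1 : Tendsto (fun p : ℝ × ℝ => (p.1 : ℂ) + p.2 * I - l) (𝓝 E ×ˢ 𝓝[>] 0)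
      (𝓝 ((E - l : ℝ) : ℂ)) := by
    have : Tendsto (fun p : ℝ × ℝ => (p.1 : ℂ) + p.2 * I - l) (𝓝 (E, 0))
        (𝓝 ((E : ℂ) + (0 : ℝ) * I - l)) :=
      Continuous.tendsto (f := fun p : ℝ × ℝ => (p.1 : ℂ) + p.2 * I - l) (by fun_prop) (E, 0)
    rw [nhds_prod_eq] at this
    refine (this.mono_left (prod_mono le_rfl nhdsWithin_le_nhds)).trans_eq ?_
    simp
  have h2 : ContinuousAt arg ((E - l : ℝ) : ℂ) :=
    continuousAt_arg (ofReal_mem_slitPlane.mpr (by linarith))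
  have h3 : arg ((E - l : ℝ) : ℂ) = 0 := arg_ofReal_of_nonneg (by linarith)
  have := h2.tendsto.comp h1
  rwa [h3] at this

lemma eventually_pos_snd (E : ℝ) : ∀ᶠ p : ℝ × ℝ in 𝓝 E ×ˢ 𝓝[>] 0, 0 < p.2 :=
  tendsto_snd.eventually self_mem_nhdsWithin

/-- The total rotation of `x + iε - f j` when the ordered tuple `f₀` is replaced by `f₁`. -/
lemma eventually_le_sum_arg_sub {m : ℕ} {f₀ f₁ : Fin m → ℝ} (h₀ : Antitone f₀) (h₁ : Antitone f₁)
    {E : ℝ} {k : ℕ} (hk : 0 < k) (hcard : k ≤ {j | f₀ j < E ∧ E < f₁ j}.ncard) {θ : ℝ} (hθ : 0 < θ) :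
    ∀ᶠ p : ℝ × ℝ in 𝓝 E ×ˢ 𝓝[>] 0, k * Real.pi - θ ≤
      ∑ j, arg ((p.1 : ℂ) + p.2 * I - f₁ j) - ∑ j, arg ((p.1 : ℂ) + p.2 * I - f₀ j) := by
  classical
  set P : Set (Fin m) := {j | f₀ j < E ∧ E < f₁ j} with hP
  -- Each of the `m` indices may lose `2τ`, hence at most `θ` altogether; the `+ 1` covers `m = 0`.
  set τ := θ / (2 * (m + 1)) with hτ
  have hτ0 : 0 < τ := by positivity
  -- One passing index prevents any backward rotation: by antitonicity, an index with `f₀ j ≥ E`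
  -- precedes `j₀`, so `f₁ j` exceeds `E` and its final angle is close to `π`.
  obtain ⟨j₀, hj₀⟩ : P.Nonempty := by
    rw [← Set.ncard_pos]
    omega
  have hup : ∀ l : ℝ, E < l → ∀ᶠ p : ℝ × ℝ in 𝓝 E ×ˢ 𝓝[>] 0,
      Real.pi - τ < arg ((p.1 : ℂ) + p.2 * I - l) := fun l hl =>
    (tendsto_arg_sub_of_gt hl).eventually_const_lt (by linarith)
  have hdn : ∀ l : ℝ, l < E → ∀ᶠ p : ℝ × ℝ in 𝓝 E ×ˢ 𝓝[>] 0,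
      arg ((p.1 : ℂ) + p.2 * I - l) < τ := fun l hl =>
    (tendsto_arg_sub_of_lt hl).eventually_lt_const hτ0
  have hnn : ∀ᶠ p : ℝ × ℝ in 𝓝 E ×ˢ 𝓝[>] 0, ∀ l : ℝ, 0 ≤ arg ((p.1 : ℂ) + p.2 * I - l) := by
    filter_upwards [eventually_pos_snd E] with p hp l
    rw [arg_nonneg_iff]
    simpa using hp.le
  have key : ∀ j, ∀ᶠ p : ℝ × ℝ in 𝓝 E ×ˢ 𝓝[>] 0, (if j ∈ P then Real.pi else 0) - 2 * τ ≤
      arg ((p.1 : ℂ) + p.2 * I - f₁ j) - arg ((p.1 : ℂ) + p.2 * I - f₀ j) := by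
    intro j
    by_cases hj : j ∈ P
    · filter_upwards [hup _ hj.2, hdn _ hj.1] with p h1 h2
      rw [if_pos hj]
      linarith
    · rw [if_neg hj]
      by_cases hE : E ≤ f₀ j
      · have hjj : j ≤ j₀ := by
          by_contra h
          have := h₀ (not_le.mp h).le
          linarith [hj₀.1]
        have : E < f₁ j := hj₀.2.trans_le (h₁ hjj)
        filter_upwards [hup _ this] with p h1
        have := arg_le_pi ((p.1 : ℂ) + p.2 * I - f₀ j)
        linarith
      · filter_upwards [hdn _ (not_le.mp hE), hnn] with p h1 h2
        have := h2 (f₁ j)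
        linarith
  filter_upwards [eventually_all.mpr key] with p hp
  have hs := Finset.sum_le_sum fun j (_ : j ∈ Finset.univ) => hp j
  rw [Finset.sum_sub_distrib, Finset.sum_sub_distrib, ← Finset.sum_filter, Finset.sum_const,
    Finset.sum_const, nsmul_eq_mul, nsmul_eq_mul, Finset.card_univ, Fintype.card_fin] at hs
  have hc : (k : ℝ) ≤ ((Finset.univ.filter fun j => j ∈ P).card : ℝ) := by
    rw [Set.ncard_eq_toFinset_card'] at hcard
    have : P.toFinset = Finset.univ.filter fun j => j ∈ P := by ext; simp
    rw [this] at hcard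
    exact_mod_cast hcard
  have hm : (m : ℝ) * (2 * τ) ≤ θ := by
    rw [hτ]
    have : (0 : ℝ) < m + 1 := by positivity
    rw [show (m : ℝ) * (2 * (θ / (2 * (m + 1)))) = θ * (m / (m + 1)) by field_simp]
    have : (m : ℝ) / (m + 1) ≤ 1 := by rw [div_le_one this]; linarith
    nlinarith
  have hpi := mul_le_mul_of_nonneg_right hc Real.pi_pos.le
  linarith

variable {n m : Type*} [Fintype n] [DecidableEq n] [Fintype m] [DecidableEq m]

/-- The additive constant in `IsLogDet.eq_sum_log` is the same at both ends and cancels. Only the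
ordered eigenvalues at the end points enter, so no smooth choice of eigenvalue branches is needed.
-/
lemma im_integral_logDeriv_hermitian {X : ℝ → Matrix n n ℂ} (hX : ∀ t, (X t).IsHermitian)
    (hc : ∀ i j, ContDiff ℝ 1 fun t => X t i j) {z : ℂ} (hz : 0 < z.im) (a b : ℝ) :
    (∫ t in a..b, logDeriv (fun t => (z • (1 : Matrix n n ℂ) - X t).det) t).im =
      ∑ j, arg (z - (hX b).eigenvalues₀ j) - ∑ j, arg (z - (hX a).eigenvalues₀ j) := by
  obtain ⟨l, hl⟩ := exists_isLogDet n
  rw [hl.integral_logDeriv (K := fun t => z • (1 : Matrix n n ℂ) - X t)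
    (fun i j => by simpa using contDiff_const.sub (hc i j))
    (fun t => imPos_smul_one_sub (hX t) hz), hl.eq_sum_log (hX a) hz, hl.eq_sum_log (hX b) hz]
  have key : ∀ t, (∑ k, Complex.log (z - (hX t).eigenvalues k)).im =
      ∑ j, arg (z - (hX t).eigenvalues₀ j) := by
    intro t
    rw [im_sum]
    simp only [log_im, IsHermitian.eigenvalues]
    exact Equiv.sum_comp (Fintype.equivOfCardEq (Fintype.card_fin _)).symm
      fun j => arg (z - (hX t).eigenvalues₀ j)
  rw [add_sub_add_right_eq_sub, sub_im, key, key]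

/-- A perturbation with positive imaginary part of a boundary condition of rank `|m|` changes the
winding of the determinant by at most `π |m|`. -/
lemma abs_im_integral_logDeriv_sub_le {X : ℝ → Matrix n n ℂ} (hX : ∀ t, (X t).IsHermitian)
    (hc : ∀ i j, ContDiff ℝ 1 fun t => X t i j) {z : ℂ} (hz : 0 < z.im) {S : Matrix m m ℂ}
    (hS : ImPos S) (P : Matrix n m ℂ) (hP : ∀ v, v ≠ 0 → P *ᵥ v ≠ 0) (a b : ℝ) :
    |(∫ t in a..b, logDeriv (fun t => (z • (1 : Matrix n n ℂ) - X t + P * S * Pᴴ).det) t).im -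
      (∫ t in a..b, logDeriv (fun t => (z • (1 : Matrix n n ℂ) - X t).det) t).im| ≤
      Fintype.card m * Real.pi := by
  have hApos : ∀ t, ImPos (z • (1 : Matrix n n ℂ) - X t) := fun t => imPos_smul_one_sub (hX t) hz
  have hAc : ∀ i j, ContDiff ℝ 1 fun t => (z • (1 : Matrix n n ℂ) - X t) i j := fun i j => by
    simpa using contDiff_const.sub (hc i j)
  -- With `A = z - X t`, the determinant lemma gives `det (A + P S Pᴴ) = det A · det (1 + Pᴴ A⁻¹ P
  -- S)`, and the last factor is `det (-(Q t) S)`. Both summands of `Q t` have non-negative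
  -- imaginary part, the first one strictly, so the winding of `det Q` costs at most `|m| π`.
  set Q : ℝ → Matrix m m ℂ := fun t => -S⁻¹ + Pᴴ * (-(z • (1 : Matrix n n ℂ) - X t)⁻¹) * P with hQ
  have hQpos : ∀ t, ImPos (Q t) := fun t => by
    refine hS.neg_inv.add fun v => ?_
    have := (((hApos t).neg_inv).conj Pᴴ (by simpa using hP)).nonneg v
    simpa using this
  have hQc : ∀ i j, ContDiff ℝ 1 fun t => Q t i j := by
    intro i j
    simp only [hQ, Matrix.add_apply, Matrix.mul_apply, Matrix.neg_apply]
    refine contDiff_const.add (ContDiff.sum fun k _ => ContDiff.mul (ContDiff.sum fun l _ =>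
      contDiff_const.mul (contDiff_inv_apply hAc (fun t => (hApos t).isUnit_det) l k).neg)
      contDiff_const)
  have hSu := hS.isUnit_det
  set c : ℂ := (-1) ^ Fintype.card m * S.det with hcdef
  have hc0 : c ≠ 0 := mul_ne_zero (by simp) hSu.ne_zero
  have hdet : ∀ t, (z • (1 : Matrix n n ℂ) - X t + P * S * Pᴴ).det =
      c * ((z • (1 : Matrix n n ℂ) - X t).det * (Q t).det) := by
    intro t
    have hu := (hApos t).isUnit_det
    have e : 1 + Pᴴ * (z • (1 : Matrix n n ℂ) - X t)⁻¹ * (P * S) = -(Q t * S) := by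
      simp only [hQ, Matrix.add_mul, Matrix.neg_mul, Matrix.mul_neg, nonsing_inv_mul _ hSu,
        Matrix.mul_assoc]
      abel
    rw [det_add_mul (A := z • (1 : Matrix n n ℂ) - X t) (P * S) Pᴴ hu, e, det_neg, det_mul, hcdef]
    ring
  have hdA := contDiff_det hAc
  have hdQ := contDiff_det hQc
  have hlog : ∀ t, logDeriv (fun t => (z • (1 : Matrix n n ℂ) - X t + P * S * Pᴴ).det) t =
      logDeriv (fun t => (z • (1 : Matrix n n ℂ) - X t).det) t + logDeriv (fun t => (Q t).det) t := by
    intro t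
    rw [funext hdet, logDeriv_const_mul t c hc0]
    exact logDeriv_mul t ((hApos t).isUnit_det.ne_zero) ((hQpos t).isUnit_det.ne_zero)
      (hdA.differentiable (by simp) t) (hdQ.differentiable (by simp) t)
  have hcont : ∀ {d : ℝ → ℂ}, ContDiff ℝ 1 d → (∀ t, d t ≠ 0) →
      IntervalIntegrable (logDeriv d) volume a b := fun hd hne =>
    ((hd.continuous_deriv le_rfl).div hd.continuous hne).intervalIntegrable _ _
  simp_rw [hlog]
  rw [intervalIntegral.integral_add (hcont hdA fun t => (hApos t).isUnit_det.ne_zero)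
    (hcont hdQ fun t => (hQpos t).isUnit_det.ne_zero), add_im, add_sub_cancel_left]
  exact abs_im_integral_logDeriv_det_le hQc hQpos a b

namespace MatrixJacobi

variable {L : ℕ} (J : MatrixJacobi L) (N : ℕ) (W : ℕ → Matrix (Fin L) (Fin L) ℂ)
  (hW : ∀ n < N, (W n).PosSemidef)

lemma contDiff_finiteHamiltonian_apply (p q : Fin N × Fin L) :
    ContDiff ℝ 1 fun μ : ℝ => J.finiteHamiltonian N W μ p q := by
  simp only [finiteHamiltonian, of_apply]
  have : ContDiff ℝ 1 fun μ : ℝ => (μ : ℂ) := ofRealCLM.contDiff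
  split_ifs
  · simp only [Matrix.add_apply, Matrix.smul_apply, smul_eq_mul]
    fun_prop
  · exact contDiff_const
  · exact contDiff_const
  · exact contDiff_const

lemma logDeriv_det_trunc_eq {K : ℕ} {z : ℂ} {S : Matrix (Fin L) (Fin L) ℂ} {c : ℂ} (hc : c ≠ 0)
    (h : ∀ μ : ℝ, (z • (1 : Matrix (Fin (N + K) × Fin L) (Fin (N + K) × Fin L) ℂ) -
        (J.perturb N W hW μ).trunc (N + K)).det =
      c * (z • (1 : Matrix (Fin N × Fin L) (Fin N × Fin L) ℂ) - J.finiteHamiltonian N W μ +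
        siteMat L N (N - 1) * S * (siteMat L N (N - 1))ᴴ).det) (μ : ℝ) :
    logDeriv (fun μ : ℝ => (z • (1 : Matrix (Fin (N + K) × Fin L) (Fin (N + K) × Fin L) ℂ) -
        (J.perturb N W hW μ).trunc (N + K)).det) μ =
    logDeriv (fun μ : ℝ => (z • (1 : Matrix (Fin N × Fin L) (Fin N × Fin L) ℂ) -
      J.finiteHamiltonian N W μ + siteMat L N (N - 1) * S * (siteMat L N (N - 1))ᴴ).det) μ := by
  rw [funext h, logDeriv_const_mul μ c hc]

/-- Bounds, uniform in the length of the chain, on the winding of the determinant. -/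
lemma eventually_winding_bounds (hL : 0 < L) (hN : 0 < N) (μ₀ μ₁ E : ℝ)
    (hpass : 2 * L ≤ J.passingEigenvalues N W hW μ₀ μ₁ E) :
    ∀ᶠ p : ℝ × ℝ in 𝓝 E ×ˢ 𝓝[>] 0, ∀ K, 0 < K →
      1 ≤ (∫ μ in μ₀..μ₁, logDeriv (fun μ : ℝ => (((p.1 : ℂ) + p.2 * I) •
          (1 : Matrix (Fin (N + K) × Fin L) (Fin (N + K) × Fin L) ℂ) -
          (J.perturb N W hW μ).trunc (N + K)).det) μ).im ∧
      (∫ μ in μ₀..μ₁, logDeriv (fun μ : ℝ => (((p.1 : ℂ) + p.2 * I) •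
          (1 : Matrix (Fin (N + K) × Fin L) (Fin (N + K) × Fin L) ℂ) -
          (J.perturb N W hW μ).trunc (N + K)).det) μ).im ≤ N * L * Real.pi := by
  have hherm := J.finiteHamiltonian_isHermitian N W hW
  filter_upwards [eventually_pos_snd E, eventually_le_sum_arg_sub (hherm μ₀).eigenvalues₀_antitone
    (hherm μ₁).eigenvalues₀_antitone (by omega) hpass one_pos] with p hp hsum K hK
  have hz : 0 < ((p.1 : ℂ) + p.2 * I).im := by simpa using hp
  obtain ⟨S, hS, c, hc, hdet⟩ := J.exists_det_trunc_eq N W hW hN hK hz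
  simp_rw [J.logDeriv_det_trunc_eq N W hW hc hdet]
  have hPne := siteMat_mulVec_ne_zero (L := L) (M := N) (n := N - 1) (by omega)
  constructor
  -- The passing eigenvalues contribute at least `2Lπ - 1`, the boundary term takes away at most
  -- `Lπ`, and `Lπ - 1 ≥ 1`.
  · have h1 := abs_im_integral_logDeriv_sub_le hherm (J.contDiff_finiteHamiltonian_apply N W) hz hS
      (siteMat L N (N - 1)) hPne μ₀ μ₁
    rw [im_integral_logDeriv_hermitian hherm (J.contDiff_finiteHamiltonian_apply N W) hz,
      Fintype.card_fin] at h1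
    have h2 := (abs_le.mp h1).1
    have h3 : (1 : ℝ) ≤ L := by exact_mod_cast hL
    push_cast at hsum
    nlinarith [Real.pi_gt_three]
  · refine (le_abs_self _).trans ((abs_im_integral_logDeriv_det_le (fun i j => ?_) (fun t => ?_)
      μ₀ μ₁).trans_eq (by simp))
    · simpa using (contDiff_const.sub (J.contDiff_finiteHamiltonian_apply N W i j)).add contDiff_const
    · refine (imPos_smul_one_sub (hherm t) hz).add fun v => ?_
      by_cases hv : (siteMat L N (N - 1))ᴴ *ᵥ v = 0
      · rw [← mulVec_mulVec, hv]; simp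
      · have := hS _ hv
        rw [star_mulVec, conjTranspose_conjTranspose, ← dotProduct_mulVec, mulVec_mulVec,
          mulVec_mulVec] at this
        exact this.le

end MatrixJacobi

end Winding

/-! ### Uniform bounds on the averaged Green matrix of the truncations -/

namespace MatrixJacobi

open Complex Filter Topology

variable {L : ℕ} (J : MatrixJacobi L) (N : ℕ) (W : ℕ → Matrix (Fin L) (Fin L) ℂ)
  (hW : ∀ n < N, (W n).PosSemidef)

/-- The Green matrix at the first site of the truncation to `M` sites. -/
def truncGreen (M : ℕ) (z : ℂ) : Matrix (Fin L) (Fin L) ℂ :=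
  (siteMat L M 0)ᴴ * (J.trunc M - z • 1)⁻¹ * siteMat L M 0

lemma trunc_sub_smul_one_isUnit_det (M : ℕ) {z : ℂ} (hz : 0 < z.im) :
    IsUnit (J.trunc M - z • (1 : Matrix (Fin M × Fin L) (Fin M × Fin L) ℂ)).det := by
  rw [← neg_sub, det_neg]
  exact IsUnit.mul (by simp) (J.imPos_smul_one_sub_trunc hz M).isUnit_det

lemma sum_sites {M : ℕ} (F : ℕ → Fin L → ℂ) :
    ∑ p : Fin M × Fin L, F p.1 p.2 = ∑ n ∈ Finset.range M, ∑ a, F n a := by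
  rw [Fintype.sum_prod_type, Fin.sum_univ_eq_sum_range (fun n => ∑ a, F n a) M]

lemma blockPotential_mulVec {M : ℕ} (g : Fin M × Fin L → ℂ) (p : Fin M × Fin L) :
    (blockPotential N W M *ᵥ g) p = (toEuclideanLin (cutoff N W p.1) (extendZero g p.1)) p.2 := by
  obtain ⟨i, a⟩ := p
  simp only [mulVec, dotProduct, blockPotential, of_apply, Fintype.sum_prod_type]
  rw [Finset.sum_eq_single i (fun j _ hj => by simp [Ne.symm hj]) (by simp)]
  simp only [if_true, toLpLin_apply, mulVec, dotProduct]
  exact Finset.sum_congr rfl fun b _ => by rw [← extendZero_apply g (i, b)]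

lemma re_blockPotential_form {M : ℕ} (hM : N ≤ M) (g : Fin M × Fin L → ℂ) :
    (star g ⬝ᵥ (blockPotential N W M *ᵥ g)).re = perturbForm N W (extendZero g) := by
  have h1 : star g ⬝ᵥ (blockPotential N W M *ᵥ g) =
      ∑ n ∈ Finset.range M, inner ℂ (extendZero g n) (toEuclideanLin (cutoff N W n) (extendZero g n)) := by
    simp only [dotProduct, blockPotential_mulVec, Pi.star_apply]
    conv_lhs => rw [Finset.sum_congr rfl fun p _ => by rw [← extendZero_apply g p]]
    rw [sum_sites (fun n a => star (extendZero g n a) *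
      (toEuclideanLin (cutoff N W n) (extendZero g n)) a)]
    refine Finset.sum_congr rfl fun n _ => ?_
    rw [PiLp.inner_apply]
    exact Finset.sum_congr rfl fun a _ => by simp [mul_comm]
  rw [h1, re_sum, perturbForm]
  rw [← Finset.sum_subset (Finset.range_mono hM)]
  · refine Finset.sum_congr rfl fun n hn => ?_
    rw [cutoff, if_pos (Finset.mem_range.mp hn)]
  · intro n _ hn
    rw [cutoff, if_neg (by simpa using hn)]
    simp

lemma re_siteMat_form {M : ℕ} (hM : 0 < M) (g : Fin M × Fin L → ℂ) :
    (star g ⬝ᵥ ((siteMat L M 0 * (siteMat L M 0)ᴴ) *ᵥ g)).re = ‖extendZero g 0‖ ^ 2 := by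
  have h1 : (siteMat L M 0)ᴴ *ᵥ g = (extendZero g 0).ofLp := by
    funext a
    simp only [mulVec, dotProduct, conjTranspose_apply, siteMat, of_apply, Fintype.sum_prod_type]
    rw [Finset.sum_eq_single (⟨0, hM⟩ : Fin M) (fun i _ hi => by
      have : ¬ (i : ℕ) = 0 := fun h0 => hi (Fin.ext h0)
      simp [this]) (by simp)]
    simp [extendZero, hM, apply_ite]
  have h2 : star g ⬝ᵥ ((siteMat L M 0 * (siteMat L M 0)ᴴ) *ᵥ g) =
      star ((siteMat L M 0)ᴴ *ᵥ g) ⬝ᵥ ((siteMat L M 0)ᴴ *ᵥ g) := by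
    rw [star_mulVec, conjTranspose_conjTranspose, ← dotProduct_mulVec, mulVec_mulVec]
  rw [h2, h1, EuclideanSpace.norm_sq_eq]
  simp only [dotProduct, Pi.star_apply, re_sum]
  refine Finset.sum_congr rfl fun a _ => ?_
  rw [← Complex.normSq_eq_norm_sq, Complex.normSq_apply]
  simp

lemma im_trace_truncGreen {M : ℕ} (hM : 0 < M) {z : ℂ} (hz : 0 < z.im) :
    (J.truncGreen M z).trace.im =
      z.im * ∑ c, ‖extendZero ((J.trunc M - z • 1)⁻¹.col c) 0‖ ^ 2 := by
  rw [truncGreen, Matrix.mul_assoc, trace_mul_comm, Matrix.mul_assoc,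
    im_trace_inv_mul (J.trunc_isHermitian M) (isHermitian_mul_conjTranspose_self _) hz]
  simp_rw [re_siteMat_form hM]

lemma im_logDeriv_det_trunc {M : ℕ} (hM : N ≤ M) {z : ℂ} (hz : 0 < z.im) (μ : ℝ) :
    (logDeriv (fun μ : ℝ => (z • (1 : Matrix (Fin M × Fin L) (Fin M × Fin L) ℂ) -
      (J.perturb N W hW μ).trunc M).det) μ).im =
      z.im * ∑ c, perturbForm N W
        (extendZero (((J.perturb N W hW μ).trunc M - z • 1)⁻¹.col c)) := by
  have hu := ((J.perturb N W hW μ).imPos_smul_one_sub_trunc hz M).isUnit_det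
  have e : ∀ μ : ℝ, z • (1 : Matrix (Fin M × Fin L) (Fin M × Fin L) ℂ) -
      (J.perturb N W hW μ).trunc M = (z • (1 : Matrix (Fin M × Fin L) (Fin M × Fin L) ℂ) - J.trunc M)
        - (μ : ℂ) • blockPotential N W M := fun μ => by rw [trunc_perturb]; abel
  have hinv : -(z • (1 : Matrix (Fin M × Fin L) (Fin M × Fin L) ℂ) - (J.perturb N W hW μ).trunc M)⁻¹
      = ((J.perturb N W hW μ).trunc M - z • 1)⁻¹ := by
    symm
    apply inv_eq_right_inv
    rw [← neg_sub (z • (1 : Matrix (Fin M × Fin L) (Fin M × Fin L) ℂ)), neg_mul_neg,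
      mul_nonsing_inv _ hu]
  simp_rw [e]
  rw [logDeriv_det_sub_smul (by rw [← e]; exact hu), ← e, ← trace_neg, ← Matrix.neg_mul, hinv,
    im_trace_inv_mul ((J.perturb N W hW μ).trunc_isHermitian M) (blockPotential_isHermitian hW M) hz]
  simp_rw [re_blockPotential_form N W hM]

/-- A column of the resolvent solves the Jacobi equation with a unit source at its index, so an
error is visible on the first `N` sites only when the index lies there. -/
lemma norm_expr_col_le {M : ℕ} (hM : N ≤ M) {z : ℂ} (hz : 0 < z.im) (c : Fin M × Fin L) (n : ℕ)
    (hn : n < N) :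
    ‖J.expr (extendZero ((J.trunc M - z • 1)⁻¹.col c)) n -
      z • extendZero ((J.trunc M - z • 1)⁻¹.col c) n‖ ≤ if (c.1 : ℕ) < N then 1 else 0 := by
  set g := (J.trunc M - z • 1)⁻¹.col c with hg
  have hu := J.trunc_sub_smul_one_isUnit_det M hz
  have h1 : (J.trunc M - z • 1) *ᵥ g = Pi.single c 1 := by
    rw [hg, ← mulVec_single_one, mulVec_mulVec, mul_nonsing_inv _ hu, one_mulVec]
  have hnM : n < M := by omega
  have h2 : J.expr (extendZero g) n - z • extendZero g n =
      if n = c.1 then EuclideanSpace.single c.2 1 else 0 := by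
    ext a
    have h3 := congrFun h1 (⟨n, hnM⟩, a)
    rw [sub_mulVec, smul_mulVec, one_mulVec, Pi.sub_apply, ← J.expr_extendZero g (⟨n, hnM⟩, a),
      Pi.smul_apply, ← extendZero_apply g (⟨n, hnM⟩, a)] at h3
    simp only [PiLp.sub_apply, PiLp.smul_apply]
    refine h3.trans ?_
    obtain ⟨i, b⟩ := c
    by_cases h : n = i
    · subst h
      by_cases hab : a = b
      · simp [hab]
      · simp [hab]
    · have : ((⟨n, hnM⟩, a) : Fin M × Fin L) ≠ (i, b) := fun h0 => h (by
        have := congrArg Prod.fst h0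
        simpa [Fin.ext_iff] using this)
      simp [h, Pi.single_eq_of_ne this]
  rw [h2]
  split_ifs with h3 h4 h5
  · simp
  · omega
  · simp
  · simp

/-- Only `N L` columns have a source in the first `N` sites. The total error is thus independent of
`M`, which makes the bounds uniform in the length of the chain. -/
lemma sum_source_le (M : ℕ) :
    ∑ c : Fin M × Fin L, (if (c.1 : ℕ) < N then (1 : ℝ) else 0) ^ 2 ≤ N * L := by
  rw [Fintype.sum_prod_type]
  simp only [Finset.sum_const, Finset.card_univ, Fintype.card_fin, nsmul_eq_mul, ite_pow, one_pow,
    ne_eq, OfNat.ofNat_ne_zero, not_false_eq_true, zero_pow]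
  rw [← Finset.mul_sum, Fin.sum_univ_eq_sum_range (fun n => if n < N then (1 : ℝ) else 0) M,
    ← Finset.sum_filter, Finset.sum_const, nsmul_eq_mul, mul_one, mul_comm]
  gcongr
  calc _ ≤ (Finset.range N).card := Finset.card_le_card fun n hn => by
        simpa using (Finset.mem_filter.mp hn).2
    _ = N := Finset.card_range N

lemma continuous_trunc_perturb (M : ℕ) : Continuous fun μ : ℝ => (J.perturb N W hW μ).trunc M := by
  simp_rw [trunc_perturb]
  fun_prop

/-- Bounds, uniform in the length of the chain and near the real axis, on the averaged density of
the spectral measure at the first site. -/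
theorem exists_bounds_integral_truncGreen (hL : 0 < L)
    (hWpos : ∃ n, n + 1 < N ∧ (W n).PosDef ∧ (W (n + 1)).PosDef)
    (μ₀ μ₁ E : ℝ) (hμ : μ₀ ≤ μ₁) (hpass : 2 * L ≤ J.passingEigenvalues N W hW μ₀ μ₁ E) :
    ∃ c > 0, ∃ C > 0, ∀ᶠ p : ℝ × ℝ in 𝓝 E ×ˢ 𝓝[>] 0, ∀ M, N < M →
      c ≤ ∫ μ in μ₀..μ₁, ((J.perturb N W hW μ).truncGreen M ((p.1 : ℂ) + p.2 * I)).trace.im ∧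
      ∫ μ in μ₀..μ₁, ((J.perturb N W hW μ).truncGreen M ((p.1 : ℂ) + p.2 * I)).trace.im ≤ C := by
  have hN : 0 < N := by obtain ⟨n, hn, -⟩ := hWpos; omega
  -- The radius `|E| + 2` covers all `z = x + iε` with `|x - E| < 1` and `ε < 1`.
  obtain ⟨A, hA, hcomp⟩ := exists_perturbForm_comparison J N W hW hWpos μ₀ μ₁ (|E| + 2) (by positivity)
  -- With `ε ≤ δ` the integrated source error is at most `1 / (2A)`; after multiplication by `A`
  -- this uses up half of the lower bound 1 on the winding.
  set δ : ℝ := (2 * A * ((N * L + 1) * (μ₁ - μ₀ + 1)))⁻¹ with hδ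
  have hδ0 : 0 < δ := by
    have : 0 ≤ μ₁ - μ₀ := by linarith
    positivity
  have hdist : ∀ᶠ p : ℝ × ℝ in 𝓝 E ×ˢ 𝓝[>] 0, p.1 ∈ Metric.ball E 1 :=
    tendsto_fst.eventually (Metric.ball_mem_nhds E one_pos)
  have hsmall : ∀ᶠ p : ℝ × ℝ in 𝓝 E ×ˢ 𝓝[>] 0, p.2 < min 1 δ :=
    tendsto_snd.eventually (eventually_nhdsWithin_of_eventually_nhds
      (eventually_lt_nhds (lt_min one_pos hδ0)))
  refine ⟨(2 * A)⁻¹, by positivity, A * (N * L * Real.pi + 1) + 1 , by positivity, ?_⟩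
  filter_upwards [J.eventually_winding_bounds N W hW hL hN μ₀ μ₁ E hpass, eventually_pos_snd E, hdist,
    hsmall] with p hwind hp hpE hpδ M hM
  obtain ⟨K, rfl⟩ : ∃ K, M = N + K := ⟨M - N, by omega⟩
  obtain ⟨hlow, hupp⟩ := hwind K (by omega)
  set z : ℂ := (p.1 : ℂ) + p.2 * I with hzdef
  have hzim : z.im = p.2 := by simp [hzdef]
  have hz : 0 < z.im := by rw [hzim]; exact hp
  have hznorm : ‖z‖ ≤ |E| + 2 := by
    have h1 : |p.1| ≤ |E| + 1 := by
      have := abs_sub_abs_le_abs_sub p.1 E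
      have h2 : |p.1 - E| < 1 := by simpa [Real.dist_eq] using hpE
      linarith
    have h2 : p.2 < 1 := hpδ.trans_le (min_le_left _ _)
    calc ‖z‖ ≤ ‖(p.1 : ℂ)‖ + ‖(p.2 : ℂ) * I‖ := norm_add_le _ _
      _ = |p.1| + p.2 := by simp [abs_of_pos hp]
      _ ≤ _ := by linarith
  set F : ℝ → ℝ := fun μ => ((J.perturb N W hW μ).truncGreen (N + K) z).trace.im with hF
  set Q : ℝ → ℂ := fun μ => logDeriv (fun μ : ℝ =>
    (z • (1 : Matrix (Fin (N + K) × Fin L) (Fin (N + K) × Fin L) ℂ) -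
      (J.perturb N W hW μ).trunc (N + K)).det) μ with hQ
  -- Summing the comparison of `φ 0` with the perturbation form over all columns turns it into a
  -- comparison of the winding rate with the spectral density.
  have hpt : ∀ μ ∈ Set.Icc μ₀ μ₁, (Q μ).im ≤ A * (F μ + p.2 * (N * L)) ∧
      F μ ≤ A * ((Q μ).im + p.2 * (N * L)) := by
    intro μ hμ
    have h1 : (Q μ).im = _ := J.im_logDeriv_det_trunc N W hW (Nat.le_add_right N K) hz μ
    have h2 : F μ = _ := (J.perturb N W hW μ).im_trace_truncGreen (M := N + K) (by omega) hz
    have hc := fun c => hcomp μ hμ z hznorm _ (if (c.1 : ℕ) < N then 1 else 0)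
      (by split_ifs <;> norm_num)
      ((J.perturb N W hW μ).norm_expr_col_le N (Nat.le_add_right N K) hz c)
    have hs1 := Finset.sum_le_sum fun c (_ : c ∈ Finset.univ) => (hc c).1
    have hs2 := Finset.sum_le_sum fun c (_ : c ∈ Finset.univ) => (hc c).2
    rw [← Finset.mul_sum, Finset.sum_add_distrib] at hs1 hs2
    have hsrc := sum_source_le (L := L) N (N + K)
    rw [h1, h2, hzim]
    constructor
    · calc _ ≤ p.2 * (A * (_ + N * L)) := by
            gcongr; exact hs1.trans (by gcongr)
        _ = _ := by ring
    · calc _ ≤ p.2 * (A * (_ + N * L)) := by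
            gcongr; exact hs2.trans (by gcongr)
        _ = _ := by ring
  have hFc : Continuous F := by
    have h0 : Continuous fun μ : ℝ => ((J.perturb N W hW μ).trunc (N + K) -
        z • (1 : Matrix (Fin (N + K) × Fin L) (Fin (N + K) × Fin L) ℂ))⁻¹ :=
      continuous_inv_of_isUnit_det ((J.continuous_trunc_perturb N W hW _).sub continuous_const)
        fun μ => (J.perturb N W hW μ).trunc_sub_smul_one_isUnit_det _ hz
    simp only [hF, truncGreen]
    exact Complex.continuous_im.comp
      ((((continuous_const.matrix_mul h0)).matrix_mul continuous_const).matrix_trace)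
  have hQc : Continuous Q := by
    have hd : ContDiff ℝ 1 fun μ : ℝ =>
        (z • (1 : Matrix (Fin (N + K) × Fin L) (Fin (N + K) × Fin L) ℂ) -
          (J.perturb N W hW μ).trunc (N + K)).det := by
      refine contDiff_det fun i j => ?_
      simp only [trunc_perturb, Matrix.sub_apply, Matrix.add_apply, Matrix.smul_apply, smul_eq_mul]
      have : ContDiff ℝ 1 fun μ : ℝ => (μ : ℂ) := ofRealCLM.contDiff
      fun_prop
    exact (hd.continuous_deriv le_rfl).div hd.continuous fun μ =>
      ((J.perturb N W hW μ).imPos_smul_one_sub_trunc hz _).isUnit_det.ne_zero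
  have hQi : (∫ μ in μ₀..μ₁, Q μ).im = ∫ μ in μ₀..μ₁, (Q μ).im :=
    (imCLM.intervalIntegral_comp_comm (hQc.intervalIntegrable μ₀ μ₁)).symm
  rw [hQi] at hlow hupp
  have hQc' : Continuous fun μ => (Q μ).im := Complex.continuous_im.comp hQc
  have hint : ∀ {f : ℝ → ℝ}, Continuous f → ∫ μ in μ₀..μ₁, A * (f μ + p.2 * (N * L)) =
      A * ((∫ μ in μ₀..μ₁, f μ) + (μ₁ - μ₀) * (p.2 * (N * L))) := by
    intro f hf
    rw [intervalIntegral.integral_const_mul, intervalIntegral.integral_add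
      (hf.intervalIntegrable _ _) (by simp), intervalIntegral.integral_const, smul_eq_mul]
  have hI1 : ∫ μ in μ₀..μ₁, (Q μ).im ≤ A * ((∫ μ in μ₀..μ₁, F μ) + (μ₁ - μ₀) * (p.2 * (N * L))) := by
    rw [← hint hFc]
    exact intervalIntegral.integral_mono_on hμ (hQc'.intervalIntegrable _ _)
      (Continuous.intervalIntegrable (by fun_prop) _ _) fun μ hμ => (hpt μ hμ).1
  have hI2 : ∫ μ in μ₀..μ₁, F μ ≤ A * ((∫ μ in μ₀..μ₁, (Q μ).im) + (μ₁ - μ₀) * (p.2 * (N * L))) := by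
    rw [← hint hQc']
    exact intervalIntegral.integral_mono_on hμ (hFc.intervalIntegrable _ _)
      (Continuous.intervalIntegrable (by fun_prop) _ _) fun μ hμ => (hpt μ hμ).2
  have herr : (μ₁ - μ₀) * (p.2 * (N * L)) ≤ (2 * A)⁻¹ := by
    have hX : (0 : ℝ) < (N * L + 1) * (μ₁ - μ₀ + 1) := by
      have : 0 ≤ μ₁ - μ₀ := by linarith
      positivity
    have h1 : p.2 ≤ δ := (hpδ.trans_le (min_le_right _ _)).le
    have h2 : (μ₁ - μ₀) * (N * L) ≤ (N * L + 1) * (μ₁ - μ₀ + 1) := by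
      have h3 : 0 ≤ μ₁ - μ₀ := by linarith
      have h4 : (0 : ℝ) ≤ N * L := by positivity
      nlinarith
    calc (μ₁ - μ₀) * (p.2 * (N * L)) = p.2 * ((μ₁ - μ₀) * (N * L)) := by ring
      _ ≤ δ * ((N * L + 1) * (μ₁ - μ₀ + 1)) := by
        have h3 : 0 ≤ μ₁ - μ₀ := by linarith
        gcongr
      _ = (2 * A)⁻¹ := by
        rw [hδ, mul_inv, mul_assoc, inv_mul_cancel₀ hX.ne', mul_one]
  have hAinv : A * (2 * A)⁻¹ = 1 / 2 := by field_simp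
  constructor
  · by_contra hcon
    have h1 : A * ((∫ μ in μ₀..μ₁, F μ) + (μ₁ - μ₀) * (p.2 * (N * L))) <
        A * ((2 * A)⁻¹ + (2 * A)⁻¹) :=
      mul_lt_mul_of_pos_left (add_lt_add_of_lt_of_le (not_le.mp hcon) herr) hA
    rw [mul_add A (2 * A)⁻¹, hAinv] at h1
    linarith
  · refine hI2.trans ?_
    calc _ ≤ A * (N * L * Real.pi + (2 * A)⁻¹) := by gcongr
      _ = A * (N * L * Real.pi) + 1 / 2 := by rw [mul_add, hAinv]
      _ ≤ _ := by nlinarith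

end MatrixJacobi

/-! ### Resolvents and symmetric perturbations of self-adjoint operators -/

section SelfAdjoint

open Complex Filter Topology

variable {E : Type*} [NormedAddCommGroup E] [InnerProductSpace ℂ E] [CompleteSpace E]
  {A : E →ₗ.[ℂ] E}

lemma IsSelfAdjoint.inner_apply (hA : IsSelfAdjoint A) (x y : A.domain) :
    inner ℂ (A x) (y : E) = inner ℂ (x : E) (A y) := by
  have h := LinearPMap.adjoint_isFormalAdjoint hA.dense_domain
  rw [LinearPMap.isSelfAdjoint_def.mp hA] at h
  exact h x y

/-- `⟨u, A u⟩` is real, so the imaginary part of `⟨u, (A - z) u⟩` is `-Im z ‖u‖²`; then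
Cauchy–Schwarz. -/
lemma IsSelfAdjoint.abs_im_mul_norm_le (hA : IsSelfAdjoint A) (z : ℂ) (u : A.domain) :
    |z.im| * ‖(u : E)‖ ≤ ‖A u - z • (u : E)‖ := by
  have h1 : (inner ℂ (u : E) (A u)).im = 0 := by
    have := hA.inner_apply u u
    rw [← inner_conj_symm] at this
    exact conj_eq_iff_im.mp this
  have h2 : (inner ℂ (u : E) (A u - z • (u : E))).im = -(z.im * ‖(u : E)‖ ^ 2) := by
    rw [inner_sub_right, inner_smul_right, sub_im, h1, inner_self_eq_norm_sq_to_K]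
    simp [← ofReal_pow]
  have h3 : |z.im| * ‖(u : E)‖ ^ 2 ≤ ‖(u : E)‖ * ‖A u - z • (u : E)‖ := by
    calc |z.im| * ‖(u : E)‖ ^ 2 = |(inner ℂ (u : E) (A u - z • (u : E))).im| := by
          rw [h2, abs_neg, abs_mul, abs_of_nonneg (sq_nonneg ‖(u : E)‖)]
      _ ≤ _ := (abs_im_le_norm _).trans (norm_inner_le_norm _ _)
  by_cases hu : ‖(u : E)‖ = 0
  · rw [hu, mul_zero]; exact norm_nonneg _
  · have : 0 < ‖(u : E)‖ := lt_of_le_of_ne (norm_nonneg _) (Ne.symm hu)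
    nlinarith

/-- The lower bound `|Im z| ‖u‖ ≤ ‖(A - z) u‖` gives injectivity and, because `A` is closed, a
closed range. A vector orthogonal to the range is an eigenvector of `A* = A` for the conjugate of
`z`, hence zero by the same bound. So `A - z` is bijective, and the bound controls the inverse. -/
lemma IsSelfAdjoint.exists_resolvent (hA : IsSelfAdjoint A) {z : ℂ} (hz : z.im ≠ 0) :
    ∃ R : E →L[ℂ] E, (∀ f : E, ∃ u : A.domain, (u : E) = R f ∧ A u - z • (u : E) = f) ∧
      ∀ u : A.domain, R (A u - z • (u : E)) = u := by
  set D : A.domain →ₗ[ℂ] E := A.toFun - z • A.domain.subtype with hD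
  have hDa : ∀ u : A.domain, D u = A u - z • (u : E) := fun u => rfl
  have hlow : ∀ u : A.domain, |z.im| * ‖(u : E)‖ ≤ ‖D u‖ := fun u => hA.abs_im_mul_norm_le z u
  have hz' : 0 < |z.im| := abs_pos.mpr hz
  have hinj : Function.Injective D := by
    rw [injective_iff_map_eq_zero]
    intro u hu
    have := hlow u
    rw [hu, norm_zero] at this
    have h2 : ‖(u : E)‖ = 0 := by nlinarith [norm_nonneg (u : E)]
    exact Subtype.ext (norm_eq_zero.mp h2)
  have hclosed : IsClosed (LinearMap.range D : Set E) := by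
    refine isClosed_of_closure_subset fun f hf => ?_
    obtain ⟨g, hg, hgf⟩ := mem_closure_iff_seq_limit.mp hf
    choose u hu using hg
    have hcau : CauchySeq fun k => (u k : E) := by
      have hc := hgf.cauchySeq
      rw [Metric.cauchySeq_iff] at hc ⊢
      intro ε hε
      obtain ⟨K, hK⟩ := hc (|z.im| * ε) (by positivity)
      refine ⟨K, fun m hm n hn => ?_⟩
      have h1 := hK m hm n hn
      rw [dist_eq_norm, ← hu, ← hu, ← map_sub] at h1
      have h2 := (hlow (u m - u n)).trans_lt h1
      rw [dist_eq_norm]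
      exact lt_of_mul_lt_mul_left h2 hz'.le
    obtain ⟨x, hx⟩ := cauchySeq_tendsto_of_complete hcau
    have hAx : Tendsto (fun k => A (u k)) atTop (𝓝 (f + z • x)) := by
      have : (fun k => A (u k)) = fun k => g k + z • (u k : E) := by
        funext k
        rw [← hu, hDa]
        abel
      rw [this]
      exact hgf.add (hx.const_smul z)
    have hmem : ((x, f + z • x) : E × E) ∈ A.graph := by
      refine hA.isClosed.mem_of_tendsto (hx.prodMk_nhds hAx) (Eventually.of_forall fun k => ?_)
      exact A.mem_graph (u k)
    obtain ⟨y, hy1, hy2⟩ := (LinearPMap.mem_graph_iff A).mp hmem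
    refine ⟨y, ?_⟩
    rw [hDa]
    simp only at hy1 hy2
    rw [hy2, hy1, add_sub_cancel_right]
  have hperp : (LinearMap.range D)ᗮ = ⊥ := by
    rw [Submodule.eq_bot_iff]
    intro y hy
    have h1 : ∀ x : A.domain, inner ℂ ((starRingEnd ℂ) z • y) (x : E) = inner ℂ y (A x) := by
      intro x
      have h2 := Submodule.inner_right_of_mem_orthogonal (LinearMap.mem_range_self D x) hy
      have h3 : inner ℂ y (D x) = 0 := by rw [← inner_conj_symm, h2, map_zero]
      rw [hDa, inner_sub_right, inner_smul_right] at h3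
      rw [inner_smul_left, conj_conj]
      exact (sub_eq_zero.mp h3).symm
    have hyd : y ∈ A.adjoint.domain := LinearPMap.mem_adjoint_domain_of_exists y ⟨_, h1⟩
    have h4 := LinearPMap.adjoint_apply_eq hA.dense_domain ⟨y, hyd⟩ h1
    have h5 : ∃ w : A.domain, (w : E) = y ∧ A w = (starRingEnd ℂ) z • y := by
      have hg : ((y, (starRingEnd ℂ) z • y) : E × E) ∈ A.adjoint.graph :=
        (LinearPMap.mem_graph_iff _).mpr ⟨⟨y, hyd⟩, rfl, h4⟩
      rw [LinearPMap.isSelfAdjoint_def.mp hA] at hg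
      exact (LinearPMap.mem_graph_iff _).mp hg
    obtain ⟨w, hw1, hw2⟩ := h5
    have h6 := hA.abs_im_mul_norm_le ((starRingEnd ℂ) z) w
    rw [hw2, hw1, sub_self, norm_zero, conj_im, abs_neg] at h6
    have h7 : ‖y‖ = 0 := by nlinarith [norm_nonneg y]
    exact norm_eq_zero.mp h7
  have hsurj : Function.Surjective D := by
    rw [← LinearMap.range_eq_top]
    have := Submodule.topologicalClosure_eq_top_iff.mpr hperp
    rwa [IsClosed.submodule_topologicalClosure_eq hclosed] at this
  set e := LinearEquiv.ofBijective D ⟨hinj, hsurj⟩ with he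
  have hDe : ∀ f, D (e.symm f) = f := fun f => e.apply_symm_apply f
  refine ⟨(A.domain.subtype.comp e.symm.toLinearMap).mkContinuous |z.im|⁻¹ fun f => ?_, ?_, ?_⟩
  · have := hlow (e.symm f)
    rw [hDe] at this
    rw [inv_mul_eq_div, le_div_iff₀ hz', mul_comm]
    exact this
  · exact fun f => ⟨e.symm f, rfl, hDe f⟩
  · intro u
    have : e.symm (A u - z • (u : E)) = u := by
      rw [← hDa]
      exact e.symm_apply_apply u
    exact congrArg Subtype.val this

/-- Self-adjointness is stable under symmetric everywhere defined perturbations. -/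
lemma IsSelfAdjoint.vadd (hA : IsSelfAdjoint A) {B : E →ₗ[ℂ] E} (hB : B.IsSymmetric) :
    IsSelfAdjoint (B +ᵥ A) := by
  have hdense : Dense ((B +ᵥ A).domain : Set E) := hA.dense_domain
  have happ : ∀ x : (B +ᵥ A).domain, (B +ᵥ A) x = B x + A x := fun x => rfl
  rw [LinearPMap.isSelfAdjoint_def]
  symm
  refine LinearPMap.eq_of_le_of_domain_eq ?_ ?_
  · refine LinearPMap.IsFormalAdjoint.le_adjoint hdense fun x y => ?_
    rw [happ, happ, inner_add_left, inner_add_right]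
    exact congrArg₂ (· + ·) (hB _ _) (hA.inner_apply x y)
  · refine le_antisymm (LinearPMap.IsFormalAdjoint.le_adjoint hdense fun x y => ?_).1 ?_
    · rw [happ, happ, inner_add_left, inner_add_right]
      exact congrArg₂ (· + ·) (hB _ _) (hA.inner_apply x y)
    -- Since `B` is symmetric and defined everywhere, subtracting `B y` from the adjoint value shows
    -- that `y` lies in the domain of `A* = A`.
    · intro y hy
      have h1 := LinearPMap.adjoint_isFormalAdjoint hdense ⟨y, hy⟩
      have h2 : y ∈ A.adjoint.domain := by
        refine LinearPMap.mem_adjoint_domain_of_exists y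
          ⟨(B +ᵥ A).adjoint ⟨y, hy⟩ - B y, fun x => ?_⟩
        have h3 := h1 x
        rw [happ, inner_add_right] at h3
        rw [inner_sub_left, h3]
        have := hB y (x : E)
        rw [this]
        exact add_sub_cancel_left _ _
      rw [LinearPMap.isSelfAdjoint_def.mp hA] at h2
      exact h2

end SelfAdjoint

/-! ### Strong resolvent convergence of the truncations at the first site -/

namespace MatrixJacobi

open Complex Filter Topology

variable {L : ℕ} (J : MatrixJacobi L) (N : ℕ) (W : ℕ → Matrix (Fin L) (Fin L) ℂ)
  (hW : ∀ n < N, (W n).PosSemidef)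

lemma localPerturbation_apply (φ : JacobiSpace L) (n : ℕ) :
    localPerturbation N W φ n = toEuclideanLin (cutoff N W n) (φ n) := by
  change (∑ k ∈ Finset.range N, sitePi k (toEuclideanLin (W k) (φ k)) : JacobiSpace L) n = _
  rw [lp.coeFn_sum, Finset.sum_apply]
  have : ∀ k, (sitePi k (toEuclideanLin (W k) (φ k)) : JacobiSpace L) n =
      if k = n then toEuclideanLin (W k) (φ k) else 0 := by
    intro k
    by_cases h : k = n
    · subst h; simp
    · simp [h]
  simp_rw [this]
  rw [Finset.sum_ite_eq']
  simp only [cutoff, Finset.mem_range]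
  split_ifs <;> simp

include hW in
lemma localPerturbation_isSymmetric (μ : ℝ) :
    ((μ : ℂ) • localPerturbation N W : JacobiSpace L →ₗ[ℂ] JacobiSpace L).IsSymmetric := by
  have h1 : (localPerturbation N W : JacobiSpace L →ₗ[ℂ] JacobiSpace L).IsSymmetric := by
    intro x y
    rw [lp.inner_eq_tsum, lp.inner_eq_tsum]
    refine tsum_congr fun n => ?_
    rw [localPerturbation_apply, localPerturbation_apply]
    exact isSymmetric_toEuclideanLin_iff.mpr (cutoff_isHermitian hW n) _ _
  intro x y
  rw [LinearMap.smul_apply, LinearMap.smul_apply, inner_smul_left, inner_smul_right, h1]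
  simp

lemma localPerturbation_continuous :
    Continuous (localPerturbation N W : JacobiSpace L →ₗ[ℂ] JacobiSpace L) := by
  refine AddMonoidHomClass.continuous_of_bound (localPerturbation N W : JacobiSpace L →ₗ[ℂ] JacobiSpace L) (∑ n ∈ Finset.range N, blockNorm (W n))
    fun φ => ?_
  change ‖(∑ k ∈ Finset.range N, sitePi k (toEuclideanLin (W k) (φ k)) : JacobiSpace L)‖ ≤ _
  rw [Finset.sum_mul]
  refine (norm_sum_le _ _).trans (Finset.sum_le_sum fun n _ => ?_)
  have h1 : ‖(sitePi n (toEuclideanLin (W n) (φ n)) : JacobiSpace L)‖ = ‖toEuclideanLin (W n) (φ n)‖ :=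
    lp.norm_single (by norm_num) _ _
  rw [h1]
  refine (norm_toEuclideanLin_le _ _).trans ?_
  have := blockNorm_nonneg (W n)
  gcongr
  exact lp.norm_apply_le_norm (by norm_num) φ n

lemma LimitPoint.isClosable {J : MatrixJacobi L} (hJ : J.LimitPoint) : J.minimal.IsClosable :=
  (IsSelfAdjoint.isClosed hJ).isClosable.leIsClosable J.minimal.le_closure

include hW in
lemma hamiltonian_isSelfAdjoint (hJ : J.LimitPoint) (μ : ℝ) :
    IsSelfAdjoint (J.hamiltonian N W μ) :=
  IsSelfAdjoint.vadd hJ (localPerturbation_isSymmetric N W hW μ)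

lemma expr_perturb (μ : ℝ) (φ : ℕ → Fibre L) (n : ℕ) :
    (J.perturb N W hW μ).expr φ n = (μ : ℂ) • toEuclideanLin (cutoff N W n) (φ n) + J.expr φ n := by
  have : ∀ k, toEuclideanLin ((J.perturb N W hW μ).V k) (φ k) =
      toEuclideanLin (J.V k) (φ k) + (μ : ℂ) • toEuclideanLin (cutoff N W k) (φ k) := by
    intro k
    simp only [perturb, map_add, map_smul, LinearMap.add_apply, LinearMap.smul_apply]
  cases n with
  | zero => simp only [expr, this]; simp only [perturb]; abel
  | succ n => simp only [expr, this]; simp only [perturb]; abel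

/-- The finitely supported states are a core of `H(μ)`. -/
lemma exists_seq_finiteStates (hJ : J.LimitPoint) (μ : ℝ) (u : (J.hamiltonian N W μ).domain) :
    ∃ φ f : ℕ → JacobiSpace L, (∀ k, φ k ∈ finiteStates L) ∧
      (∀ k n, f k n = (J.perturb N W hW μ).expr (φ k) n) ∧
      (∀ k, ∃ w : (J.hamiltonian N W μ).domain, (w : JacobiSpace L) = φ k ∧
        J.hamiltonian N W μ w = f k) ∧
      Tendsto φ atTop (𝓝 (u : JacobiSpace L)) ∧ Tendsto f atTop (𝓝 (J.hamiltonian N W μ u)) := by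
  have happ : ∀ x : (J.hamiltonian N W μ).domain, J.hamiltonian N W μ x =
      (μ : ℂ) • localPerturbation N W (x : JacobiSpace L) + J.minimal.closure x := fun x => rfl
  have hu : (((u : JacobiSpace L), J.minimal.closure u) : JacobiSpace L × JacobiSpace L) ∈
      _root_.closure (J.minimal.graph : Set (JacobiSpace L × JacobiSpace L)) := by
    have h1 : (((u : JacobiSpace L), J.minimal.closure u) : JacobiSpace L × JacobiSpace L) ∈
        J.minimal.closure.graph := J.minimal.closure.mem_graph u
    rw [← hJ.isClosable.graph_closure_eq_closure_graph] at h1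
    exact h1
  obtain ⟨g, hg, hgu⟩ := mem_closure_iff_seq_limit.mp hu
  have hg' : ∀ k, ∃ ψ : J.minimal.domain, (ψ : JacobiSpace L) = (g k).1 ∧ J.minimal ψ = (g k).2 :=
    fun k => (LinearPMap.mem_graph_iff _).mp (hg k)
  choose ψ hψ1 hψ2 using hg'
  have hfst : Tendsto (fun k => (ψ k : JacobiSpace L)) atTop (𝓝 (u : JacobiSpace L)) := by
    simp_rw [hψ1]
    exact (continuous_fst.tendsto _).comp hgu
  have hsnd : Tendsto (fun k => J.minimal (ψ k)) atTop (𝓝 (J.minimal.closure u)) := by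
    simp_rw [hψ2]
    exact (continuous_snd.tendsto _).comp hgu
  refine ⟨fun k => ψ k, fun k => (μ : ℂ) • localPerturbation N W (ψ k : JacobiSpace L) +
    J.minimal (ψ k), fun k => (ψ k).2, fun k n => ?_, fun k => ?_, hfst, ?_⟩
  · rw [expr_perturb, lp.coeFn_add, Pi.add_apply, lp.coeFn_smul, Pi.smul_apply,
      localPerturbation_apply]
    rfl
  · have hle := J.minimal.le_closure
    refine ⟨⟨ψ k, hle.1 (ψ k).2⟩, rfl, ?_⟩
    rw [happ]
    congr 1
    exact (hle.2 rfl).symm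
  · rw [happ]
    exact (((localPerturbation_continuous N W).tendsto _ |>.comp hfst).const_smul _).add hsnd

/-- The restriction of a state to the first `M` sites. -/
def restrictSites (M : ℕ) (φ : ℕ → Fibre L) : EuclideanSpace ℂ (Fin M × Fin L) :=
  WithLp.toLp 2 fun p => φ p.1 p.2

lemma norm_restrictSites_le (M : ℕ) (φ : JacobiSpace L) : ‖restrictSites M φ‖ ≤ ‖φ‖ := by
  have h1 : ‖restrictSites M φ‖ ^ 2 = ∑ n ∈ Finset.range M, ‖φ n‖ ^ 2 := by
    rw [EuclideanSpace.norm_sq_eq, restrictSites]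
    have := Fintype.sum_prod_type (fun p : Fin M × Fin L => ‖φ p.1 p.2‖ ^ 2)
    refine this.trans ?_
    rw [Fin.sum_univ_eq_sum_range (fun n => ∑ a, ‖φ n a‖ ^ 2) M]
    exact Finset.sum_congr rfl fun n _ => (EuclideanSpace.norm_sq_eq _).symm
  have h2 := lp.sum_rpow_le_norm_rpow (p := 2) (by norm_num) φ (Finset.range M)
  simp only [ENNReal.toReal_ofNat, Real.rpow_ofNat] at h2
  rw [← h1] at h2
  exact (sq_le_sq₀ (norm_nonneg _) (norm_nonneg _)).mp h2

/-- The reality argument of `IsSelfAdjoint.abs_im_mul_norm_le` for matrices; the point is that the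
bound does not depend on the size. -/
lemma norm_le_of_hermitian {n : Type*} [Fintype n] [DecidableEq n] {H : Matrix n n ℂ}
    (hH : H.IsHermitian) {z : ℂ} (hz : 0 < z.im) (g : EuclideanSpace ℂ n) :
    ‖toEuclideanLin (H - z • 1)⁻¹ g‖ ≤ ‖g‖ / z.im := by
  have hu : IsUnit (H - z • (1 : Matrix n n ℂ)).det := by
    rw [← neg_sub, det_neg]
    exact IsUnit.mul (by simp) (imPos_smul_one_sub hH hz).isUnit_det
  set w := toEuclideanLin (H - z • 1)⁻¹ g with hw
  have hg : g = toEuclideanLin H w - z • w := by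
    have : toEuclideanLin (H - z • 1) w = g := by
      rw [hw]
      simp [toLpLin_apply, mulVec_mulVec, mul_nonsing_inv _ hu, -map_sub]
    rw [← this]
    simp
  have h1 : (inner ℂ w (toEuclideanLin H w)).im = 0 := by
    have := isSymmetric_toEuclideanLin_iff.mpr hH w w
    rw [← inner_conj_symm] at this
    exact conj_eq_iff_im.mp this
  have h2 : (inner ℂ w g).im = -(z.im * ‖w‖ ^ 2) := by
    rw [hg, inner_sub_right, inner_smul_right, sub_im, h1, inner_self_eq_norm_sq_to_K]
    simp [← ofReal_pow]
  have h3 : z.im * ‖w‖ ^ 2 ≤ ‖w‖ * ‖g‖ := by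
    calc z.im * ‖w‖ ^ 2 = |(inner ℂ w g).im| := by
          rw [h2, abs_neg, abs_of_nonneg (by positivity)]
      _ ≤ _ := (abs_im_le_norm _).trans (norm_inner_le_norm _ _)
  rw [le_div_iff₀ hz]
  by_cases hn : ‖w‖ = 0
  · rw [hn, zero_mul]; exact norm_nonneg _
  · have : 0 < ‖w‖ := lt_of_le_of_ne (norm_nonneg _) (Ne.symm hn)
    nlinarith

lemma restrictSites_sitePi (M : ℕ) (v : Fibre L) :
    restrictSites M (sitePi 0 v : JacobiSpace L) = WithLp.toLp 2 (siteMat L M 0 *ᵥ v.ofLp) := by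
  ext p
  have h1 : (sitePi 0 v : JacobiSpace L) p.1 = if (p.1 : ℕ) = 0 then v else 0 := by
    by_cases h : (p.1 : ℕ) = 0
    · simp [h]
    · simp [h]
  simp only [restrictSites, h1]
  by_cases h : (p.1 : ℕ) = 0
  · simp [h, siteMat, mulVec, dotProduct]
  · simp [h, siteMat, mulVec, dotProduct]

lemma truncGreen_form (M : ℕ) (z : ℂ) (v : Fibre L) :
    star v.ofLp ⬝ᵥ (J.truncGreen M z *ᵥ v.ofLp) =
      inner ℂ (restrictSites M (sitePi 0 v : JacobiSpace L))
        (toEuclideanLin (J.trunc M - z • 1)⁻¹ (restrictSites M (sitePi 0 v : JacobiSpace L))) := by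
  rw [restrictSites_sitePi, truncGreen, ← mulVec_mulVec, ← mulVec_mulVec, dotProduct_mulVec,
    ← star_mulVec, PiLp.inner_apply]
  simp [dotProduct, toLpLin_apply, mul_comm]

lemma norm_truncGreen_form_le (M : ℕ) {z : ℂ} (hz : 0 < z.im) (v : Fibre L) :
    ‖star v.ofLp ⬝ᵥ (J.truncGreen M z *ᵥ v.ofLp)‖ ≤ ‖v‖ ^ 2 / z.im := by
  rw [truncGreen_form]
  have h0 : ‖restrictSites M (sitePi 0 v : JacobiSpace L)‖ ≤ ‖v‖ :=
    (norm_restrictSites_le M _).trans_eq (lp.norm_single (by norm_num) _ _)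
  calc _ ≤ _ := norm_inner_le_norm _ _
    _ ≤ ‖v‖ * (‖v‖ / z.im) := by
      gcongr
      exact (norm_le_of_hermitian (J.trunc_isHermitian M) hz _).trans (by gcongr)
    _ = _ := by ring

lemma toEuclideanLin_trunc_restrictSites {M : ℕ} (φ : ℕ → Fibre L) (hφ : φ M = 0) :
    toEuclideanLin (J.trunc M) (restrictSites M φ) = restrictSites M (J.expr φ) := by
  ext p
  rw [toLpLin_apply]
  exact J.trunc_mulVec φ hφ p

/-- Strong resolvent convergence of the truncations at the first site. -/
lemma tendsto_truncGreen (hJ : J.LimitPoint) (μ : ℝ) {z : ℂ} (hz : 0 < z.im)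
    {R : JacobiSpace L →L[ℂ] JacobiSpace L} (hR : IsResolvent (J.hamiltonian N W μ) z R)
    (v : Fibre L) :
    Tendsto (fun M => star v.ofLp ⬝ᵥ ((J.perturb N W hW μ).truncGreen M z *ᵥ v.ofLp)) atTop
      (𝓝 (inner ℂ (sitePi 0 v : JacobiSpace L) (R (sitePi 0 v)))) := by
  set h : JacobiSpace L := sitePi 0 v with hh
  set J' := J.perturb N W hW μ with hJ'
  obtain ⟨u, hu1, hu2⟩ := hR.1 h
  obtain ⟨φ, f, hfin, hf, -, hφu, hfu⟩ := J.exists_seq_finiteStates N W hW hJ μ u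
  have hconv : Tendsto (fun k => ‖v‖ * (‖h - (f k - z • φ k)‖ / z.im) + ‖v‖ * ‖φ k - R h‖) atTop
      (𝓝 0) := by
    have h1 : Tendsto (fun k => h - (f k - z • φ k)) atTop (𝓝 0) := by
      have := (tendsto_const_nhds (x := h)).sub (hfu.sub (hφu.const_smul z))
      rwa [hu2, sub_self] at this
    have h2 : Tendsto (fun k => φ k - R h) atTop (𝓝 0) := by
      have := hφu.sub (tendsto_const_nhds (x := R h))
      rwa [hu1, sub_self] at this
    have := ((h1.norm.div_const z.im).const_mul ‖v‖).add (h2.norm.const_mul ‖v‖)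
    simpa using this
  have hhn : ‖h‖ = ‖v‖ := lp.norm_single (by norm_num) _ _
  rw [Metric.tendsto_atTop]
  intro ε hε
  -- First fix a finitely supported `φ k` that nearly solves `(H(μ) - z) φ = h`, then let `M` exceed
  -- its support. From there on the truncated resolvent inverts this approximate equation exactly,
  -- and the residual is controlled by `1 / Im z` uniformly in `M`.
  obtain ⟨k, hk⟩ := (hconv.eventually_lt_const hε).exists
  obtain ⟨m, hm⟩ := (show {n : ℕ | φ k n ≠ 0}.Finite from hfin k).bddAbove
  refine ⟨m + 1, fun M hM => ?_⟩
  have hφM : φ k M = 0 := by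
    by_contra h0
    have := hm h0
    omega
  set G := toEuclideanLin (J'.trunc M - z • 1)⁻¹ with hG
  have hsol : G (restrictSites M (f k - z • φ k : JacobiSpace L)) = restrictSites M (φ k) := by
    have e : restrictSites M (f k - z • φ k : JacobiSpace L) =
        toEuclideanLin (J'.trunc M - z • 1) (restrictSites M (φ k)) := by
      rw [map_sub, LinearMap.sub_apply, J'.toEuclideanLin_trunc_restrictSites _ hφM]
      ext p
      have hfp : J'.expr (φ k) p.1 = f k p.1 := (hf k p.1).symm
      simp [restrictSites, hfp]
      rfl
    rw [e, hG]
    simp [toLpLin_apply, mulVec_mulVec, nonsing_inv_mul _ (J'.trunc_sub_smul_one_isUnit_det M hz),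
      -map_sub]
  have hsub : restrictSites M (h : ℕ → Fibre L) = restrictSites M (h - (f k - z • φ k) : JacobiSpace L) +
      restrictSites M (f k - z • φ k : JacobiSpace L) := by
    ext p
    simp [restrictSites]
  have hφin : inner ℂ (restrictSites M (h : ℕ → Fibre L)) (restrictSites M (φ k)) =
      inner ℂ h (φ k) := by
    have e1 : inner ℂ h (φ k) = inner ℂ v (φ k 0) := lp.inner_single_left _ _ _
    rw [e1, hh, restrictSites_sitePi, PiLp.inner_apply, PiLp.inner_apply]
    simp only [restrictSites]
    have : ∀ p : Fin M × Fin L, (siteMat L M 0 *ᵥ v.ofLp) p = if (p.1 : ℕ) = 0 then v p.2 else 0 := by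
      intro p
      by_cases h : (p.1 : ℕ) = 0
      · simp [h, siteMat, mulVec, dotProduct]
      · simp [h, siteMat, mulVec, dotProduct]
    simp_rw [this]
    rw [sum_sites (fun n a => inner ℂ (if n = 0 then v a else 0) (φ k n a)),
      Finset.sum_eq_single 0 (fun n _ hn => by simp [hn]) (fun h0 => by simp at h0; omega)]
    simp
  rw [truncGreen_form, dist_eq_norm, ← hh, ← hG]
  have key : inner ℂ (restrictSites M (h : ℕ → Fibre L)) (G (restrictSites M (h : ℕ → Fibre L))) -
      inner ℂ h (R h) =
      inner ℂ (restrictSites M (h : ℕ → Fibre L))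
        (G (restrictSites M (h - (f k - z • φ k) : JacobiSpace L))) + inner ℂ h (φ k - R h) := by
    conv_lhs => rw [hsub, map_add, hsol, inner_add_right, ← hsub, hφin]
    rw [inner_sub_right]
    ring
  rw [key]
  refine lt_of_le_of_lt ?_ hk
  refine (norm_add_le _ _).trans (add_le_add ?_ ?_)
  · refine (norm_inner_le_norm _ _).trans ?_
    gcongr
    · exact (norm_restrictSites_le M h).trans_eq hhn
    · exact (norm_le_of_hermitian (J'.trunc_isHermitian M) hz _).trans
        (div_le_div_of_nonneg_right (norm_restrictSites_le M _) hz.le)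
  · exact (norm_inner_le_norm _ _).trans_eq (by rw [hhn])

end MatrixJacobi

/-! ### Stieltjes transforms, the Poisson kernel and inversion -/

section Stieltjes

open Complex Filter Topology BoundedContinuousFunction

/-- The Stieltjes transform of a measure on the line. -/
def stieltjes (ν : Measure ℝ) (z : ℂ) : ℂ := ∫ x : ℝ, ((x : ℂ) - z)⁻¹ ∂ν

/-- The Poisson kernel of the upper half plane. -/
def halfPlaneKernel (ε t : ℝ) : ℝ := Real.pi⁻¹ * (ε / (t ^ 2 + ε ^ 2))

lemma halfPlaneKernel_nonneg {ε : ℝ} (hε : 0 < ε) (t : ℝ) : 0 ≤ halfPlaneKernel ε t := by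
  have := Real.pi_pos
  unfold halfPlaneKernel
  positivity

lemma continuous_halfPlaneKernel {ε : ℝ} (hε : 0 < ε) : Continuous (halfPlaneKernel ε) := by
  unfold halfPlaneKernel
  refine continuous_const.mul (continuous_const.div (by fun_prop) fun t => ?_)
  positivity

lemma sub_ne_zero_of_im_pos {z : ℂ} (hz : 0 < z.im) (x : ℝ) : (x : ℂ) - z ≠ 0 := by
  intro h
  have := congrArg Complex.im h
  simp at this
  exact hz.ne' this

lemma norm_inv_sub_le {z : ℂ} (hz : 0 < z.im) (x : ℝ) : ‖((x : ℂ) - z)⁻¹‖ ≤ z.im⁻¹ := by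
  rw [norm_inv]
  have h1 : z.im ≤ ‖(x : ℂ) - z‖ := by
    have := abs_im_le_norm ((x : ℂ) - z)
    simpa [abs_of_pos hz] using this
  gcongr

lemma continuous_inv_sub {z : ℂ} (hz : 0 < z.im) : Continuous fun x : ℝ => ((x : ℂ) - z)⁻¹ :=
  Continuous.inv₀ (by fun_prop) (sub_ne_zero_of_im_pos hz)

lemma integrable_inv_sub (ν : Measure ℝ) [IsFiniteMeasure ν] {z : ℂ} (hz : 0 < z.im) :
    Integrable (fun x : ℝ => ((x : ℂ) - z)⁻¹) ν :=
  Integrable.of_bound (continuous_inv_sub hz).aestronglyMeasurable _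
    (Eventually.of_forall (norm_inv_sub_le hz))

lemma im_inv_sub (x a ε : ℝ) : (((x : ℂ) - (a + ε * I))⁻¹).im = ε / ((x - a) ^ 2 + ε ^ 2) := by
  rw [inv_im, normSq_apply]
  simp
  ring

lemma im_stieltjes (ν : Measure ℝ) [IsFiniteMeasure ν] {ε : ℝ} (hε : 0 < ε) (a : ℝ) :
    Real.pi⁻¹ * (stieltjes ν (a + ε * I)).im = ∫ x, halfPlaneKernel ε (x - a) ∂ν := by
  have hz : 0 < ((a : ℂ) + ε * I).im := by simpa using hε
  have h1 := imCLM.integral_comp_comm (integrable_inv_sub ν hz)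
  simp only [imCLM_apply] at h1
  rw [stieltjes, ← h1, ← integral_const_mul]
  simp_rw [im_inv_sub]
  rfl

lemma integrable_kernel : Integrable fun s : ℝ => Real.pi⁻¹ * (1 + s ^ 2)⁻¹ :=
  integrable_inv_one_add_sq.const_mul _

lemma integral_kernel : ∫ s : ℝ, Real.pi⁻¹ * (1 + s ^ 2)⁻¹ = 1 := by
  rw [integral_const_mul, integral_univ_inv_one_add_sq, inv_mul_cancel₀ Real.pi_ne_zero]

/-- The convolution of a function with the Poisson kernel, after rescaling. -/
def smoothing (f : ℝ → ℝ) (ε x : ℝ) : ℝ := ∫ s : ℝ, f (x + ε * s) * (Real.pi⁻¹ * (1 + s ^ 2)⁻¹)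

lemma scaled_kernel {ε : ℝ} (hε : 0 < ε) (s : ℝ) :
    Real.pi⁻¹ * (1 + s ^ 2)⁻¹ = ε * halfPlaneKernel ε (ε * s) := by
  unfold halfPlaneKernel
  have : 1 + s ^ 2 ≠ 0 := by positivity
  have : (ε * s) ^ 2 + ε ^ 2 ≠ 0 := by positivity
  field_simp
  ring

lemma integral_mul_halfPlaneKernel (f : ℝ → ℝ) {ε : ℝ} (hε : 0 < ε) (x : ℝ) :
    ∫ a, f a * halfPlaneKernel ε (x - a) = smoothing f ε x := by
  have h1 : ∀ s : ℝ, f (x + ε * s) * (Real.pi⁻¹ * (1 + s ^ 2)⁻¹) =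
      ε * (fun t => f (x + t) * halfPlaneKernel ε t) (ε * s) := fun s => by
    rw [scaled_kernel hε]; ring
  have h2 := integral_add_left_eq_self (μ := volume) (fun a => f a * halfPlaneKernel ε (x - a)) x
  rw [smoothing]
  simp_rw [h1]
  rw [integral_const_mul, Measure.integral_comp_mul_left (fun t => f (x + t) * halfPlaneKernel ε t) ε,
    ← h2, abs_of_pos (inv_pos.mpr hε), smul_eq_mul, ← mul_assoc, mul_inv_cancel₀ hε.ne', one_mul]
  refine integral_congr_ae (Eventually.of_forall fun t => ?_)
  simp [halfPlaneKernel]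

lemma integrable_mul_halfPlaneKernel {f : ℝ → ℝ} (hf : Continuous f) {C : ℝ} (hC : ∀ x, |f x| ≤ C)
    {ε : ℝ} (hε : 0 < ε) (x : ℝ) : Integrable fun a => f a * halfPlaneKernel ε (x - a) := by
  have hp : Integrable fun a => halfPlaneKernel ε (x - a) := by
    have h0 : Integrable (halfPlaneKernel ε) := by
      have := (integrable_kernel.const_mul ε⁻¹)
      have h3 : (fun s : ℝ => ε⁻¹ * (Real.pi⁻¹ * (1 + s ^ 2)⁻¹)) = fun s => halfPlaneKernel ε (s * ε) := by
        funext s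
        rw [scaled_kernel hε, ← mul_assoc, inv_mul_cancel₀ hε.ne', one_mul, mul_comm ε s]
      rw [h3] at this
      exact (integrable_comp_mul_right_iff (halfPlaneKernel ε) hε.ne').mp this
    exact h0.comp_sub_left x
  exact hp.bdd_mul hf.aestronglyMeasurable (Eventually.of_forall hC)

lemma abs_smoothing_le {f : ℝ → ℝ} {C : ℝ} (hC : ∀ x, |f x| ≤ C) (ε x : ℝ) :
    |smoothing f ε x| ≤ C := by
  rw [smoothing, ← Real.norm_eq_abs]
  have h0 : 0 ≤ C := (abs_nonneg _).trans (hC 0)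
  calc _ ≤ ∫ s : ℝ, C * (Real.pi⁻¹ * (1 + s ^ 2)⁻¹) := by
        refine norm_integral_le_of_norm_le (integrable_kernel.const_mul C)
          (Eventually.of_forall fun s => ?_)
        rw [norm_mul, Real.norm_eq_abs, Real.norm_eq_abs, abs_of_nonneg (a := Real.pi⁻¹ * _)]
        · gcongr
          exact hC _
        · have := Real.pi_pos
          positivity
    _ = C := by rw [integral_const_mul, integral_kernel, mul_one]

lemma tendsto_smoothing {f : ℝ → ℝ} (hf : Continuous f) {C : ℝ} (hC : ∀ x, |f x| ≤ C) (x : ℝ) :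
    Tendsto (fun ε => smoothing f ε x) (𝓝[>] 0) (𝓝 (f x)) := by
  have h1 : f x = ∫ s : ℝ, f x * (Real.pi⁻¹ * (1 + s ^ 2)⁻¹) := by
    rw [integral_const_mul, integral_kernel, mul_one]
  rw [h1]
  refine tendsto_integral_filter_of_dominated_convergence
    (fun s => C * (Real.pi⁻¹ * (1 + s ^ 2)⁻¹)) (Eventually.of_forall fun ε => ?_)
    (Eventually.of_forall fun ε => Eventually.of_forall fun s => ?_) (integrable_kernel.const_mul C)
    (Eventually.of_forall fun s => ?_)
  · exact (hf.comp (by fun_prop)).aestronglyMeasurable.mul integrable_kernel.aestronglyMeasurable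
  · rw [norm_mul, Real.norm_eq_abs, Real.norm_eq_abs, abs_of_nonneg (a := Real.pi⁻¹ * _)]
    · gcongr
      exact hC _
    · have := Real.pi_pos
      positivity
  · have h2 : Tendsto (fun ε : ℝ => f (x + ε * s)) (𝓝 0) (𝓝 (f (x + 0 * s))) :=
      (hf.comp (by fun_prop : Continuous fun ε : ℝ => x + ε * s)).tendsto 0
    rw [zero_mul, add_zero] at h2
    exact (h2.mono_left nhdsWithin_le_nhds).mul_const _

/-- `f` is only bounded, so integrability over the line comes from the kernel, whose integral does
not depend on the second variable; finiteness of `ν` handles the rest. This justifies Fubini in the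
inversion formula. -/
lemma integrable_prod_halfPlaneKernel (ν : Measure ℝ) [IsFiniteMeasure ν] {f : ℝ → ℝ}
    (hf : Continuous f) {C : ℝ} (hC : ∀ x, |f x| ≤ C) {ε : ℝ} (hε : 0 < ε) :
    Integrable (fun p : ℝ × ℝ => f p.1 * halfPlaneKernel ε (p.2 - p.1)) (volume.prod ν) := by
  have hm : AEStronglyMeasurable (fun p : ℝ × ℝ => f p.1 * halfPlaneKernel ε (p.2 - p.1))
      (volume.prod ν) := by
    have := continuous_halfPlaneKernel hε
    exact Continuous.aestronglyMeasurable (by fun_prop)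
  refine (integrable_prod_iff' hm).mpr ⟨Eventually.of_forall fun x =>
    integrable_mul_halfPlaneKernel hf hC hε x, ?_⟩
  refine Integrable.of_bound hm.norm.prod_swap.integral_prod_right' C (Eventually.of_forall fun x => ?_)
  have e : ∀ a, ‖f a * halfPlaneKernel ε (x - a)‖ = |f a| * halfPlaneKernel ε (x - a) := fun a => by
    rw [norm_mul, Real.norm_eq_abs, Real.norm_eq_abs, abs_of_nonneg (halfPlaneKernel_nonneg hε _)]
  simp_rw [e]
  rw [integral_mul_halfPlaneKernel (fun a => |f a|) hε]
  exact abs_smoothing_le (fun y => by rw [abs_abs]; exact hC y) ε x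

lemma integral_mul_im_stieltjes (ν : Measure ℝ) [IsFiniteMeasure ν] {f : ℝ → ℝ}
    (hf : Continuous f) {C : ℝ} (hC : ∀ x, |f x| ≤ C) {ε : ℝ} (hε : 0 < ε) :
    ∫ a : ℝ, f a * (Real.pi⁻¹ * (stieltjes ν (a + ε * I)).im) = ∫ x, smoothing f ε x ∂ν := by
  simp_rw [im_stieltjes ν hε, ← integral_const_mul]
  rw [integral_integral_swap (integrable_prod_halfPlaneKernel ν hf hC hε)]
  simp_rw [integral_mul_halfPlaneKernel f hε]

lemma abs_integral_mul_im_stieltjes_le (ν : Measure ℝ) [IsFiniteMeasure ν] {f : ℝ → ℝ}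
    (hf : Continuous f) {C : ℝ} (hC : ∀ x, |f x| ≤ C) {ε : ℝ} (hε : 0 < ε) :
    |∫ a : ℝ, f a * (Real.pi⁻¹ * (stieltjes ν (a + ε * I)).im)| ≤ C * ν.real Set.univ := by
  rw [integral_mul_im_stieltjes ν hf hC hε, ← Real.norm_eq_abs]
  exact norm_integral_le_of_norm_le_const (Eventually.of_forall fun x => abs_smoothing_le hC ε x)

/-- The Stieltjes inversion formula. -/
lemma tendsto_integral_mul_im_stieltjes (ν : Measure ℝ) [IsFiniteMeasure ν] {f : ℝ → ℝ}
    (hf : Continuous f) {C : ℝ} (hC : ∀ x, |f x| ≤ C) :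
    Tendsto (fun ε : ℝ => ∫ a : ℝ, f a * (Real.pi⁻¹ * (stieltjes ν (a + ε * I)).im)) (𝓝[>] 0)
      (𝓝 (∫ x, f x ∂ν)) := by
  have h1 : Tendsto (fun ε => ∫ x, smoothing f ε x ∂ν) (𝓝[>] 0) (𝓝 (∫ x, f x ∂ν)) := by
    refine tendsto_integral_filter_of_dominated_convergence (fun _ => C) ?_
      (Eventually.of_forall fun ε => Eventually.of_forall fun x => abs_smoothing_le hC ε x)
      (integrable_const C) (Eventually.of_forall fun x => tendsto_smoothing hf hC x)
    filter_upwards [self_mem_nhdsWithin] with ε hε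
    have := (integrable_prod_halfPlaneKernel ν hf hC (hε : 0 < ε)).integral_prod_right.aestronglyMeasurable
    refine this.congr (Eventually.of_forall fun x => ?_)
    exact integral_mul_halfPlaneKernel f hε x
  refine h1.congr' ?_
  filter_upwards [self_mem_nhdsWithin] with ε hε
  exact (integral_mul_im_stieltjes ν hf hC hε).symm

/-- Real linear relations between Stieltjes transforms are inherited by the measures. -/
lemma measureReal_eq_sum_of_im_stieltjes_eq {ι : Type*} [Fintype ι] (ν : Measure ℝ)
    [IsFiniteMeasure ν] (νs : ι → Measure ℝ) [∀ i, IsFiniteMeasure (νs i)] (c : ι → ℝ)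
    (h : ∀ z : ℂ, 0 < z.im → (stieltjes ν z).im = ∑ i, c i * (stieltjes (νs i) z).im)
    (B : Set ℝ) : ν.real B = ∑ i, c i * (νs i).real B := by
  have hint : ∀ f : ℝ →ᵇ ℝ, ∫ x, f x ∂ν = ∑ i, c i * ∫ x, f x ∂(νs i) := by
    intro f
    have hC : ∀ x, |f x| ≤ ‖f‖ := fun x => f.norm_coe_le_norm x
    refine tendsto_nhds_unique (tendsto_integral_mul_im_stieltjes ν f.continuous hC) ?_
    have h2 := tendsto_finsetSum Finset.univ fun i _ =>
      (tendsto_integral_mul_im_stieltjes (νs i) f.continuous hC).const_mul (c i)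
    refine h2.congr' ?_
    filter_upwards [self_mem_nhdsWithin] with ε hε
    have hε' : 0 < ε := hε
    have hi : ∀ (τ : Measure ℝ) [IsFiniteMeasure τ],
        Integrable fun a : ℝ => f a * (Real.pi⁻¹ * (stieltjes τ (a + ε * I)).im) := by
      intro τ _
      simp_rw [im_stieltjes τ hε', ← integral_const_mul]
      exact (integrable_prod_halfPlaneKernel τ f.continuous hC hε').integral_prod_left
    have h3 : ∀ a : ℝ, f a * (Real.pi⁻¹ * (stieltjes ν (a + ε * I)).im) =
        ∑ i, c i * (f a * (Real.pi⁻¹ * (stieltjes (νs i) (a + ε * I)).im)) := by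
      intro a
      rw [h _ (by simpa using hε'), Finset.mul_sum, Finset.mul_sum]
      exact Finset.sum_congr rfl fun i _ => by ring
    simp_rw [h3]
    rw [integral_finsetSum _ fun i _ => (hi (νs i)).const_mul (c i)]
    simp_rw [integral_const_mul]
  have hfin : ∀ (b : ι → NNReal), IsFiniteMeasure (∑ i, b i • νs i) := fun b => by infer_instance
  -- The coefficients may have either sign; moving the negative parts to the other side leaves an
  -- identity between finite positive measures, which integrals of bounded continuous functions
  -- determine.
  have hmeas : ν + ∑ i, (-c i).toNNReal • νs i = ∑ i, (c i).toNNReal • νs i := by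
    refine ext_of_forall_integral_eq_of_IsFiniteMeasure fun f => ?_
    have hi : ∀ (τ : Measure ℝ) [IsFiniteMeasure τ], Integrable f τ := fun τ _ => f.integrable τ
    have hsum : ∀ b : ι → NNReal, ∫ x, f x ∂(∑ i, b i • νs i) = ∑ i, (b i : ℝ) * ∫ x, f x ∂(νs i) := by
      intro b
      rw [integral_finsetSum_measure fun i _ => hi _]
      exact Finset.sum_congr rfl fun i _ => by
        rw [integral_smul_nnreal_measure, NNReal.smul_def, smul_eq_mul]
    rw [integral_add_measure (hi _) (hi _), hsum, hsum, hint, ← Finset.sum_add_distrib]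
    refine Finset.sum_congr rfl fun i _ => ?_
    rw [← add_mul, Real.coe_toNNReal', Real.coe_toNNReal']
    congr 1
    rcases le_total 0 (c i) with h | h
    · rw [max_eq_right (by linarith), max_eq_left h, add_zero]
    · rw [max_eq_left (by linarith), max_eq_right h]; ring
  have hreal : ∀ b : ι → NNReal, (∑ i, b i • νs i : Measure ℝ).real B = ∑ i, (b i : ℝ) * (νs i).real B := by
    intro b
    rw [measureReal_def, Measure.finsetSum_apply, ENNReal.toReal_sum fun i _ => measure_ne_top _ _]
    exact Finset.sum_congr rfl fun i _ => by simp [measureReal_def]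
  have h4 := congrArg (fun τ : Measure ℝ => τ.real B) hmeas
  rw [measureReal_add_apply, hreal, hreal] at h4
  have h5 : ∀ i, c i * (νs i).real B = ((c i).toNNReal : ℝ) * (νs i).real B -
      ((-c i).toNNReal : ℝ) * (νs i).real B := by
    intro i
    rw [← sub_mul, Real.coe_toNNReal', Real.coe_toNNReal']
    congr 1
    rcases le_total 0 (c i) with h | h
    · rw [max_eq_right (a := -c i) (by linarith), max_eq_left h, sub_zero]
    · rw [max_eq_left (a := -c i) (by linarith), max_eq_right h]; ring
  simp_rw [h5]
  rw [Finset.sum_sub_distrib]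
  linarith

end Stieltjes

/-! ### Scalar spectral measures as limits of those of finite matrices -/

section Existence

open Complex Filter Topology BoundedContinuousFunction
open scoped NNReal

/-- The spectral measure of a Hermitian matrix at a vector, with Chebyshev's tail bound. -/
lemma exists_measure_of_isHermitian {n : Type*} [Fintype n] [DecidableEq n] {H : Matrix n n ℂ}
    (hH : H.IsHermitian) (h : EuclideanSpace ℂ n) :
    ∃ ν : Measure ℝ, IsFiniteMeasure ν ∧ ν.real Set.univ = ‖h‖ ^ 2 ∧
      (∀ r > 0, ν.real (Set.Icc (-r) r)ᶜ ≤ ‖toEuclideanLin H h‖ ^ 2 / r ^ 2) ∧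
      ∀ z : ℂ, 0 < z.im → stieltjes ν z = inner ℂ h (toEuclideanLin (H - z • 1)⁻¹ h) := by
  set b := hH.eigenvectorBasis
  set c : n → ℝ≥0 := fun k => ‖inner ℂ (b k) h‖₊ ^ 2
  have hb : ∀ k w, inner ℂ (b k) (toEuclideanLin H w) = hH.eigenvalues k * inner ℂ (b k) w := by
    intro k w
    rw [← isSymmetric_toEuclideanLin_iff.mpr hH (b k) w]
    have : toEuclideanLin H (b k) = (hH.eigenvalues k : ℂ) • b k := by
      ext i
      simpa [toLpLin_apply] using congrFun (hH.mulVec_eigenvectorBasis k) i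
    rw [this, inner_smul_left]
    simp
  have hreal : ∀ B, MeasurableSet B → (∑ k, c k • Measure.dirac (hH.eigenvalues k) : Measure ℝ).real B =
      ∑ k, ‖inner ℂ (b k) h‖ ^ 2 * B.indicator 1 (hH.eigenvalues k) := by
    intro B hB
    rw [measureReal_def, Measure.finsetSum_apply, ENNReal.toReal_sum fun i _ => measure_ne_top _ _]
    refine Finset.sum_congr rfl fun k _ => ?_
    rw [Measure.smul_apply, Measure.dirac_apply' _ hB]
    by_cases hk : hH.eigenvalues k ∈ B <;> simp [hk, c, ENNReal.smul_def]
  refine ⟨∑ k, c k • Measure.dirac (hH.eigenvalues k), inferInstance, ?_, fun r hr => ?_,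
    fun z hz => ?_⟩
  · rw [hreal _ MeasurableSet.univ, ← b.sum_sq_norm_inner_right h]
    simp
  · rw [hreal _ measurableSet_Icc.compl, le_div_iff₀ (by positivity),
      ← b.sum_sq_norm_inner_right (toEuclideanLin H h), Finset.sum_mul]
    refine Finset.sum_le_sum fun k _ => ?_
    rw [hb, norm_mul, mul_pow, norm_real, Real.norm_eq_abs, sq_abs]
    by_cases hk : hH.eigenvalues k ∈ (Set.Icc (-r) r)ᶜ
    · have h1 : r ^ 2 ≤ hH.eigenvalues k ^ 2 := by
        refine sq_le_sq.mpr ?_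
        rw [abs_of_pos hr]
        by_contra hcon
        exact hk (abs_le.mp (not_le.mp hcon).le)
      rw [Set.indicator_of_mem hk]
      simp only [Pi.one_apply, mul_one]
      rw [mul_comm]
      gcongr
    · rw [Set.indicator_of_notMem hk, mul_zero, zero_mul]
      positivity
  · have hu : IsUnit (H - z • (1 : Matrix n n ℂ)).det := by
      rw [← neg_sub, det_neg]
      exact IsUnit.mul (by simp) (imPos_smul_one_sub hH hz).isUnit_det
    set w := toEuclideanLin (H - z • 1)⁻¹ h with hw
    have hg : h = toEuclideanLin H w - z • w := by
      have : toEuclideanLin (H - z • 1) w = h := by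
        rw [hw]
        simp [toLpLin_apply, mulVec_mulVec, mul_nonsing_inv _ hu, -map_sub]
      rw [← this]
      simp
    have hin : ∀ k, inner ℂ (b k) w = ((hH.eigenvalues k : ℂ) - z)⁻¹ * inner ℂ (b k) h := by
      intro k
      have h1 : inner ℂ (b k) h = ((hH.eigenvalues k : ℂ) - z) * inner ℂ (b k) w := by
        conv_lhs => rw [hg]
        rw [inner_sub_right, inner_smul_right, hb]
        ring
      rw [h1, ← mul_assoc, inv_mul_cancel₀ (sub_ne_zero_of_im_pos hz _), one_mul]
    rw [stieltjes, integral_finsetSum_measure fun i _ => integrable_inv_sub _ hz,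
      ← b.sum_inner_mul_inner h w]
    refine Finset.sum_congr rfl fun k _ => ?_
    rw [integral_smul_nnreal_measure, integral_dirac, hin, ← inner_conj_symm h (b k)]
    rw [mul_left_comm, ← normSq_eq_conj_mul_self, normSq_eq_norm_sq, NNReal.smul_def, real_smul,
      mul_comm]
    simp [c]

/-- A tight sequence of measures whose Stieltjes transforms converge has a limit. -/
lemma exists_measure_of_tendsto_stieltjes (νs : ℕ → Measure ℝ) [∀ m, IsFiniteMeasure (νs m)]
    {C D : ℝ} (hC : ∀ m, (νs m).real Set.univ ≤ C)
    (hD : ∀ m, ∀ r > 0, (νs m).real (Set.Icc (-r) r)ᶜ ≤ D / r ^ 2) {G : ℂ → ℂ}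
    (hG : ∀ z : ℂ, 0 < z.im → Tendsto (fun m => stieltjes (νs m) z) atTop (𝓝 (G z))) :
    ∃ ν : Measure ℝ, IsFiniteMeasure ν ∧ ν.real Set.univ ≤ C ∧
      ∀ z : ℂ, 0 < z.im → stieltjes ν z = G z := by
  have hC0 : 0 ≤ C := measureReal_nonneg.trans (hC 0)
  have hu : Tendsto (fun k : ℕ => (D / ((k : ℝ) + 1) ^ 2).toNNReal) atTop (𝓝 0) := by
    have h1 : Tendsto (fun k : ℕ => D / ((k : ℝ) + 1) ^ 2) atTop (𝓝 0) :=
      Tendsto.const_div_atTop ((tendsto_pow_atTop two_ne_zero).comp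
        (tendsto_atTop_add_const_right _ _ tendsto_natCast_atTop_atTop)) D
    have h2 := (continuous_real_toNNReal.tendsto 0).comp h1
    rwa [Real.toNNReal_zero] at h2
  -- Prokhorov's theorem, with the tail bound used at the radii `k + 1`, which are positive.
  have hcpt := isCompact_setOfPred_finiteMeasure_mass_le_compl_isCompact_le (E := ℝ) C.toNNReal hu
    (fun k : ℕ => isCompact_Icc (a := -((k : ℝ) + 1)) (b := (k : ℝ) + 1)) (Or.inl inferInstance)
  set F : ℕ → FiniteMeasure ℝ := fun m => ⟨νs m, inferInstance⟩ with hF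
  have hmem : ∀ m, F m ∈ {μ : FiniteMeasure ℝ | μ.mass ≤ C.toNNReal ∧
      ∀ k : ℕ, μ (Set.Icc (-((k : ℝ) + 1)) ((k : ℝ) + 1))ᶜ ≤ (D / ((k : ℝ) + 1) ^ 2).toNNReal} := by
    intro m
    refine ⟨?_, fun k => ?_⟩
    · rw [Real.le_toNNReal_iff_coe_le hC0]
      exact hC m
    · have h1 := hD m ((k : ℝ) + 1) (by positivity)
      rw [Real.le_toNNReal_iff_coe_le (measureReal_nonneg.trans h1)]
      exact h1
  -- A limit along an ultrafilter suffices, because the Stieltjes transforms converge along the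
  -- whole sequence.
  obtain ⟨ν, hν, hlim⟩ := hcpt.ultrafilter_le_nhds' ((hyperfilter ℕ : Ultrafilter ℕ).map F)
    (Ultrafilter.mem_map.mpr (Eventually.of_forall hmem))
  have hlim' : Tendsto F (hyperfilter ℕ : Filter ℕ) (𝓝 ν) := hlim
  refine ⟨ν, inferInstance, ?_, fun z hz => ?_⟩
  · exact (Real.le_toNNReal_iff_coe_le hC0).mp hν.1
  · let f : ℝ →ᵇ ℂ := BoundedContinuousFunction.ofNormedAddCommGroup
      (fun x : ℝ => ((x : ℂ) - z)⁻¹) (continuous_inv_sub hz) z.im⁻¹ (norm_inv_sub_le hz)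
    have h1 := (FiniteMeasure.tendsto_iff_forall_integral_rclike_tendsto ℂ).mp hlim' f
    exact tendsto_nhds_unique h1 ((hG z hz).mono_left Nat.hyperfilter_le_atTop)

namespace MatrixJacobi

variable {L : ℕ} (J : MatrixJacobi L)

/-- The truncated operator applied to a state at the first site is the restriction of one fixed
square-summable sequence. Through Chebyshev's bound this yields tightness. -/
lemma exists_norm_trunc_restrictSites_le (v : Fibre L) :
    ∃ D : ℝ, ∀ M, 0 < M → ‖toEuclideanLin (J.trunc M)
      (restrictSites M (sitePi 0 v : JacobiSpace L))‖ ≤ D := by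
  have h0 : ∀ n, n ≠ 0 → (sitePi 0 v : JacobiSpace L) n = 0 := fun n hn => by
    simp [hn]
  have hmem := J.expr_memℓp (sitePi 0 v : JacobiSpace L) ((Set.finite_singleton 0).subset fun n hn => by
    by_contra h
    exact hn (h0 n h))
  refine ⟨‖(⟨_, hmem⟩ : JacobiSpace L)‖, fun M hM => ?_⟩
  rw [J.toEuclideanLin_trunc_restrictSites _ (h0 M hM.ne')]
  exact norm_restrictSites_le M (⟨_, hmem⟩ : JacobiSpace L)

/-- The scalar spectral measures of a limit of finite Jacobi matrices. -/
lemma exists_measure_of_tendsto_truncGreen (v : Fibre L) {G : ℂ → ℂ}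
    (hG : ∀ z : ℂ, 0 < z.im →
      Tendsto (fun M => star v.ofLp ⬝ᵥ (J.truncGreen M z *ᵥ v.ofLp)) atTop (𝓝 (G z))) :
    ∃ ν : Measure ℝ, IsFiniteMeasure ν ∧ ν.real Set.univ ≤ ‖v‖ ^ 2 ∧
      ∀ z : ℂ, 0 < z.im → stieltjes ν z = G z := by
  obtain ⟨D, hD⟩ := J.exists_norm_trunc_restrictSites_le v
  choose νs hfin hmass htail hst using fun m : ℕ => exists_measure_of_isHermitian
    (J.trunc_isHermitian (m + 1)) (restrictSites (m + 1) (sitePi 0 v : JacobiSpace L))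
  refine exists_measure_of_tendsto_stieltjes νs (D := D ^ 2) (fun m => ?_) (fun m r hr => ?_)
    fun z hz => ?_
  · rw [hmass]
    gcongr
    exact (norm_restrictSites_le _ _).trans_eq (lp.norm_single (by norm_num) _ _)
  · refine (htail m r hr).trans ?_
    gcongr
    exact hD _ m.succ_pos
  · simp_rw [hst _ z hz, ← truncGreen_form]
    exact (hG z hz).comp (tendsto_add_atTop_nat 1)

end MatrixJacobi

end Existence

/-! ### Polarization of quadratic forms -/

section Polarization

open Complex Filter Topology

/-- The vectors `e_j + i^l e_k` of the polarization identity. -/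
def polarVec {L : ℕ} (p : Fin L × Fin L × Fin 4) : Fin L → ℂ :=
  Pi.single p.1 1 + I ^ (p.2.2 : ℕ) • Pi.single p.2.1 1

/-- The Hermitian matrices dual to the vectors `e_j + i^l e_k`. -/
def polarMat {L : ℕ} (p : Fin L × Fin L × Fin 4) : Matrix (Fin L) (Fin L) ℂ :=
  (8⁻¹ : ℂ) • (Matrix.single p.1 p.2.1 (star (I ^ (p.2.2 : ℕ))) +
    Matrix.single p.2.1 p.1 (I ^ (p.2.2 : ℕ)))

lemma polarMat_isHermitian {L : ℕ} (p : Fin L × Fin L × Fin 4) : (polarMat p).IsHermitian := by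
  rw [IsHermitian, polarMat, conjTranspose_smul, conjTranspose_add, conjTranspose_single,
    conjTranspose_single, star_star, add_comm]
  simp

lemma polarMat_form {L : ℕ} (p : Fin L × Fin L × Fin 4) (v : Fin L → ℂ) :
    star v ⬝ᵥ (polarMat p *ᵥ v) =
      ((4⁻¹ * star (v p.1) * v p.2.1 * star (I ^ (p.2.2 : ℕ))).re : ℝ) := by
  have h1 : ∀ (j k : Fin L) (c : ℂ), star v ⬝ᵥ (Matrix.single j k c *ᵥ v) = star (v j) * (c * v k) := by
    intro j k c
    rw [single_mulVec]
    exact dotProduct_single _ _ _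
  rw [polarMat, smul_mulVec, add_mulVec, dotProduct_smul, dotProduct_add, h1, h1]
  generalize I ^ (p.2.2 : ℕ) = c
  apply Complex.ext
  · simp
    ring
  · simp
    ring

lemma form_eq_sum_polarVec {L : ℕ} (K : Matrix (Fin L) (Fin L) ℂ) (v : Fin L → ℂ) :
    star v ⬝ᵥ (K *ᵥ v) = ∑ p : Fin L × Fin L × Fin 4,
      4⁻¹ * star (v p.1) * v p.2.1 * star (I ^ (p.2.2 : ℕ)) *
        (star (polarVec p) ⬝ᵥ (K *ᵥ polarVec p)) := by
  have h1 : ∀ p : Fin L × Fin L × Fin 4, star (polarVec p) ⬝ᵥ (K *ᵥ polarVec p) =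
      K p.1 p.1 + I ^ (p.2.2 : ℕ) * K p.1 p.2.1 + star (I ^ (p.2.2 : ℕ)) * K p.2.1 p.1 +
        star (I ^ (p.2.2 : ℕ)) * I ^ (p.2.2 : ℕ) * K p.2.1 p.2.1 := by
    intro p
    simp only [polarVec, star_add, star_smul, mulVec_add, mulVec_smul, dotProduct_add,
      add_dotProduct, smul_dotProduct, dotProduct_smul, mulVec_single_one, ← Pi.single_star, star_one,
      single_one_dotProduct, col_apply, smul_eq_mul]
    ring
  simp_rw [h1, Fintype.sum_prod_type, Fin.sum_univ_four]
  simp only [dotProduct, mulVec, Finset.mul_sum]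
  refine Finset.sum_congr rfl fun j _ => Finset.sum_congr rfl fun k _ => ?_
  have h3 : I ^ 3 = -I := by rw [pow_succ, I_sq]; ring
  simp [h3]
  ring_nf
  simp
  ring

/-- Apply the complex identity to `K - Kᴴ`, whose forms are purely imaginary. Cancelling `i` and
taking real parts leaves real coefficients, as is needed to transfer the identity to positive
measures through imaginary parts of Stieltjes transforms. -/
lemma im_form_eq_sum_polarVec {L : ℕ} (K : Matrix (Fin L) (Fin L) ℂ) (v : Fin L → ℂ) :
    (star v ⬝ᵥ (K *ᵥ v)).im = ∑ p : Fin L × Fin L × Fin 4,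
      (4⁻¹ * star (v p.1) * v p.2.1 * star (I ^ (p.2.2 : ℕ))).re *
        (star (polarVec p) ⬝ᵥ (K *ᵥ polarVec p)).im := by
  have h0 : ∀ u : Fin L → ℂ, star u ⬝ᵥ (Kᴴ *ᵥ u) = star (star u ⬝ᵥ (K *ᵥ u)) := by
    intro u
    rw [← star_dotProduct_star, star_star, star_mulVec, ← dotProduct_mulVec]
  have h1 : ∀ u : Fin L → ℂ, star u ⬝ᵥ ((K - Kᴴ) *ᵥ u) = (2 * (star u ⬝ᵥ (K *ᵥ u)).im : ℝ) * I := by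
    intro u
    rw [sub_mulVec, dotProduct_sub, h0]
    exact sub_conj _
  have h2 := form_eq_sum_polarVec (K - Kᴴ) v
  simp_rw [h1, ← mul_assoc] at h2
  rw [← Finset.sum_mul] at h2
  have h3 := congrArg re (mul_right_cancel₀ I_ne_zero h2)
  rw [ofReal_re, re_sum] at h3
  simp_rw [re_mul_ofReal] at h3
  have h4 : (2 : ℝ) * (star v ⬝ᵥ (K *ᵥ v)).im = 2 * ∑ p : Fin L × Fin L × Fin 4,
      (4⁻¹ * star (v p.1) * v p.2.1 * star (I ^ (p.2.2 : ℕ))).re *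
        (star (polarVec p) ⬝ᵥ (K *ᵥ polarVec p)).im := by
    rw [h3, Finset.mul_sum]
    exact Finset.sum_congr rfl fun p _ => by ring
  linarith

end Polarization

/-! ### Matrix-valued measures from scalar ones -/

namespace MatrixMeasure

open Complex Filter Topology

variable {L : ℕ} (ρ : MatrixMeasure L)

instance (f : Matrix (Fin L) (Fin L) ℂ →+ ℝ) (hf : Continuous f)
    (h0 : ∀ M : Matrix (Fin L) (Fin L) ℂ, M.PosSemidef → 0 ≤ f M) :
    IsFiniteMeasure (ρ.functional f hf h0) := by
  unfold functional
  infer_instance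

instance (v : Fin L → ℂ) : IsFiniteMeasure (ρ.quad v) := by
  unfold quad
  infer_instance

instance : IsFiniteMeasure ρ.trace := by
  unfold trace
  infer_instance

lemma functional_real (f : Matrix (Fin L) (Fin L) ℂ →+ ℝ) (hf : Continuous f)
    (h0 : ∀ M : Matrix (Fin L) (Fin L) ℂ, M.PosSemidef → 0 ≤ f M) {B : Set ℝ}
    (hB : MeasurableSet B) : (ρ.functional f hf h0).real B = f (ρ.toVectorMeasure B) := by
  rw [functional, SignedMeasure.toMeasureOfZeroLE_real_apply _ _ _ hB, Set.univ_inter,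
    VectorMeasure.mapRange_apply]

lemma quad_real (v : Fin L → ℂ) {B : Set ℝ} (hB : MeasurableSet B) :
    (ρ.quad v).real B = (star v ⬝ᵥ (ρ.toVectorMeasure B *ᵥ v)).re :=
  ρ.functional_real _ _ _ hB

lemma trace_real {B : Set ℝ} (hB : MeasurableSet B) :
    ρ.trace.real B = (ρ.toVectorMeasure B).trace.re :=
  ρ.functional_real _ _ _ hB

lemma trace_eq_sum_quad : ρ.trace = ∑ a, ρ.quad (Pi.single a 1) := by
  ext B hB
  rw [← ENNReal.toReal_eq_toReal_iff' (measure_ne_top _ _) (measure_ne_top _ _)]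
  change ρ.trace.real B = _
  rw [ρ.trace_real hB, Measure.finsetSum_apply, ENNReal.toReal_sum fun i _ => measure_ne_top _ _,
    Matrix.trace, re_sum]
  refine Finset.sum_congr rfl fun a _ => ?_
  change _ = (ρ.quad (Pi.single a 1)).real B
  rw [ρ.quad_real _ hB]
  simp

/-- A consistent family of scalar measures comes from a matrix-valued measure. -/
lemma exists_quad_eq {G : ℕ → ℂ → Matrix (Fin L) (Fin L) ℂ} (ν : (Fin L → ℂ) → Measure ℝ)
    [∀ v, IsFiniteMeasure (ν v)]
    (hG : ∀ z : ℂ, 0 < z.im → ∀ v,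
      Tendsto (fun M => star v ⬝ᵥ (G M z *ᵥ v)) atTop (𝓝 (stieltjes (ν v) z))) :
    ∃ ρ : MatrixMeasure L, ∀ v, ρ.quad v = ν v := by
  -- The `ν v` are not assumed to depend quadratically on `v`. This is inherited from the matrices
  -- `G M z` through their limits and the uniqueness of a measure with given transform.
  have hpol : ∀ (v : Fin L → ℂ) {B : Set ℝ}, MeasurableSet B → (ν v).real B =
      ∑ p : Fin L × Fin L × Fin 4, (4⁻¹ * star (v p.1) * v p.2.1 * star (I ^ (p.2.2 : ℕ))).re *
        (ν (polarVec p)).real B := by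
    intro v B hB
    refine measureReal_eq_sum_of_im_stieltjes_eq (ν v) (fun p => ν (polarVec p)) _ (fun z hz => ?_) B
    refine tendsto_nhds_unique ((continuous_im.tendsto _).comp (hG z hz v)) ?_
    have h1 := tendsto_finsetSum Finset.univ fun (p : Fin L × Fin L × Fin 4) _ =>
      ((continuous_im.tendsto _).comp (hG z hz (polarVec p))).const_mul
        (4⁻¹ * star (v p.1) * v p.2.1 * star (I ^ (p.2.2 : ℕ))).re
    refine h1.congr fun M => ?_
    exact (im_form_eq_sum_polarVec (G M z) v).symm
  let F : Fin L × Fin L × Fin 4 → ℝ →+ Matrix (Fin L) (Fin L) ℂ := fun p =>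
    { toFun := fun r => r • polarMat p
      map_zero' := zero_smul _ _
      map_add' := fun r s => add_smul r s _ }
  have hF : ∀ p, Continuous (F p) := fun p => continuous_id.smul continuous_const
  -- The form of `polarMat p` at `v` is exactly the coefficient of `ν (polarVec p)` in `hpol`, so
  -- the form of `V B` at `v` is `ν v B`; positivity follows.
  let V : VectorMeasure ℝ (Matrix (Fin L) (Fin L) ℂ) := ∑ p, (ν (polarVec p)).toSignedMeasure.mapRange (F p) (hF p)
  have hV : ∀ {B : Set ℝ}, MeasurableSet B → V B = ∑ p, (ν (polarVec p)).real B • polarMat p := by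
    intro B hB
    have h1 : V B = ∑ p, ((ν (polarVec p)).toSignedMeasure.mapRange (F p) (hF p)) B := by
      rw [FunLike.coe_sum, Finset.sum_apply]
    rw [h1]
    refine Finset.sum_congr rfl fun p _ => ?_
    rw [VectorMeasure.mapRange_apply, Measure.toSignedMeasure_apply_measurable hB]
    rfl
  have hform : ∀ {B : Set ℝ}, MeasurableSet B → ∀ v, star v ⬝ᵥ (V B *ᵥ v) = ((ν v).real B : ℂ) := by
    intro B hB v
    rw [hV hB, sum_mulVec, dotProduct_sum, hpol v hB, ofReal_sum]
    refine Finset.sum_congr rfl fun p _ => ?_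
    rw [smul_mulVec, dotProduct_smul, polarMat_form, real_smul, ofReal_mul, mul_comm]
  refine ⟨⟨V, fun B => ?_⟩, fun v => ?_⟩
  · by_cases hB : MeasurableSet B
    · refine PosSemidef.of_dotProduct_mulVec_nonneg ?_ fun v => ?_
      · rw [hV hB, IsHermitian, conjTranspose_sum]
        refine Finset.sum_congr rfl fun p _ => ?_
        rw [conjTranspose_smul, (polarMat_isHermitian p).eq, star_trivial]
      · rw [hform hB]
        exact_mod_cast measureReal_nonneg
    · rw [V.not_measurable hB]
      exact PosSemidef.zero
  · ext B hB
    rw [← ENNReal.toReal_eq_toReal_iff' (measure_ne_top _ _) (measure_ne_top _ _)]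
    change (quad _ v).real B = (ν v).real B
    rw [quad_real _ _ hB, hform hB, ofReal_re]

end MatrixMeasure

/-! ### Existence of the spectral measure of `H(μ)` -/

namespace MatrixJacobi

open Complex Filter Topology

variable {L : ℕ} (J : MatrixJacobi L) (N : ℕ) (W : ℕ → Matrix (Fin L) (Fin L) ℂ)
  (hW : ∀ n < N, (W n).PosSemidef)

include hW in
lemma exists_isSpectralMeasure (hJ : J.LimitPoint) (μ : ℝ) :
    ∃ ρ, IsSpectralMeasure (J.hamiltonian N W μ) ρ := by
  have hres : ∀ z : ℂ, ∃ R : JacobiSpace L →L[ℂ] JacobiSpace L,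
      0 < z.im → IsResolvent (J.hamiltonian N W μ) z R := by
    intro z
    by_cases hz : 0 < z.im
    · obtain ⟨R, hR⟩ := (J.hamiltonian_isSelfAdjoint N W hW hJ μ).exists_resolvent hz.ne'
      exact ⟨R, fun _ => hR⟩
    · exact ⟨0, fun h => absurd h hz⟩
  choose R hR using hres
  have hlim := fun (v : Fibre L) (z : ℂ) (hz : 0 < z.im) =>
    J.tendsto_truncGreen N W hW hJ μ hz (hR z hz) v
  choose ν hfin _ hst using fun v : Fin L → ℂ =>
    (J.perturb N W hW μ).exists_measure_of_tendsto_truncGreen (WithLp.toLp 2 v)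
      (G := fun z => inner ℂ (sitePi 0 (WithLp.toLp 2 v) : JacobiSpace L) (R z (sitePi 0 (WithLp.toLp 2 v))))
      (hlim (WithLp.toLp 2 v))
  obtain ⟨ρ, hρ⟩ := MatrixMeasure.exists_quad_eq ν (G := (J.perturb N W hW μ).truncGreen)
    fun z hz v => by
      rw [hst v z hz]
      exact hlim (WithLp.toLp 2 v) z hz
  refine ⟨ρ, fun z hz => ⟨R z, hR z hz, fun v => ?_⟩⟩
  rw [hρ]
  exact (hst v.ofLp z hz).symm

include hW in
lemma isSpectralMeasure_spectralMeasure (hJ : J.LimitPoint) (μ : ℝ) :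
    IsSpectralMeasure (J.hamiltonian N W μ) (spectralMeasure (J.hamiltonian N W μ)) := by
  have h := J.exists_isSpectralMeasure N W hW hJ μ
  rw [spectralMeasure, dif_pos h]
  exact h.choose_spec

lemma tendsto_trace_truncGreen (hJ : J.LimitPoint) (μ : ℝ) {z : ℂ} (hz : 0 < z.im) :
    Tendsto (fun M => ((J.perturb N W hW μ).truncGreen M z).trace) atTop
      (𝓝 (stieltjes (spectralMeasure (J.hamiltonian N W μ)).trace z)) := by
  obtain ⟨R, hR, hv⟩ := J.isSpectralMeasure_spectralMeasure N W hW hJ μ z hz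
  rw [MatrixMeasure.trace_eq_sum_quad, stieltjes,
    integral_finsetSum_measure fun i _ => integrable_inv_sub _ hz]
  have h1 := tendsto_finsetSum Finset.univ fun (a : Fin L) _ =>
    J.tendsto_truncGreen N W hW hJ μ hz hR (WithLp.toLp 2 (Pi.single a 1))
  simp_rw [hv] at h1
  refine h1.congr fun M => ?_
  rw [Matrix.trace]
  refine Finset.sum_congr rfl fun a _ => ?_
  simp

end MatrixJacobi

/-! ### Measurable families of measures and bounds on their averages -/

section Averaging

open Complex Filter Topology BoundedContinuousFunction
open scoped NNReal

lemma norm_stieltjes_le (ν : Measure ℝ) [IsFiniteMeasure ν] {z : ℂ} (hz : 0 < z.im) :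
    ‖stieltjes ν z‖ ≤ z.im⁻¹ * ν.real Set.univ :=
  norm_integral_le_of_norm_le_const (Eventually.of_forall (norm_inv_sub_le hz))

lemma abs_im_stieltjes_le (ν : Measure ℝ) [IsFiniteMeasure ν] {D : ℝ} (hD : ν.real Set.univ ≤ D)
    {ε : ℝ} (hε : 0 < ε) (a : ℝ) : |(stieltjes ν (a + ε * I)).im| ≤ ε⁻¹ * D := by
  have hz : 0 < ((a : ℂ) + ε * I).im := by simpa using hε
  have h1 := (abs_im_le_norm _).trans (norm_stieltjes_le ν hz)
  have h2 : ((a : ℂ) + ε * I).im = ε := by simp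
  rw [h2] at h1
  exact h1.trans (by gcongr)

/-- Inversion along `ε = 1 / (n + 1)` presents the integral as a pointwise limit of parameter
integrals of jointly measurable functions. -/
lemma measurable_integral_of_im_stieltjes {α : Type*} [MeasurableSpace α] {τ : α → Measure ℝ}
    [∀ a, IsFiniteMeasure (τ a)]
    (hτ : ∀ ε : ℝ, 0 < ε → Measurable fun p : α × ℝ => (stieltjes (τ p.1) (p.2 + ε * I)).im)
    {f : ℝ → ℝ} (hf : Continuous f) {C : ℝ} (hC : ∀ x, |f x| ≤ C) :
    Measurable fun a => ∫ x, f x ∂τ a := by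
  have hε : Tendsto (fun n : ℕ => 1 / ((n : ℝ) + 1)) atTop (𝓝[>] 0) :=
    tendsto_nhdsWithin_iff.mpr ⟨tendsto_one_div_add_atTop_nhds_zero_nat,
      Eventually.of_forall fun n => Set.mem_Ioi.mpr (by positivity)⟩
  refine measurable_of_tendsto_metrizable (f := fun (n : ℕ) a =>
    ∫ x : ℝ, f x * (Real.pi⁻¹ * (stieltjes (τ a) (x + (1 / ((n : ℝ) + 1) : ℝ) * I)).im))
    (fun n => ?_) (tendsto_pi_nhds.mpr fun a =>
      (tendsto_integral_mul_im_stieltjes (τ a) hf hC).comp hε)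
  have h1 := hτ (1 / ((n : ℝ) + 1)) (by positivity)
  have h2 : Measurable fun p : α × ℝ =>
      f p.2 * (Real.pi⁻¹ * (stieltjes (τ p.1) (p.2 + (1 / ((n : ℝ) + 1) : ℝ) * I)).im) :=
    (hf.measurable.comp measurable_snd).mul (h1.const_mul _)
  exact h2.stronglyMeasurable.integral_prod_right.measurable

/-- A family of measures depends measurably on a parameter if its Stieltjes transforms do. -/
lemma measurable_of_im_stieltjes {α : Type*} [MeasurableSpace α] {τ : α → Measure ℝ}
    [∀ a, IsFiniteMeasure (τ a)]
    (hτ : ∀ ε : ℝ, 0 < ε → Measurable fun p : α × ℝ => (stieltjes (τ p.1) (p.2 + ε * I)).im) :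
    Measurable τ := by
  refine Measurable.measure_of_isPiSystem (S := {s | IsClosed s})
    (by rw [BorelSpace.measurable_eq (α := ℝ), borel_eq_generateFrom_isClosed]) isPiSystem_isClosed
    (fun F hF => ?_) ?_
  · have hδ : ∀ n : ℕ, 0 < 1 / ((n : ℝ) + 1) := fun n => by positivity
    refine measurable_of_tendsto_metrizable (f := fun (n : ℕ) a =>
      ∫⁻ x, thickenedIndicator (hδ n) F x ∂τ a) (fun n => ?_) (tendsto_pi_nhds.mpr fun a =>
      tendsto_lintegral_thickenedIndicator_of_isClosed (τ a) hF hδ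
        tendsto_one_div_add_atTop_nhds_zero_nat)
    have h1 : ∀ a, ∫⁻ x, thickenedIndicator (hδ n) F x ∂τ a =
        ENNReal.ofReal (∫ x, (thickenedIndicator (hδ n) F x : ℝ) ∂τ a) := fun a =>
      lintegral_coe_eq_integral _ (integrable_thickenedIndicator F (hδ n))
    simp_rw [h1]
    refine (measurable_integral_of_im_stieltjes hτ
      (NNReal.continuous_coe.comp (thickenedIndicator (hδ n) F).continuous) (C := 1)
      fun x => ?_).ennreal_ofReal
    rw [Function.comp_apply, NNReal.abs_eq]
    exact_mod_cast thickenedIndicator_le_one (hδ n) F x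
  · have h1 := (measurable_integral_of_im_stieltjes hτ (f := fun _ => (1 : ℝ)) continuous_const
      (C := 1) (by simp)).ennreal_ofReal
    simpa [measureReal_def] using h1

/-- Comparison of the integrals of continuous functions supported in an open set gives comparison of
the measures on that set. -/
lemma restrict_le_restrict_of_lintegral_le {α β : Measure ℝ} [α.InnerRegularCompactLTTop]
    [β.OuterRegular] {U : Set ℝ} (hU : IsOpen U) (hα : α U ≠ ∞)
    (h : ∀ f : ℝ → ℝ, Continuous f → (∀ x, f x ∈ Set.Icc (0 : ℝ) 1) → (∀ x ∉ U, f x = 0) →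
      ∫⁻ x, ENNReal.ofReal (f x) ∂α ≤ ∫⁻ x, ENNReal.ofReal (f x) ∂β) :
    α.restrict U ≤ β.restrict U := by
  refine Measure.le_iff.mpr fun B hB => ?_
  rw [Measure.restrict_apply hB, Measure.restrict_apply hB]
  have hBU := hB.inter hU.measurableSet
  have hfin : α (B ∩ U) ≠ ∞ := measure_ne_top_of_subset Set.inter_subset_right hα
  -- Approximate from inside by a compact `K` for `α` and from outside by an open `O` for `β`; a
  -- Urysohn function equal to one on `K` and supported in `O ∩ U` separates the two.
  rw [hBU.measure_eq_iSup_isCompact_of_ne_top hfin, (B ∩ U).measure_eq_iInf_isOpen β]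
  refine iSup₂_le fun K hK => iSup_le fun hKc => le_iInf₂ fun O hO => le_iInf fun hOo => ?_
  obtain ⟨f, hf0, hf1, hf⟩ := exists_continuous_zero_one_of_isClosed (hOo.inter hU).isClosed_compl
    hKc.isClosed (Set.disjoint_left.mpr fun x hx hxK => hx ⟨hO (hK hxK), (hK hxK).2⟩)
  calc α K = ∫⁻ x in K, 1 ∂α := by simp
    _ ≤ ∫⁻ x in K, ENNReal.ofReal (f x) ∂α := by
      refine setLIntegral_mono' hKc.measurableSet fun x hx => ?_
      rw [hf1 hx]
      simp
    _ ≤ ∫⁻ x, ENNReal.ofReal (f x) ∂α := setLIntegral_le_lintegral _ _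
    _ ≤ ∫⁻ x, ENNReal.ofReal (f x) ∂β := h f f.continuous hf fun x hx => hf0 fun hx' => hx hx'.2
    _ ≤ ∫⁻ x, O.indicator 1 x ∂β := by
      refine lintegral_mono fun x => ?_
      by_cases hx : x ∈ O
      · rw [Set.indicator_of_mem hx]
        exact ENNReal.ofReal_le_one.mpr (hf x).2
      · rw [hf0 fun hx' => hx hx'.1]
        simp
    _ = β O := lintegral_indicator_one hOo.measurableSet

/-- If the averaged Stieltjes transform has imaginary part between `c` and `C` near `E`, then the
averaged measure has a density between `c / π` and `C / π` near `E`. -/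
lemma exists_restrict_bind_bounds {τ : ℝ → Measure ℝ} [∀ μ, IsFiniteMeasure (τ μ)]
    (hτ : ∀ ε : ℝ, 0 < ε → Measurable fun p : ℝ × ℝ => (stieltjes (τ p.1) (p.2 + ε * I)).im)
    {D : ℝ} (hD : ∀ μ, (τ μ).real Set.univ ≤ D) {μ₀ μ₁ : ℝ} (hμ : μ₀ ≤ μ₁) {c C E : ℝ} (hc : 0 < c) (hC : 0 < C)
    (h : ∀ᶠ p : ℝ × ℝ in 𝓝 E ×ˢ 𝓝[>] 0,
      c ≤ ∫ μ in μ₀..μ₁, (stieltjes (τ μ) (p.1 + p.2 * I)).im ∧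
      ∫ μ in μ₀..μ₁, (stieltjes (τ μ) (p.1 + p.2 * I)).im ≤ C) :
    ∃ U : Set ℝ, IsOpen U ∧ E ∈ U ∧
      ENNReal.ofReal (c * Real.pi⁻¹) • volume.restrict U ≤
        ((volume.restrict (Set.Icc μ₀ μ₁)).bind τ).restrict U ∧
      ((volume.restrict (Set.Icc μ₀ μ₁)).bind τ).restrict U ≤
        ENNReal.ofReal (C * Real.pi⁻¹) • volume.restrict U := by
  have hmeas := measurable_of_im_stieltjes hτ
  have hD0 : 0 ≤ D := measureReal_nonneg.trans (hD 0)
  set κ := (volume.restrict (Set.Icc μ₀ μ₁)).bind τ with hκ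
  obtain ⟨pa, hpa, pb, hpb, hp⟩ := eventually_prod_iff.mp h
  obtain ⟨η, hη, hball⟩ := Metric.eventually_nhds_iff_ball.mp hpa
  have hfinite : IsFiniteMeasure κ := by
    refine ⟨?_⟩
    rw [hκ, Measure.bind_apply MeasurableSet.univ hmeas.aemeasurable]
    calc _ ≤ ∫⁻ μ in Set.Icc μ₀ μ₁, ENNReal.ofReal D := by
          refine lintegral_mono fun μ => ?_
          rw [← ENNReal.ofReal_toReal (measure_ne_top (τ μ) _)]
          exact ENNReal.ofReal_le_ofReal (hD μ)
      _ < ∞ := by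
          rw [lintegral_const]
          exact ENNReal.mul_lt_top ENNReal.ofReal_lt_top (by simp)
  have key : ∀ f : ℝ → ℝ, Continuous f → (∀ x, f x ∈ Set.Icc (0 : ℝ) 1) →
      (∀ x ∉ Metric.ball E η, f x = 0) → Integrable f ∧
      ∃ Λ : ℝ, ∫⁻ x, ENNReal.ofReal (f x) ∂κ = ENNReal.ofReal Λ ∧
        c * Real.pi⁻¹ * (∫ x, f x) ≤ Λ ∧ Λ ≤ C * Real.pi⁻¹ * ∫ x, f x := by
    intro f hf hf01 hfU
    have hf1 : ∀ x, |f x| ≤ 1 := fun x => abs_le.mpr ⟨by linarith [(hf01 x).1], (hf01 x).2⟩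
    have hfi : Integrable f := by
      refine hf.integrable_of_hasCompactSupport (HasCompactSupport.intro
        (isCompact_closedBall E η) fun x hx => hfU x fun hx' => hx (Metric.ball_subset_closedBall hx'))
    have hFm : Measurable fun μ => ∫ x, f x ∂τ μ := measurable_integral_of_im_stieltjes hτ hf hf1
    have hFD : ∀ μ, ‖∫ x, f x ∂τ μ‖ ≤ D := fun μ => by
      have := norm_integral_le_of_norm_le_const (μ := τ μ) (f := f) (C := 1)
        (Eventually.of_forall hf1)
      rw [one_mul] at this
      exact this.trans (hD μ)
    refine ⟨hfi, ∫ μ in Set.Icc μ₀ μ₁, ∫ x, f x ∂τ μ, ?_, ?_⟩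
    · rw [hκ, Measure.lintegral_bind hmeas.aemeasurable hf.measurable.ennreal_ofReal.aemeasurable]
      have e : ∀ μ, ∫⁻ x, ENNReal.ofReal (f x) ∂τ μ = ENNReal.ofReal (∫ x, f x ∂τ μ) := fun μ =>
        (ofReal_integral_eq_lintegral_ofReal (Integrable.of_bound hf.aestronglyMeasurable 1
          (Eventually.of_forall hf1)) (Eventually.of_forall fun x => (hf01 x).1)).symm
      simp_rw [e]
      refine (ofReal_integral_eq_lintegral_ofReal (Integrable.of_bound hFm.aestronglyMeasurable D
        (Eventually.of_forall hFD)) (Eventually.of_forall fun μ => ?_)).symm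
      exact integral_nonneg fun x => (hf01 x).1
    · have hprod : ∀ ε : ℝ, 0 < ε → Integrable (fun p : ℝ × ℝ =>
          f p.2 * (Real.pi⁻¹ * (stieltjes (τ p.1) (p.2 + ε * I)).im))
          ((volume.restrict (Set.Icc μ₀ μ₁)).prod volume) := by
        intro ε hε
        have hb : Integrable (fun p : ℝ × ℝ => (Real.pi⁻¹ * (ε⁻¹ * D)) * |f p.2|)
            ((volume.restrict (Set.Icc μ₀ μ₁)).prod volume) :=
          (integrable_const (μ := volume.restrict (Set.Icc μ₀ μ₁)) (Real.pi⁻¹ * (ε⁻¹ * D))).mul_prod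
            hfi.abs
        refine hb.mono' (((hf.measurable.comp measurable_snd).mul
          ((hτ ε hε).const_mul _)).aestronglyMeasurable) (Eventually.of_forall fun p => ?_)
        have hpi := inv_pos.mpr Real.pi_pos
        rw [norm_mul, norm_mul, Real.norm_eq_abs, Real.norm_eq_abs, Real.norm_eq_abs,
          abs_of_pos hpi, mul_comm]
        gcongr
        exact abs_im_stieltjes_le _ (hD _) hε _
      have hlim : Tendsto (fun ε : ℝ => ∫ μ in Set.Icc μ₀ μ₁, ∫ a : ℝ,
          f a * (Real.pi⁻¹ * (stieltjes (τ μ) (a + ε * I)).im)) (𝓝[>] 0)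
          (𝓝 (∫ μ in Set.Icc μ₀ μ₁, ∫ x, f x ∂τ μ)) := by
        refine tendsto_integral_filter_of_dominated_convergence (fun _ => D) ?_ ?_
          (integrable_const D) (Eventually.of_forall fun μ =>
            tendsto_integral_mul_im_stieltjes (τ μ) hf hf1)
        · filter_upwards [self_mem_nhdsWithin] with ε hε
          exact (hprod ε hε).integral_prod_left.aestronglyMeasurable
        · filter_upwards [self_mem_nhdsWithin] with ε hε
          refine Eventually.of_forall fun μ => ?_
          have := abs_integral_mul_im_stieltjes_le (τ μ) hf hf1 hε
          rw [one_mul] at this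
          exact this.trans (hD μ)
      have hbd : ∀ᶠ ε : ℝ in 𝓝[>] 0, c * Real.pi⁻¹ * (∫ x, f x) ≤
          ∫ μ in Set.Icc μ₀ μ₁, ∫ a : ℝ, f a * (Real.pi⁻¹ * (stieltjes (τ μ) (a + ε * I)).im) ∧
          ∫ μ in Set.Icc μ₀ μ₁, ∫ a : ℝ, f a * (Real.pi⁻¹ * (stieltjes (τ μ) (a + ε * I)).im) ≤
            C * Real.pi⁻¹ * ∫ x, f x := by
        filter_upwards [self_mem_nhdsWithin, hpb] with ε hε hpε
        -- After the exchange, the inner `μ`-integral at `a` is bounded by hypothesis for `a` in the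
        -- ball, and `f` vanishes elsewhere.
        rw [integral_integral_swap (hprod ε hε)]
        have hi := (hprod ε hε).integral_prod_right
        simp_rw [integral_const_mul] at hi ⊢
        rw [← integral_const_mul, ← integral_const_mul]
        have hpt : ∀ a, c * Real.pi⁻¹ * f a ≤ f a * (Real.pi⁻¹ *
            ∫ μ in Set.Icc μ₀ μ₁, (stieltjes (τ μ) (a + ε * I)).im) ∧
            f a * (Real.pi⁻¹ * ∫ μ in Set.Icc μ₀ μ₁, (stieltjes (τ μ) (a + ε * I)).im) ≤
            C * Real.pi⁻¹ * f a := by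
          intro a
          by_cases ha : a ∈ Metric.ball E η
          · have h1 := hp (hball a ha) hpε
            simp only [intervalIntegral.integral_of_le hμ, ← integral_Icc_eq_integral_Ioc] at h1
            have hw : 0 ≤ f a * Real.pi⁻¹ := mul_nonneg (hf01 a).1 (inv_pos.mpr Real.pi_pos).le
            constructor
            · linarith [mul_le_mul_of_nonneg_left h1.1 hw]
            · linarith [mul_le_mul_of_nonneg_left h1.2 hw]
          · rw [hfU a ha]
            simp
        exact ⟨integral_mono (hfi.const_mul _) hi fun a => (hpt a).1,
          integral_mono hi (hfi.const_mul _) fun a => (hpt a).2⟩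
      exact ⟨ge_of_tendsto hlim (hbd.mono fun _ h => h.1),
        le_of_tendsto hlim (hbd.mono fun _ h => h.2)⟩
  have hvol : ∀ {f : ℝ → ℝ}, Integrable f → (∀ x, f x ∈ Set.Icc (0 : ℝ) 1) → ∀ r : ℝ≥0,
      ∫⁻ x, ENNReal.ofReal (f x) ∂(r • volume : Measure ℝ) = ENNReal.ofReal (r * ∫ x, f x) := by
    intro f hfi hf01 r
    rw [lintegral_smul_measure, ← ofReal_integral_eq_lintegral_ofReal hfi
      (Eventually.of_forall fun x => (hf01 x).1), ENNReal.ofReal_mul r.coe_nonneg]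
    simp [ENNReal.smul_def]
  refine ⟨Metric.ball E η, Metric.isOpen_ball, Metric.mem_ball_self hη, ?_, ?_⟩
  · rw [← Measure.restrict_smul]
    refine restrict_le_restrict_of_lintegral_le
      (α := (c * Real.pi⁻¹).toNNReal • (volume : Measure ℝ)) Metric.isOpen_ball ?_ fun f hf hf01 hfU => ?_
    · rw [Measure.smul_apply]
      exact ENNReal.mul_ne_top ENNReal.coe_ne_top measure_ball_lt_top.ne
    · obtain ⟨hfi, Λ, h1, h2, -⟩ := key f hf hf01 hfU
      rw [hvol hfi hf01, h1]
      refine ENNReal.ofReal_le_ofReal (le_of_eq_of_le ?_ h2)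
      rw [Real.coe_toNNReal _ (by have := Real.pi_pos; positivity)]
  · rw [← Measure.restrict_smul]
    refine restrict_le_restrict_of_lintegral_le
      (β := (C * Real.pi⁻¹).toNNReal • (volume : Measure ℝ)) Metric.isOpen_ball
      (measure_ne_top _ _) fun f hf hf01 hfU => ?_
    obtain ⟨hfi, Λ, h1, -, h3⟩ := key f hf hf01 hfU
    rw [hvol hfi hf01, h1]
    refine ENNReal.ofReal_le_ofReal (h3.trans_eq ?_)
    rw [Real.coe_toNNReal _ (by have := Real.pi_pos; positivity)]

end Averaging

/-! ### Passage to the limit of infinitely many sites -/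

namespace MatrixJacobi

open Complex Filter Topology

variable {L : ℕ} (J : MatrixJacobi L) (N : ℕ) (W : ℕ → Matrix (Fin L) (Fin L) ℂ)
  (hW : ∀ n < N, (W n).PosSemidef)

include hW in
-- For a unit vector, the truncations produce a measure of mass at most one with the same transform,
-- and the transform determines the measure. The bound is uniform in `μ`, as domination in the
-- averaging argument requires.
lemma trace_spectralMeasure_real_univ_le (hJ : J.LimitPoint) (μ : ℝ) :
    (spectralMeasure (J.hamiltonian N W μ)).trace.real Set.univ ≤ L := by
  set ρ := spectralMeasure (J.hamiltonian N W μ)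
  have hquad : ∀ a : Fin L, (ρ.quad (Pi.single a 1)).real Set.univ ≤ 1 := by
    intro a
    obtain ⟨ν, hfin, hmass, hst⟩ := (J.perturb N W hW μ).exists_measure_of_tendsto_truncGreen
      (WithLp.toLp 2 (Pi.single a 1)) (G := fun z => stieltjes (ρ.quad (Pi.single a 1)) z)
      fun z hz => by
        obtain ⟨R, hR, hv⟩ := J.isSpectralMeasure_spectralMeasure N W hW hJ μ z hz
        have h1 := J.tendsto_truncGreen N W hW hJ μ hz hR (WithLp.toLp 2 (Pi.single a 1))
        rw [hv] at h1
        exact h1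
    have h1 := measureReal_eq_sum_of_im_stieltjes_eq (ι := Unit) (ρ.quad (Pi.single a 1))
      (fun _ => ν) (fun _ => 1) (fun z hz => by simp [hst z hz]) Set.univ
    simp only [Finset.univ_unique, Finset.sum_singleton, one_mul] at h1
    rw [h1]
    refine hmass.trans_eq ?_
    rw [EuclideanSpace.norm_sq_eq]
    simp [Pi.single_apply, apply_ite]
  rw [MatrixMeasure.trace_eq_sum_quad, measureReal_def, Measure.finsetSum_apply,
    ENNReal.toReal_sum fun i _ => measure_ne_top _ _]
  calc _ ≤ ∑ _a : Fin L, (1 : ℝ) := Finset.sum_le_sum fun a _ => hquad a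
    _ = L := by simp

lemma norm_trace_truncGreen_le (M : ℕ) {z : ℂ} (hz : 0 < z.im) :
    ‖(J.truncGreen M z).trace‖ ≤ L / z.im := by
  have h1 : (J.truncGreen M z).trace = ∑ a, star (Pi.single a 1 : Fin L → ℂ) ⬝ᵥ
      (J.truncGreen M z *ᵥ Pi.single a 1) := by
    rw [Matrix.trace]
    exact Finset.sum_congr rfl fun a _ => by simp
  rw [h1]
  calc _ ≤ ∑ _a : Fin L, 1 / z.im := by
        refine (norm_sum_le _ _).trans (Finset.sum_le_sum fun a _ => ?_)
        refine (J.norm_truncGreen_form_le M hz (WithLp.toLp 2 (Pi.single a 1))).trans_eq ?_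
        rw [EuclideanSpace.norm_sq_eq]
        simp [Pi.single_apply, apply_ite]
    _ = _ := by simp [div_eq_mul_inv]

lemma continuous_trace_truncGreen (M : ℕ) {ε : ℝ} (hε : 0 < ε) :
    Continuous fun p : ℝ × ℝ => ((J.perturb N W hW p.1).truncGreen M (p.2 + ε * I)).trace := by
  have h1 := (J.continuous_trunc_perturb N W hW M).comp (continuous_fst (X := ℝ) (Y := ℝ))
  have h2 : Continuous fun p : ℝ × ℝ => ((J.perturb N W hW p.1).trunc M -
      ((p.2 : ℂ) + ε * I) • (1 : Matrix (Fin M × Fin L) (Fin M × Fin L) ℂ)) :=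
    h1.sub (by fun_prop)
  have h3 := continuous_inv_of_isUnit_det h2 fun p =>
    (J.perturb N W hW p.1).trunc_sub_smul_one_isUnit_det M (z := (p.2 : ℂ) + ε * I) (by simpa using hε)
  exact ((continuous_const.matrix_mul h3).matrix_mul continuous_const).matrix_trace

include hW in
-- Pointwise limit, as `M → ∞`, of functions that are jointly continuous in the coupling and the
-- energy.
lemma measurable_im_stieltjes_trace (hJ : J.LimitPoint) {ε : ℝ} (hε : 0 < ε) :
    Measurable fun p : ℝ × ℝ =>
      (stieltjes (spectralMeasure (J.hamiltonian N W p.1)).trace (p.2 + ε * I)).im :=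
  measurable_of_tendsto_metrizable
    (fun M => (continuous_im.comp (J.continuous_trace_truncGreen N W hW M hε)).measurable)
    (tendsto_pi_nhds.mpr fun p => (continuous_im.tendsto _).comp
      (J.tendsto_trace_truncGreen N W hW hJ p.1 (by simpa using hε)))

include hW in
/-- Bounds near the real axis for the averaged Stieltjes transform of the spectral measure. -/
lemma exists_bounds_integral_stieltjes (hL : 0 < L) (hJ : J.LimitPoint)
    (hWpos : ∃ n, n + 1 < N ∧ (W n).PosDef ∧ (W (n + 1)).PosDef)
    (μ₀ μ₁ E : ℝ) (hμ : μ₀ ≤ μ₁) (hpass : 2 * L ≤ J.passingEigenvalues N W hW μ₀ μ₁ E) :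
    ∃ c > 0, ∃ C > 0, ∀ᶠ p : ℝ × ℝ in 𝓝 E ×ˢ 𝓝[>] 0,
      c ≤ ∫ μ in μ₀..μ₁,
        (stieltjes (spectralMeasure (J.hamiltonian N W μ)).trace (p.1 + p.2 * I)).im ∧
      ∫ μ in μ₀..μ₁,
        (stieltjes (spectralMeasure (J.hamiltonian N W μ)).trace (p.1 + p.2 * I)).im ≤ C := by
  obtain ⟨c, hc, C, hC, h⟩ :=
    J.exists_bounds_integral_truncGreen N W hW hL hWpos μ₀ μ₁ E hμ hpass
  refine ⟨c, hc, C, hC, ?_⟩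
  have hpos : ∀ᶠ p : ℝ × ℝ in 𝓝 E ×ˢ 𝓝[>] 0, 0 < p.2 := tendsto_snd.eventually self_mem_nhdsWithin
  filter_upwards [h, hpos] with p hp hε
  have hz : 0 < ((p.1 : ℂ) + p.2 * I).im := by simpa using hε
  have hlim : Tendsto (fun M => ∫ μ in μ₀..μ₁,
      ((J.perturb N W hW μ).truncGreen M ((p.1 : ℂ) + p.2 * I)).trace.im) atTop
      (𝓝 (∫ μ in μ₀..μ₁,
        (stieltjes (spectralMeasure (J.hamiltonian N W μ)).trace (p.1 + p.2 * I)).im)) := by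
    refine intervalIntegral.tendsto_integral_filter_of_dominated_convergence
      (fun _ => L / ((p.1 : ℂ) + p.2 * I).im) (Eventually.of_forall fun M => ?_)
      (Eventually.of_forall fun M => Eventually.of_forall fun μ _ =>
        (abs_im_le_norm _).trans ((J.perturb N W hW μ).norm_trace_truncGreen_le M hz))
      (by simp) (Eventually.of_forall fun μ _ => (continuous_im.tendsto _).comp
        (J.tendsto_trace_truncGreen N W hW hJ μ hz))
    have h1 : Continuous fun μ : ℝ => (μ, p.1) := by fun_prop
    exact (continuous_im.comp ((J.continuous_trace_truncGreen N W hW M hε).comp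
      h1)).aestronglyMeasurable
  have hM := (eventually_gt_atTop N).mono fun M hM => hp M hM
  exact ⟨ge_of_tendsto hlim (hM.mono fun _ h => h.1), le_of_tendsto hlim (hM.mono fun _ h => h.2)⟩

end MatrixJacobi

end
theorem theorem4 {L : ℕ} (hL : 0 < L) (J : MatrixJacobi L) (hJ : J.LimitPoint)
    (N : ℕ) (W : ℕ → Matrix (Fin L) (Fin L) ℂ) (hW : ∀ n < N, (W n).PosSemidef)
    (hWpos : ∃ n, n + 1 < N ∧ (W n).PosDef ∧ (W (n + 1)).PosDef)
    (μ₀ μ₁ E : ℝ) (hμ : μ₀ ≤ μ₁)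
    (hpass : 2 * L ≤ J.passingEigenvalues N W hW μ₀ μ₁ E) :
    (∀ μ : ℝ, IsSelfAdjoint (J.hamiltonian N W μ) ∧
      IsSpectralMeasure (J.hamiltonian N W μ) (spectralMeasure (J.hamiltonian N W μ))) ∧
    Measurable (fun μ : ℝ => (spectralMeasure (J.hamiltonian N W μ)).trace) ∧
    ∃ U : Set ℝ, IsOpen U ∧ E ∈ U ∧
      (averagedSpectralMeasure J N W μ₀ μ₁).restrict U ≪ volume.restrict U ∧
      volume.restrict U ≪ (averagedSpectralMeasure J N W μ₀ μ₁).restrict U ∧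
      ∃ c C : ℝ, 0 < c ∧ 0 < C ∧
        ENNReal.ofReal c • volume.restrict U ≤ (averagedSpectralMeasure J N W μ₀ μ₁).restrict U ∧
        (averagedSpectralMeasure J N W μ₀ μ₁).restrict U ≤ ENNReal.ofReal C • volume.restrict U := by
  refine ⟨fun μ => ⟨J.hamiltonian_isSelfAdjoint N W hW hJ μ,
    J.isSpectralMeasure_spectralMeasure N W hW hJ μ⟩, ?_, ?_⟩
  · exact measurable_of_im_stieltjes fun ε hε => J.measurable_im_stieltjes_trace N W hW hJ hε
  · obtain ⟨c, hc, C, hC, h⟩ :=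
      J.exists_bounds_integral_stieltjes N W hW hL hJ hWpos μ₀ μ₁ E hμ hpass
    obtain ⟨U, hU, hEU, h1, h2⟩ := exists_restrict_bind_bounds
      (fun ε hε => J.measurable_im_stieltjes_trace N W hW hJ hε)
      (J.trace_spectralMeasure_real_univ_le N W hW hJ) hμ hc hC h
    have hpi := inv_pos.mpr Real.pi_pos
    have hc' : ENNReal.ofReal (c * Real.pi⁻¹) ≠ 0 :=
      (ENNReal.ofReal_pos.mpr (mul_pos hc hpi)).ne'
    refine ⟨U, hU, hEU, Measure.absolutelyContinuous_of_le_smul h2, ?_, c * Real.pi⁻¹,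
      C * Real.pi⁻¹, mul_pos hc hpi, mul_pos hC hpi, h1, h2⟩
    exact (Measure.absolutelyContinuous_smul hc').trans (Measure.absolutelyContinuous_of_le h1)
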